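/- **Setting.** A metric graph $\mathcal G$ consists of vertices and edges; each edge $e$ is identified with $[0,|e|]$ ($|e|<\infty$, bounded edge, possibly a loop) or with $[0,\infty)$ (half-line), glued together at the vertices. The degree of a vertex is the number of edge ends at it (a loop counts twice). $\mathcal G$ is in the class $\mathbf G$ if it is connected, has at most countably many edges, every vertex has finite degree, and $\inf_e|e|>0$. A *pendant* is a bounded edge with a vertex of degree $1$. A *signpost* is the union of a loop and a bounded edge glued at a common vertex to which no other edge is attached (so this vertex has degree $3$). The real line $\mathbb R$ is regarded as the graph of two half-lines glued at one vertex, and $\mathbb R^+$ as the graph of one half-line. $H^1(\mathcal G)$ is the space of real functions that are continuous on $\mathcal G$, belong to $L^2(\mathcal G)$, and are absolutely continuous on each edge, with $u'\in L^2(\mathcal G)$. For $\mu>0$ let $H^1_\mu(\mathcal G)=\{u\in H^1(\mathcal G):\|u\|_2^2=\mu\}$, with the $H^1$ topology. For $p>6$, $\rho\in[1/2,1]$ and $\delta>0$ put $$E_\rho(u,\mathcal G)=\tfrac12\|u'\|_2^2-\tfrac{\rho}{p}\|u\|_p^p,\quad A_\delta=\{u\in H^1_\mu(\mathcal G):\|u'\|_2^2\le\delta\},\quad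 B=\{u\in H^1_\mu(\mathcal G):E_{1/2}(u,\mathcal G)<0\},$$ $$c_\rho(\mathcal G)=c_{\rho,\delta}(\mathcal G)=\inf_{\gamma\in\Gamma}\max_{t\in[0,1]}E_\rho(\gamma(t),\mathcal G),\qquad \Gamma=\{\gamma\in C([0,1],H^1_\mu(\mathcal G)):\gamma(0)\in A_\delta,\ \gamma(1)\in B\}.$$ Here $\delta$ may depend on $\mathcal G,p,\mu$ but not on $\rho$. Call $\delta$ *admissible* for $\mathcal G,p,\mu$ if $A_\delta\ne\emptyset$ and $c_{\rho,\delta}(\mathcal G)>\max\{\sup_{A_\delta}E_\rho,\sup_BE_\rho\}$ for every $\rho\in[1/2,1]$. **Proposition.** Let $p>6$. For every $\mu>0$ there are admissible $\delta$ for $\mathbb R$ and for $\mathbb R^+$. Let $\mathcal G\in\mathbf G$. 1. For every $\varepsilon>0$ there is $\mu_0>0$, depending only on $\mathcal G,p,\varepsilon$, such that for every $\mu\in(0,\mu_0]$ and every $\rho\in[1/2,1]$ $$c_\rho(\mathcal G)\le(1+\varepsilon)\,c_\rho(\mathbb R).$$ That is, $c_\rho(\mathcal G)\le c_\rho(\mathbb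 R)+o(c_\rho(\mathbb R))$ as $\mu\to0$, uniformly for $\rho\in[1/2,1]$. 2. If $\mathcal G$ has a pendant, then for every $\varepsilon>0$ there is $\mu_0>0$, depending only on $\mathcal G,p,\varepsilon$, such that for every $\mu\in(0,\mu_0]$ and every $\rho\in[1/2,1]$ $$c_\rho(\mathcal G)\le(1+\varepsilon)\,c_\rho(\mathbb R^+).$$ That is, $c_\rho(\mathcal G)\le c_\rho(\mathbb R^+)+o(c_\rho(\mathbb R^+))$ as $\mu\to0$, uniformly for $\rho\in[1/2,1]$. 3. If $\mathcal G$ has a signpost, there is $\mu_0>0$, depending only on $\mathcal G,p$, such that for every $\mu\in(0,\mu_0]$ and every $\rho\in[1/2,1]$ $$c_\rho(\mathcal G)<c_\rho(\mathbb R).$$ In 1–3, $c_\rho(\mathbb R)$ and $c_\rho(\mathbb R^+)$ are taken with any admissible $\delta$ for $\mathbb R$, respectively $\mathbb R^+$, and $c_\rho(\mathcal G)$ with any $\delta>0$ for which $A_\delta\subset H^1_\mu(\mathcal G)$ is nonempty (in particular with any admissible one); $\mu_0$ does not depend on these choices. -/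

import Mathlib

open MeasureTheory Set

universe u v

noncomputable section

/-- A metric graph. The edge `e` is identified with the interval `[0, len e]` if `len e < ⊤` and
with the half-line `[0, ⊤)` if `len e = ⊤`. The point `0` of `e` is the vertex `src e`; a bounded
edge has a second end, the point `len e`, which is the vertex `tgt e`. Loops (`src e = tgt e`) and
multiple edges are allowed. -/
structure MetricGraph : Type (max (u + 1) (v + 1)) where
  V : Type u
  E : Type v
  len : E → ENNReal
  len_pos : ∀ e, 0 < len e
  src : E → V
  tgt : (e : E) → len e ≠ ⊤ → V

namespace MetricGraph

/-- The real line: two half-lines glued together at one vertex. -/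
def line : MetricGraph.{0, 0} where
  V := Unit
  E := Bool
  len := fun _ => ⊤
  len_pos := fun _ => ENNReal.zero_lt_top
  src := fun _ => ()
  tgt := fun _ _ => ()

/-- The half-line `[0, ∞)`: one unbounded edge and one vertex. -/
def halfLine : MetricGraph.{0, 0} where
  V := Unit
  E := Unit
  len := fun _ => ⊤
  len_pos := fun _ => ENNReal.zero_lt_top
  src := fun _ => ()
  tgt := fun _ _ => ()

variable (G : MetricGraph.{u, v})

/-- The set of ends of edges at the vertex `v`, counted with multiplicity (a loop counts twice). -/
def degree (v : G.V) : ℕ∞ :=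
  {e : G.E | G.src e = v}.encard + {e : G.E | ∃ h : G.len e ≠ ⊤, G.tgt e h = v}.encard

/-- `v` is an endpoint of the edge `e`. -/
def IsEndpoint (e : G.E) (v : G.V) : Prop :=
  G.src e = v ∨ ∃ h : G.len e ≠ ⊤, G.tgt e h = v

/-- `e` is a (bounded) loop at `v`: both of its ends are the vertex `v`. -/
def IsLoopAt (e : G.E) (v : G.V) : Prop :=
  G.src e = v ∧ ∃ h : G.len e ≠ ⊤, G.tgt e h = v

/-- The class of connected metric graphs with at most countably many edges, finite degrees, and
edge lengths bounded away from zero. -/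
structure InClassG : Prop where
  connected : ∀ v w : G.V,
    Relation.EqvGen (fun a b => ∃ (e : G.E) (h : G.len e ≠ ⊤), G.src e = a ∧ G.tgt e h = b) v w
  countable : Countable G.E
  degree_lt_top : ∀ v : G.V, G.degree v < ⊤
  len_bound : 0 < ⨅ e : G.E, G.len e

/-- A pendant: a bounded edge with a vertex of degree one. -/
def HasPendant : Prop :=
  ∃ (e : G.E) (v : G.V), G.len e ≠ ⊤ ∧ G.IsEndpoint e v ∧ G.degree v = 1

/-- A signpost: a loop and a bounded edge glued together at a common vertex `v`, at which no other
edge is attached (so that `v` has degree `2 + 1`, and the bounded edge is not itself a loop). -/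
def HasSignpost : Prop :=
  ∃ (l b : G.E) (v : G.V), G.IsLoopAt l v ∧ G.len b ≠ ⊤ ∧ b ≠ l ∧ G.IsEndpoint b v ∧
    G.degree v = 3

/-- The interval `[0, len e]` (or `[0, ∞)`) of coordinates along the edge `e`. -/
def interval (e : G.E) : Set ℝ :=
  {x | 0 ≤ x ∧ ENNReal.ofReal x ≤ G.len e}

instance instMeasurableSpaceEdge : MeasurableSpace G.E := ⊤

/-- Lebesgue measure on the graph: the sum of the Lebesgue measures of the edges. The pair `(e, x)`
stands for the point of coordinate `x` on the edge `e`. -/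
def edgeMeasure : Measure (G.E × ℝ) :=
  Measure.sum fun e => (volume.restrict (G.interval e)).map (Prod.mk e)

/-- The space `L²(G)`. -/
abbrev L2 : Type v := Lp ℝ 2 G.edgeMeasure

/-- `f` is a continuous function on the graph whose restriction to each edge is absolutely
continuous with derivative `g`. The number `c v` is the value of `f` at the vertex `v`, so that
the values of `f` at all the edge ends glued at `v` agree. -/
def IsPrimitive (f g : G.E × ℝ → ℝ) : Prop :=
  ∃ c : G.V → ℝ, ∀ e : G.E,
    (∀ x ∈ G.interval e, f (e, x) = c (G.src e) + ∫ t in (0 : ℝ)..x, g (e, t)) ∧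
    ∀ h : G.len e ≠ ⊤, f (e, (G.len e).toReal) = c (G.tgt e h)

/-- The Sobolev space `H¹(G)`: a function `u` of the space is represented by the pair `(u, u')` of
elements of `L²(G)`, where `u` has a representative that is continuous on `G` and absolutely
continuous with derivative `u'` on each edge. (The pair is determined by `u`.) The topology induced
by `L²(G) × L²(G)` is the one of the `H¹` norm. -/
def H1 : Set (G.L2 × G.L2) :=
  {w | ∃ f : G.E × ℝ → ℝ, f =ᵐ[G.edgeMeasure] w.1 ∧ G.IsPrimitive f w.2}

/-- The functions of `H¹(G)` of mass `μ`, that is, with `‖u‖₂² = μ`. -/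
def H1mass (μ : ℝ) : Set (G.L2 × G.L2) :=
  {w | w ∈ G.H1 ∧ ‖w.1‖ ^ 2 = μ}

/-- The energy `E_ρ(u, G) = ½ ‖u'‖₂² - (ρ / p) ‖u‖_p^p`. -/
def energy (p ρ : ℝ) (w : G.L2 × G.L2) : ℝ :=
  1 / 2 * ‖w.2‖ ^ 2 - ρ / p * ∫ z, |w.1 z| ^ p ∂G.edgeMeasure

/-- The set `A_δ` of the functions `u` of mass `μ` with `‖u'‖₂² ≤ δ`. -/
def setA (μ δ : ℝ) : Set (G.L2 × G.L2) :=
  {w | w ∈ G.H1mass μ ∧ ‖w.2‖ ^ 2 ≤ δ}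

/-- The set `B` of the functions `u` of mass `μ` with `E_{1/2}(u, G) < 0`. -/
def setB (p μ : ℝ) : Set (G.L2 × G.L2) :=
  {w | w ∈ G.H1mass μ ∧ G.energy p (1 / 2) w < 0}

/-- The continuous paths `[0, 1] → H¹_μ(G)` from `A_δ` to `B`. -/
def paths (p μ δ : ℝ) : Set C(unitInterval, G.H1mass μ) :=
  {γ | (γ 0 : G.L2 × G.L2) ∈ G.setA μ δ ∧ (γ 1 : G.L2 × G.L2) ∈ G.setB p μ}

/-- The mountain pass level `c_ρ(G)` at mass `μ`, for the paths that start in `A_δ`. -/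
def level (p μ δ ρ : ℝ) : EReal :=
  ⨅ γ ∈ G.paths p μ δ, ⨆ t : unitInterval, (G.energy p ρ (γ t) : EReal)

/-- `δ` gives the mountain pass geometry for all `ρ ∈ [1/2, 1]`: `A_δ` is nonempty, and `c_ρ(G)` is
strictly larger than the suprema of `E_ρ` on `A_δ` and on `B`. -/
def IsMountainPass (p μ δ : ℝ) : Prop :=
  0 < δ ∧ (G.setA μ δ).Nonempty ∧ ∀ ρ ∈ Icc (1 / 2 : ℝ) 1,
    max (⨆ w ∈ G.setA μ δ, (G.energy p ρ w : EReal))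
      (⨆ w ∈ G.setB p μ, (G.energy p ρ w : EReal)) < G.level p μ δ ρ

end MetricGraph

end

/-! ### Edgewise measure and integration; the linear structure of `H1`. -/

namespace MetricGraph

open Filter Topology

variable {G : MetricGraph.{u, v}}

/-! Put `q = (p - 2) / 2 > 2`. At mass `μ`, a Gagliardo–Nirenberg inequality `‖u‖_p^p ≤ Λ ‖u'‖₂^q`
bounds the energy below by `x²/2 - a x^q`, with `x = ‖u'‖₂` and `a = ρ Λ / p`. This function of one
variable has a single barrier, of height `fiberMax q a`, and `B` lies beyond it. A path into `B`
that starts before the barrier must cross it, so the level is at least `fiberMax q a`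
(`HasGNBound.fiberMax_le_level`, for any admissible `δ`).

Conversely, a continuous family of test functions whose Gagliardo–Nirenberg quotient is at least `r`
times the same constant, and whose kinetic energy tends to infinity, gives a path with energy at
most `fiberMax q (r a) = r ^ (-2 / (q - 2)) fiberMax q a` (`exists_level_le_of_reachesGN`). The
geometry of the graph fixes the first member of the family. For small `μ` its kinetic energy lies
below the barrier, and it can then be joined to any nonempty `A_δ` (`level_le_of_family`).
Everything reduces to comparing quotients: `r` close to `1` gives the factor `1 + ε`, and `r > 1`
gives strict inequality.

The sharp constants of the line and the half-line come from a calibration. If `F' (s) = s √(M^(p-2)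
- |s|^(p-2))`, with `M` the supremum of `|u|`, then every value is joined to `0` along two disjoint
branches of the line (one of the half-line), so `∫ |F'(u) u'|` is at least `2 F(M)` (respectively
`F(M)`). Cauchy–Schwarz and an optimisation in `M` give the inequality (`IsCalibrated.hasGNBound`).
The soliton `φ(y) = cosh((p-2)y/2)^(-2/(p-2))` satisfies `φ'² = φ² - φ^p`, the equality case, and
supplies the explicit constant `gnConst`.

The test functions are concentrated truncated solitons inside an edge (constant of the line), or
half of one at the tip of a pendant (constant of the half-line). On a signpost the soliton is
centred on the loop and its two missing tails, of height `t` at the vertex, are replaced by a single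
polynomial tail on the bounded edge. That tail restores at least the lost `p`-norm, while mass plus
kinetic energy drops by at least `8/45 t²`, so the quotient strictly exceeds that of the line. -/

instance : MeasurableSingletonClass G.E := ⟨fun _ => trivial⟩

theorem interval_of_ne_top {e : G.E} (h : G.len e ≠ ⊤) :
    G.interval e = Icc 0 (G.len e).toReal := by
  ext x
  constructor
  · rintro ⟨h0, h1⟩
    exact ⟨h0, (ENNReal.ofReal_le_iff_le_toReal h).1 h1⟩
  · rintro ⟨h0, h1⟩
    exact ⟨h0, (ENNReal.ofReal_le_iff_le_toReal h).2 h1⟩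

theorem interval_of_eq_top {e : G.E} (h : G.len e = ⊤) : G.interval e = Ici 0 := by
  ext x
  simp [interval, h]

theorem measurableSet_interval (e : G.E) : MeasurableSet (G.interval e) := by
  by_cases h : G.len e = ⊤
  · rw [interval_of_eq_top h]; exact measurableSet_Ici
  · rw [interval_of_ne_top h]; exact measurableSet_Icc

theorem Icc_subset_interval {e : G.E} {x : ℝ} (hx : x ∈ G.interval e) :
    Icc 0 x ⊆ G.interval e :=
  fun _ hy => ⟨hy.1, (ENNReal.ofReal_le_ofReal hy.2).trans hx.2⟩

theorem toReal_len_pos {e : G.E} (h : G.len e ≠ ⊤) : 0 < (G.len e).toReal :=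
  ENNReal.toReal_pos (G.len_pos e).ne' h

/-- The Lebesgue measure on the edge `e`, as a part of the measure of the graph. -/
theorem map_le_edgeMeasure (e : G.E) :
    (volume.restrict (G.interval e)).map (Prod.mk e) ≤ G.edgeMeasure :=
  Measure.le_sum (fun e => (volume.restrict (G.interval e)).map (Prod.mk e)) e

theorem ae_edgeMeasure_iff [Countable G.E] {P : G.E × ℝ → Prop} :
    (∀ᵐ z ∂G.edgeMeasure, P z) ↔
      ∀ e, ∀ᵐ x ∂volume.restrict (G.interval e), P (e, x) := by
  rw [edgeMeasure, Measure.ae_sum_iff]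
  exact forall_congr' fun e => (measurableEmbedding_prodMk_left e).ae_map_iff

theorem memLp_edge {q : ENNReal} {F : G.E × ℝ → ℝ} (h : MemLp F q G.edgeMeasure) (e : G.E) :
    MemLp (fun x => F (e, x)) q (volume.restrict (G.interval e)) :=
  (measurableEmbedding_prodMk_left e).memLp_map_measure_iff.1
    (h.mono_measure (map_le_edgeMeasure e))

theorem integrable_edge {F : G.E × ℝ → ℝ} (h : Integrable F G.edgeMeasure) (e : G.E) :
    IntegrableOn (fun x => F (e, x)) (G.interval e) :=
  (measurableEmbedding_prodMk_left e).integrable_map_iff.1 (h.mono_measure (map_le_edgeMeasure e))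

theorem integral_map_edge (F : G.E × ℝ → ℝ) (e : G.E) :
    ∫ z, F z ∂(volume.restrict (G.interval e)).map (Prod.mk e) =
      ∫ x in G.interval e, F (e, x) :=
  (measurableEmbedding_prodMk_left e).integral_map _

theorem integral_edgeMeasure {F : G.E × ℝ → ℝ} (h : Integrable F G.edgeMeasure) :
    ∫ z, F z ∂G.edgeMeasure = ∑' e, ∫ x in G.interval e, F (e, x) := by
  rw [edgeMeasure, integral_sum_measure h]
  exact tsum_congr fun e => integral_map_edge F e

theorem intervalIntegrable_edge {g : G.E × ℝ → ℝ} (h : MemLp g 2 G.edgeMeasure) {e : G.E} {x : ℝ}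
    (hx : x ∈ G.interval e) : IntervalIntegrable (fun t => g (e, t)) volume 0 x := by
  rw [intervalIntegrable_iff, uIoc_of_le hx.1]
  have h2 : MemLp (fun t => g (e, t)) 2 (volume.restrict (Ioc 0 x)) :=
    (memLp_edge h e).mono_measure
      (Measure.restrict_mono (Ioc_subset_Icc_self.trans (Icc_subset_interval hx)) le_rfl)
  exact h2.integrable (by norm_num)

theorem intervalIntegral_congr_edge [Countable G.E] {g g' : G.E × ℝ → ℝ}
    (h : g =ᵐ[G.edgeMeasure] g') {e : G.E} {x : ℝ} (hx : x ∈ G.interval e) :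
    ∫ t in (0 : ℝ)..x, g (e, t) = ∫ t in (0 : ℝ)..x, g' (e, t) := by
  refine intervalIntegral.integral_congr_ae_restrict ?_
  rw [uIoc_of_le hx.1]
  exact ae_mono (Measure.restrict_mono (Ioc_subset_Icc_self.trans (Icc_subset_interval hx)) le_rfl)
    (ae_edgeMeasure_iff.1 h e)

theorem IsPrimitive.congr [Countable G.E] {f g g' : G.E × ℝ → ℝ} (h : G.IsPrimitive f g)
    (hg : g =ᵐ[G.edgeMeasure] g') : G.IsPrimitive f g' := by
  obtain ⟨c, hc⟩ := h
  refine ⟨c, fun e => ⟨fun x hx => ?_, (hc e).2⟩⟩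
  rw [(hc e).1 x hx, intervalIntegral_congr_edge hg hx]

theorem IsPrimitive.add {f g f' g' : G.E × ℝ → ℝ} (h : G.IsPrimitive f g)
    (h' : G.IsPrimitive f' g') (hg : MemLp g 2 G.edgeMeasure) (hg' : MemLp g' 2 G.edgeMeasure) :
    G.IsPrimitive (f + f') (g + g') := by
  obtain ⟨c, hc⟩ := h
  obtain ⟨c', hc'⟩ := h'
  refine ⟨c + c', fun e => ⟨fun x hx => ?_, fun hl => ?_⟩⟩
  · simp only [Pi.add_apply]
    rw [(hc e).1 x hx, (hc' e).1 x hx, intervalIntegral.integral_add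
      (intervalIntegrable_edge hg hx) (intervalIntegrable_edge hg' hx)]
    ring
  · simp only [Pi.add_apply]
    rw [(hc e).2 hl, (hc' e).2 hl]

theorem IsPrimitive.smul {f g : G.E × ℝ → ℝ} (h : G.IsPrimitive f g) (r : ℝ) :
    G.IsPrimitive (r • f) (r • g) := by
  obtain ⟨c, hc⟩ := h
  refine ⟨r • c, fun e => ⟨fun x hx => ?_, fun hl => ?_⟩⟩
  · simp only [Pi.smul_apply, smul_eq_mul]
    rw [(hc e).1 x hx, intervalIntegral.integral_const_mul]
    ring
  · simp only [Pi.smul_apply, smul_eq_mul]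
    rw [(hc e).2 hl]

theorem add_mem_H1 [Countable G.E] {w w' : G.L2 × G.L2} (h : w ∈ G.H1) (h' : w' ∈ G.H1) :
    w + w' ∈ G.H1 := by
  obtain ⟨f, hf, hp⟩ := h
  obtain ⟨f', hf', hp'⟩ := h'
  exact ⟨f + f', (hf.add hf').trans (Lp.coeFn_add w.1 w'.1).symm,
    (hp.add hp' (Lp.memLp w.2) (Lp.memLp w'.2)).congr (Lp.coeFn_add w.2 w'.2).symm⟩

theorem smul_mem_H1 [Countable G.E] {w : G.L2 × G.L2} (h : w ∈ G.H1) (r : ℝ) :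
    r • w ∈ G.H1 := by
  obtain ⟨f, hf, hp⟩ := h
  exact ⟨r • f, (hf.const_smul r).trans (Lp.coeFn_smul r w.1).symm,
    (hp.smul r).congr (Lp.coeFn_smul r w.2).symm⟩

theorem norm_sq_eq_integral (w : G.L2) : ‖w‖ ^ 2 = ∫ z, (w z) ^ 2 ∂G.edgeMeasure := by
  rw [← real_inner_self_eq_norm_sq, L2.inner_def]
  refine integral_congr_ae (Eventually.of_forall fun z => ?_)
  simp [pow_two]

theorem norm_sq_toLp {f : G.E × ℝ → ℝ} (hf : MemLp f 2 G.edgeMeasure) :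
    ‖hf.toLp f‖ ^ 2 = ∫ z, (f z) ^ 2 ∂G.edgeMeasure := by
  rw [norm_sq_eq_integral]
  refine integral_congr_ae ?_
  filter_upwards [hf.coeFn_toLp] with z hz
  rw [hz]

theorem energy_le_half_norm_sq {p ρ : ℝ} (hp : 0 ≤ p) (hρ : 0 ≤ ρ) (w : G.L2 × G.L2) :
    G.energy p ρ w ≤ 1 / 2 * ‖w.2‖ ^ 2 := by
  have h : 0 ≤ ρ / p * ∫ z, |w.1 z| ^ p ∂G.edgeMeasure :=
    mul_nonneg (div_nonneg hρ hp) (integral_nonneg fun z => Real.rpow_nonneg (abs_nonneg _) _)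
  unfold energy
  linarith

theorem energy_anti {p ρ ρ' : ℝ} (hp : 0 ≤ p) (hρ : ρ ≤ ρ') (w : G.L2 × G.L2) :
    G.energy p ρ' w ≤ G.energy p ρ w := by
  have h : ρ / p * ∫ z, |w.1 z| ^ p ∂G.edgeMeasure ≤ ρ' / p * ∫ z, |w.1 z| ^ p ∂G.edgeMeasure :=
    mul_le_mul_of_nonneg_right (div_le_div_of_nonneg_right hρ hp)
      (integral_nonneg fun z => Real.rpow_nonneg (abs_nonneg _) _)
  unfold energy
  linarith

end MetricGraph

/-! ### Upper bounds for the mountain pass level from explicit paths. -/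

namespace MetricGraph

open Filter Topology

variable {G : MetricGraph.{u, v}}

theorem level_le_of_joinedIn {p μ δ ρ b : ℝ} {x y : G.L2 × G.L2} (hx : x ∈ G.setA μ δ)
    (hy : y ∈ G.setB p μ)
    (h : JoinedIn {w | w ∈ G.H1mass μ ∧ G.energy p ρ w ≤ b} x y) :
    G.level p μ δ ρ ≤ (b : EReal) := by
  obtain ⟨γ, hγ⟩ := h
  let Γ : C(unitInterval, G.H1mass μ) :=
    ⟨fun t => ⟨γ t, (hγ t).1⟩, Continuous.subtype_mk γ.continuous _⟩
  have hΓ : Γ ∈ G.paths p μ δ := by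
    refine ⟨?_, ?_⟩
    · change γ 0 ∈ _
      rw [γ.source]; exact hx
    · change γ 1 ∈ _
      rw [γ.target]; exact hy
  exact (iInf₂_le Γ hΓ).trans (iSup_le fun t => EReal.coe_le_coe_iff.2 (hγ t).2)

theorem neg_mem_setA [Countable G.E] {μ δ : ℝ} {w : G.L2 × G.L2} (h : w ∈ G.setA μ δ) :
    -w ∈ G.setA μ δ := by
  obtain ⟨⟨h1, h2⟩, h3⟩ := h
  refine ⟨⟨?_, ?_⟩, ?_⟩
  · simpa using smul_mem_H1 h1 (-1)
  · simpa using h2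
  · simpa using h3

/-- Two functions of mass `μ` with nonnegative inner product can be joined by a path of functions
of mass `μ` along which the kinetic energy at most doubles. -/
theorem joinedIn_of_inner_nonneg [Countable G.E] {μ k : ℝ} (hμ : 0 < μ) {w v : G.L2 × G.L2}
    (hw : w ∈ G.H1mass μ) (hv : v ∈ G.H1mass μ) (hwk : ‖w.2‖ ^ 2 ≤ k) (hvk : ‖v.2‖ ^ 2 ≤ k)
    (hin : 0 ≤ inner ℝ w.1 v.1) :
    JoinedIn {z | z ∈ G.H1mass μ ∧ ‖z.2‖ ^ 2 ≤ 2 * k} w v := by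
  have hk : 0 ≤ k := (sq_nonneg _).trans hwk
  let U : ℝ → G.L2 × G.L2 := fun t => (1 - t) • w + t • v
  have hU : Continuous U := by fun_prop
  -- The nonnegative inner product keeps the chord away from the origin: its squared norm is at
  -- least `((1 - t)² + t²) μ ≥ μ / 2`. Renormalising to mass `μ` therefore costs a factor of at
  -- most `2` in the kinetic energy.
  have hUn : ∀ t ∈ Icc (0 : ℝ) 1, μ / 2 ≤ ‖(U t).1‖ ^ 2 := by
    intro t ht
    have : ‖(U t).1‖ ^ 2 = (1 - t) ^ 2 * μ + 2 * ((1 - t) * t * inner ℝ w.1 v.1) + t ^ 2 * μ := by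
      change ‖(1 - t) • w.1 + t • v.1‖ ^ 2 = _
      rw [norm_add_sq_real, norm_smul, norm_smul, mul_pow, mul_pow, hw.2, hv.2, inner_smul_left,
        inner_smul_right]
      simp
      ring
    rw [this]
    have h1 : 0 ≤ (1 - t) * t * inner ℝ w.1 v.1 :=
      mul_nonneg (mul_nonneg (by linarith [ht.2]) ht.1) hin
    nlinarith [mul_nonneg hμ.le (sq_nonneg (2 * t - 1))]
  have hUk : ∀ t ∈ Icc (0 : ℝ) 1, ‖(U t).2‖ ^ 2 ≤ k := by
    intro t ht
    have h1 : ‖w.2‖ ≤ √k := Real.le_sqrt_of_sq_le hwk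
    have h2 : ‖v.2‖ ≤ √k := Real.le_sqrt_of_sq_le hvk
    have h3 : ‖(U t).2‖ ≤ √k := by
      change ‖(1 - t) • w.2 + t • v.2‖ ≤ _
      refine (norm_add_le _ _).trans ?_
      rw [norm_smul, norm_smul, Real.norm_of_nonneg ht.1,
        Real.norm_of_nonneg (by linarith [ht.2] : 0 ≤ 1 - t)]
      nlinarith [mul_le_mul_of_nonneg_left h1 (by linarith [ht.2] : 0 ≤ 1 - t),
        mul_le_mul_of_nonneg_left h2 ht.1]
    calc ‖(U t).2‖ ^ 2 ≤ √k ^ 2 := by gcongr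
      _ = k := Real.sq_sqrt hk
  have hpos : ∀ t ∈ Icc (0 : ℝ) 1, ‖(U t).1‖ ≠ 0 := by
    intro t ht h0
    have := hUn t ht
    rw [h0] at this
    linarith [this]
  have hwμ : ‖w.1‖ = √μ := by rw [← hw.2, Real.sqrt_sq (norm_nonneg _)]
  have hvμ : ‖v.1‖ = √μ := by rw [← hv.2, Real.sqrt_sq (norm_nonneg _)]
  have hsμ : √μ ≠ 0 := (Real.sqrt_pos.2 hμ).ne'
  refine JoinedIn.ofLine (f := fun t => (√μ / ‖(U t).1‖) • U t) ?_ ?_ ?_ ?_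
  · refine ContinuousOn.smul (ContinuousOn.div continuousOn_const ?_ hpos) hU.continuousOn
    exact (continuous_fst.comp hU).norm.continuousOn
  · simp [U, hwμ, hsμ]
  · simp [U, hvμ, hsμ]
  · rintro _ ⟨t, ht, rfl⟩
    have hn := hpos t ht
    refine ⟨⟨smul_mem_H1 (add_mem_H1 (smul_mem_H1 hw.1 _) (smul_mem_H1 hv.1 _)) _, ?_⟩, ?_⟩
    · rw [Prod.smul_fst, norm_smul, norm_div, norm_norm, div_mul_cancel₀ _ hn,
        Real.norm_of_nonneg (Real.sqrt_nonneg _), Real.sq_sqrt hμ.le]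
    · rw [Prod.smul_snd, norm_smul, norm_div, norm_norm, mul_pow, div_pow,
        Real.norm_of_nonneg (Real.sqrt_nonneg _), Real.sq_sqrt hμ.le]
      have h2 : μ / ‖(U t).1‖ ^ 2 ≤ 2 := by
        rw [div_le_iff₀ (by positivity)]
        linarith [hUn t ht]
      exact mul_le_mul h2 (hUk t ht) (sq_nonneg _) (by norm_num)

/-- Upper bound for the mountain pass level from a continuous family of functions that ends in
`B`. -/
theorem level_le_of_family [Countable G.E] {p μ δ ρ k b s₀ s₁ : ℝ} (hp : 0 ≤ p) (hρ : 0 ≤ ρ)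
    (hμ : 0 < μ) (hs : s₀ ≤ s₁) (hA : (G.setA μ δ).Nonempty) {v : ℝ → G.L2 × G.L2}
    (hv : ContinuousOn v (Icc s₀ s₁)) (hmass : ∀ s ∈ Icc s₀ s₁, v s ∈ G.H1mass μ)
    (hE : ∀ s ∈ Icc s₀ s₁, G.energy p ρ (v s) ≤ b) (hB : v s₁ ∈ G.setB p μ)
    (hk : ‖(v s₀).2‖ ^ 2 ≤ k) (hkb : k ≤ b) :
    G.level p μ δ ρ ≤ (b : EReal) := by
  have hs₀ : s₀ ∈ Icc s₀ s₁ := ⟨le_rfl, hs⟩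
  have h2 : JoinedIn {w | w ∈ G.H1mass μ ∧ G.energy p ρ w ≤ b} (v s₀) (v s₁) := by
    refine JoinedIn.ofLine (f := fun t => v (s₀ + t * (s₁ - s₀))) ?_ (by simp) (by simp) ?_
    · refine hv.comp (by fun_prop) ?_
      intro t ht
      exact ⟨by nlinarith [ht.1, ht.2], by nlinarith [ht.1, ht.2]⟩
    · rintro _ ⟨t, ht, rfl⟩
      have : s₀ + t * (s₁ - s₀) ∈ Icc s₀ s₁ := ⟨by nlinarith [ht.1, ht.2], by nlinarith [ht.1, ht.2]⟩
      exact ⟨hmass _ this, hE _ this⟩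
  -- If `k ≤ δ` the family already starts in `A_δ`. Otherwise every point of `A_δ` has kinetic
  -- energy at most `k`; one of them, up to sign, is joined to `v s₀` with kinetic energy at most
  -- `2k`, hence energy at most `k ≤ b`.
  by_cases hδ : k ≤ δ
  · exact level_le_of_joinedIn ⟨hmass _ hs₀, hk.trans hδ⟩ hB h2
  · obtain ⟨w, hwA, hin⟩ : ∃ w ∈ G.setA μ δ, 0 ≤ inner ℝ w.1 (v s₀).1 := by
      obtain ⟨w, hw⟩ := hA
      by_cases h : 0 ≤ inner ℝ w.1 (v s₀).1
      · exact ⟨w, hw, h⟩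
      · refine ⟨-w, neg_mem_setA hw, ?_⟩
        rw [Prod.fst_neg, inner_neg_left]
        linarith
    have h1 := joinedIn_of_inner_nonneg hμ hwA.1 (hmass _ hs₀) (hwA.2.trans (not_le.1 hδ).le) hk hin
    refine level_le_of_joinedIn hwA hB ((h1.mono ?_).trans h2)
    rintro z ⟨hz1, hz2⟩
    exact ⟨hz1, by linarith [energy_le_half_norm_sq hp hρ z]⟩

end MetricGraph

namespace MetricGraph

open Filter Topology

/-! ### The one-variable energy `x²/2 - a x^q`. -/

section Fiber

/-- The energy along a fibre, as a function of `x = ‖u'‖₂`. -/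
noncomputable def fiber (q a x : ℝ) : ℝ := x ^ 2 / 2 - a * x ^ q

/-- The maximum point of `fiber q a`. -/
noncomputable def fiberArg (q a : ℝ) : ℝ := (q * a) ^ (-(q - 2)⁻¹)

/-- The maximum of `fiber q a`. -/
noncomputable def fiberMax (q a : ℝ) : ℝ := fiberArg q a ^ 2 * (1 / 2 - 1 / q)

variable {q a : ℝ}

theorem fiberArg_pos (hq : 2 < q) (ha : 0 < a) : 0 < fiberArg q a :=
  Real.rpow_pos_of_pos (mul_pos (by linarith) ha) _

theorem half_sub_inv_pos (hq : 2 < q) : 0 < 1 / 2 - 1 / q := by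
  rw [sub_pos]
  exact one_div_lt_one_div_of_lt (by norm_num) hq

theorem fiberMax_pos (hq : 2 < q) (ha : 0 < a) : 0 < fiberMax q a :=
  mul_pos (pow_pos (fiberArg_pos hq ha) 2) (half_sub_inv_pos hq)

theorem mul_fiberArg_rpow (hq : 2 < q) (ha : 0 < a) :
    a * fiberArg q a ^ q = fiberArg q a ^ 2 / q := by
  have hs := fiberArg_pos hq ha
  have h1 : fiberArg q a ^ (q - 2) = (q * a)⁻¹ := by
    rw [fiberArg, ← Real.rpow_mul (mul_pos (by linarith) ha).le, neg_mul,
      inv_mul_cancel₀ (by linarith), Real.rpow_neg_one]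
  have h2 : fiberArg q a ^ q = fiberArg q a ^ (q - 2) * fiberArg q a ^ 2 := by
    rw [← Real.rpow_natCast (fiberArg q a) 2, ← Real.rpow_add hs]
    norm_num
  rw [h2, h1]
  field_simp

theorem fiber_fiberArg (hq : 2 < q) (ha : 0 < a) : fiber q a (fiberArg q a) = fiberMax q a := by
  rw [fiber, mul_fiberArg_rpow hq ha, fiberMax]
  ring

/-- With `x = l s`, where `s` is the critical point, the claim reduces to `l² ≤ (2/q) l^q + (1 -
2/q)`, which is the weighted arithmetic–geometric mean inequality. -/
theorem fiber_le_fiberMax (hq : 2 < q) (ha : 0 < a) {x : ℝ} (hx : 0 ≤ x) :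
    fiber q a x ≤ fiberMax q a := by
  have hs := fiberArg_pos hq ha
  set s := fiberArg q a with hsdef
  obtain ⟨l, rfl⟩ : ∃ l, x = l * s := ⟨x / s, by field_simp⟩
  have hl : 0 ≤ l := by
    by_contra h
    nlinarith [not_le.1 h]
  have hq0 : 0 < q := by linarith
  have h1 : l ^ 2 ≤ 2 / q * l ^ q + (1 - 2 / q) := by
    have h := Real.geom_mean_le_arith_mean2_weighted (w₁ := 2 / q) (w₂ := 1 - 2 / q) (p₁ := l ^ q)
      (p₂ := 1) (by positivity) (by rw [sub_nonneg, div_le_one hq0]; exact hq.le)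
      (Real.rpow_nonneg hl _) zero_le_one (by ring)
    rw [← Real.rpow_mul hl, mul_div_cancel₀ _ hq0.ne', Real.one_rpow, mul_one, mul_one] at h
    exact_mod_cast h
  have h2 : a * (l * s) ^ q = l ^ q * (s ^ 2 / q) := by
    rw [Real.mul_rpow hl hs.le, ← mul_fiberArg_rpow hq ha]
    ring
  rw [fiber, h2, fiberMax, ← hsdef]
  have h3 : s ^ 2 * l ^ 2 ≤ s ^ 2 * (2 / q * l ^ q + (1 - 2 / q)) :=
    mul_le_mul_of_nonneg_left h1 (sq_nonneg s)
  have h4 : s ^ 2 * (2 / q * l ^ q + (1 - 2 / q)) = 2 * (l ^ q * (s ^ 2 / q)) +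
      2 * (s ^ 2 * (1 / 2 - 1 / q)) := by
    field_simp
  nlinarith

/-- Up to the critical point, `a x^(q-2) ≤ 1/q < 1/2`, so the energy is nonnegative there. This
places `B` beyond the barrier. -/
theorem fiberArg_lt_of_fiber_neg (hq : 2 < q) (ha : 0 < a) {x : ℝ} (hx : 0 ≤ x)
    (h : fiber q a x < 0) : fiberArg q a < x := by
  by_contra! hxs
  have hs := fiberArg_pos hq ha
  rcases hx.eq_or_lt with rfl | hx
  · rw [fiber, Real.zero_rpow (by linarith)] at h
    norm_num at h
  have h1 : x ^ q = x ^ (q - 2) * x ^ 2 := by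
    rw [← Real.rpow_natCast x 2, ← Real.rpow_add hx]
    norm_num
  have h2 : a * x ^ (q - 2) ≤ 1 / q := by
    have h3 : x ^ (q - 2) ≤ fiberArg q a ^ (q - 2) :=
      Real.rpow_le_rpow hx.le hxs (by linarith)
    have h4 : fiberArg q a ^ (q - 2) = (q * a)⁻¹ := by
      rw [fiberArg, ← Real.rpow_mul (mul_pos (by linarith) ha).le, neg_mul,
        inv_mul_cancel₀ (by linarith), Real.rpow_neg_one]
    rw [h4] at h3
    calc a * x ^ (q - 2) ≤ a * (q * a)⁻¹ := mul_le_mul_of_nonneg_left h3 ha.le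
      _ = 1 / q := by field_simp
  have h5 := half_sub_inv_pos hq
  have : fiber q a x = x ^ 2 * (1 / 2 - a * x ^ (q - 2)) := by
    rw [fiber, h1]; ring
  rw [this] at h
  have : 0 ≤ x ^ 2 * (1 / 2 - a * x ^ (q - 2)) := mul_nonneg (sq_nonneg x) (by linarith)
  linarith

theorem fiberArg_anti (hq : 2 < q) (ha : 0 < a) {b : ℝ} (hab : a ≤ b) :
    fiberArg q b ≤ fiberArg q a := by
  have hq0 : 0 < q := by linarith
  exact Real.rpow_le_rpow_of_nonpos (mul_pos hq0 ha) (mul_le_mul_of_nonneg_left hab hq0.le)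
    (neg_nonpos.2 (inv_nonneg.2 (by linarith)))

theorem fiberMax_anti (hq : 2 < q) (ha : 0 < a) {b : ℝ} (hab : a ≤ b) :
    fiberMax q b ≤ fiberMax q a :=
  mul_le_mul_of_nonneg_right (pow_le_pow_left₀ (fiberArg_pos hq (ha.trans_le hab)).le
    (fiberArg_anti hq ha hab) 2) (half_sub_inv_pos hq).le

/-- Homogeneity of degree `-2/(q-2)` in the coefficient: this converts a factor in the
Gagliardo–Nirenberg quotient into a factor in the level. -/
theorem fiberMax_mul (hq : 2 < q) (ha : 0 < a) {r : ℝ} (hr : 0 < r) :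
    fiberMax q (r * a) = (r ^ (-(q - 2)⁻¹)) ^ 2 * fiberMax q a := by
  have : fiberArg q (r * a) = r ^ (-(q - 2)⁻¹) * fiberArg q a := by
    rw [fiberArg, fiberArg, ← Real.mul_rpow hr.le (mul_pos (by linarith) ha).le]
    congr 1
    ring
  rw [fiberMax, this, fiberMax]
  ring

end Fiber

/-! ### Lower bounds for the level from a Gagliardo–Nirenberg inequality. -/

variable {G : MetricGraph.{u, v}} {p μ Λ : ℝ}

/-- A Gagliardo–Nirenberg inequality for the functions of mass `μ`, with constant `Λ`. -/
def HasGNBound (G : MetricGraph.{u, v}) (p μ Λ : ℝ) : Prop :=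
  ∀ w ∈ G.H1mass μ, ∫ z, |w.1 z| ^ p ∂G.edgeMeasure ≤ Λ * ‖w.2‖ ^ ((p - 2) / 2)

theorem HasGNBound.fiber_le_energy (h : G.HasGNBound p μ Λ) (hp : 0 < p) {ρ : ℝ} (hρ : 0 ≤ ρ)
    {w : G.L2 × G.L2} (hw : w ∈ G.H1mass μ) :
    fiber ((p - 2) / 2) (ρ / p * Λ) ‖w.2‖ ≤ G.energy p ρ w := by
  have := mul_le_mul_of_nonneg_left (h w hw) (div_nonneg hρ hp.le)
  rw [fiber, energy]
  linarith

/-- Along a path `‖u'‖₂` is continuous, starts at or below `fiberArg` and ends above it, because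
`E_ρ ≤ E_{1/2} < 0` on `B`. By the intermediate value theorem it equals `fiberArg` at some time,
where the energy is at least `fiberMax`. -/
theorem HasGNBound.fiberMax_le_level_of_forall (h : G.HasGNBound p μ Λ) (hp : 6 < p) (hΛ : 0 < Λ)
    {δ ρ : ℝ} (hρ : ρ ∈ Icc (1 / 2 : ℝ) 1)
    (hδ : ∀ w ∈ G.setA μ δ, ‖w.2‖ ≤ fiberArg ((p - 2) / 2) (ρ / p * Λ)) :
    (fiberMax ((p - 2) / 2) (ρ / p * Λ) : EReal) ≤ G.level p μ δ ρ := by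
  have hq : 2 < (p - 2) / 2 := by linarith
  have hρ0 : 0 < ρ := by linarith [hρ.1]
  have ha : 0 < ρ / p * Λ := by positivity
  refine le_iInf₂ fun γ hγ => ?_
  have hc : Continuous fun t : unitInterval => ‖(γ t : G.L2 × G.L2).2‖ := by fun_prop
  have h0 := hδ _ hγ.1
  have h1 : fiberArg ((p - 2) / 2) (ρ / p * Λ) ≤ ‖(γ 1 : G.L2 × G.L2).2‖ := by
    refine (fiberArg_lt_of_fiber_neg hq ha (norm_nonneg _) ?_).le
    calc _ ≤ G.energy p ρ (γ 1) := h.fiber_le_energy (by linarith) hρ0.le (γ 1).2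
      _ ≤ G.energy p (1 / 2) (γ 1) := energy_anti (by linarith) hρ.1 _
      _ < 0 := hγ.2.2
  obtain ⟨t, -, ht⟩ := intermediate_value_Icc zero_le_one hc.continuousOn ⟨h0, h1⟩
  refine le_trans (EReal.coe_le_coe_iff.2 ?_)
    (le_iSup (fun t : unitInterval => (G.energy p ρ (γ t) : EReal)) t)
  have h2 := h.fiber_le_energy (by linarith) hρ0.le (γ t).2
  simp only at ht
  rwa [ht, fiber_fiberArg hq ha] at h2

/-- Independence of the admissible `δ`: if `A_δ` reaches beyond the barrier, then by `hex` it
contains a function exactly on top of it, so `sup_{A_δ} E_ρ ≥ fiberMax`, and admissibility puts the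
level above this supremum. -/
theorem HasGNBound.fiberMax_le_level (h : G.HasGNBound p μ Λ) (hp : 6 < p) (hΛ : 0 < Λ)
    (hex : ∀ x : ℝ, 0 < x → ∃ w ∈ G.H1mass μ, ‖w.2‖ = x)
    {δ ρ : ℝ} (hρ : ρ ∈ Icc (1 / 2 : ℝ) 1) (hδ : G.IsMountainPass p μ δ) :
    (fiberMax ((p - 2) / 2) (ρ / p * Λ) : EReal) ≤ G.level p μ δ ρ := by
  have hq : 2 < (p - 2) / 2 := by linarith
  have hρ0 : 0 < ρ := by linarith [hρ.1]
  have ha : 0 < ρ / p * Λ := by positivity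
  by_cases hA : ∀ w ∈ G.setA μ δ, ‖w.2‖ ≤ fiberArg ((p - 2) / 2) (ρ / p * Λ)
  · exact h.fiberMax_le_level_of_forall hp hΛ hρ hA
  · push Not at hA
    obtain ⟨w, hw, hlt⟩ := hA
    have hs := fiberArg_pos hq ha
    obtain ⟨z, hz, hzx⟩ := hex _ hs
    have hzA : z ∈ G.setA μ δ :=
      ⟨hz, (by rw [hzx]; exact pow_le_pow_left₀ hs.le hlt.le 2 : ‖z.2‖ ^ 2 ≤ ‖w.2‖ ^ 2).trans hw.2⟩
    have h1 := h.fiber_le_energy (by linarith) hρ0.le hz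
    rw [hzx, fiber_fiberArg hq ha] at h1
    calc (fiberMax ((p - 2) / 2) (ρ / p * Λ) : EReal) ≤ G.energy p ρ z := EReal.coe_le_coe_iff.2 h1
      _ ≤ ⨆ w ∈ G.setA μ δ, (G.energy p ρ w : EReal) :=
        le_iSup₂ (f := fun w (_ : w ∈ G.setA μ δ) => (G.energy p ρ w : EReal)) z hzA
      _ ≤ G.level p μ δ ρ := (le_max_left _ _).trans (hδ.2.2 ρ hρ).le

theorem HasGNBound.exists_isMountainPass (h : G.HasGNBound p μ Λ) (hp : 6 < p) (hΛ : 0 < Λ)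
    (hex : ∀ x : ℝ, 0 < x → ∃ w ∈ G.H1mass μ, ‖w.2‖ = x) :
    ∃ δ, G.IsMountainPass p μ δ := by
  have hq : 2 < (p - 2) / 2 := by linarith
  have ha1 : 0 < 1 / p * Λ := by positivity
  have hs := fiberArg_pos hq ha1
  have hm := fiberMax_pos hq ha1
  -- This `δ` is the barrier height at `ρ = 1`, the lowest over all `ρ`. It is at most `fiberArg²`,
  -- so `A_δ` lies before every barrier, and `E_ρ ≤ δ / 2` on `A_δ` is strictly below the barrier
  -- height.
  refine ⟨fiberMax ((p - 2) / 2) (1 / p * Λ), hm, ?_, fun ρ hρ => ?_⟩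
  · obtain ⟨w, hw, hx⟩ := hex _ (Real.sqrt_pos.2 hm)
    exact ⟨w, hw, by rw [hx, Real.sq_sqrt hm.le]⟩
  have hρ0 : 0 < ρ := by linarith [hρ.1]
  have ha : 0 < ρ / p * Λ := by positivity
  have hle : ρ / p * Λ ≤ 1 / p * Λ := by
    have := hρ.2
    gcongr
  have hfm := fiberMax_anti hq ha hle
  have hlevel : (fiberMax ((p - 2) / 2) (ρ / p * Λ) : EReal) ≤
      G.level p μ (fiberMax ((p - 2) / 2) (1 / p * Λ)) ρ := by
    refine h.fiberMax_le_level_of_forall hp hΛ hρ fun w hw => ?_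
    refine le_trans ?_ (fiberArg_anti hq ha hle)
    refine abs_le_of_sq_le_sq' ?_ hs.le |>.2
    refine hw.2.trans ?_
    rw [fiberMax]
    have : 0 ≤ 1 / ((p - 2) / 2) := by positivity
    exact mul_le_of_le_one_right (sq_nonneg _) (by linarith)
  refine lt_of_lt_of_le ?_ hlevel
  refine max_lt ?_ ?_
  · have : (⨆ w ∈ G.setA μ (fiberMax ((p - 2) / 2) (1 / p * Λ)), (G.energy p ρ w : EReal)) ≤
        ((1 / 2 * fiberMax ((p - 2) / 2) (1 / p * Λ) : ℝ) : EReal) := by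
      refine iSup₂_le fun w hw => EReal.coe_le_coe_iff.2 ?_
      have := energy_le_half_norm_sq (p := p) (by linarith) hρ0.le w
      linarith [hw.2]
    exact this.trans_lt (EReal.coe_lt_coe_iff.2 (by linarith))
  · have : (⨆ w ∈ G.setB p μ, (G.energy p ρ w : EReal)) ≤ ((0 : ℝ) : EReal) := by
      refine iSup₂_le fun w hw => EReal.coe_le_coe_iff.2 ?_
      exact (energy_anti (by linarith) hρ.1 w).trans hw.2.le
    exact this.trans_lt (EReal.coe_lt_coe_iff.2 (by linarith))

end MetricGraph

namespace MetricGraph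

open Filter Topology

/-! ### Chain rule for absolutely continuous functions, and decay on half-lines. -/

section ChainRule

theorem AbsolutelyContinuousOnInterval.lipschitz_comp {f F : ℝ → ℝ} {a b : ℝ} {K : NNReal}
    {s : Set ℝ} (hf : AbsolutelyContinuousOnInterval f a b) (hF : LipschitzOnWith K F s)
    (hs : ∀ x ∈ uIcc a b, f x ∈ s) : AbsolutelyContinuousOnInterval (F ∘ f) a b := by
  have h := hf.const_mul (K : ℝ)
  rw [absolutelyContinuousOnInterval_iff] at h ⊢
  intro ε hε
  obtain ⟨δ, hδ, hE⟩ := h ε hε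
  refine ⟨δ, hδ, fun E hEd hlen => (Finset.sum_le_sum fun i hi => ?_).trans_lt (hE E hEd hlen)⟩
  have h1 := hF.dist_le_mul _ (hs _ (hEd.1 i hi).1) _ (hs _ (hEd.1 i hi).2)
  refine h1.trans (le_of_eq ?_)
  rw [Real.dist_eq, Real.dist_eq, ← mul_sub, abs_mul, NNReal.abs_eq]

/-- `F` is Lipschitz on the compact range of `f`, so `F ∘ f` is absolutely continuous; its
derivative is `F'(f) g` almost everywhere, and the fundamental theorem of calculus applies. -/
theorem integral_comp_primitive {f g F F' : ℝ → ℝ} {a b c : ℝ} (ha : 0 ≤ a) (hab : a ≤ b)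
    (hg : IntervalIntegrable g volume 0 b) (hf : ∀ x ∈ Icc 0 b, f x = c + ∫ t in (0 : ℝ)..x, g t)
    (hF : ∀ y, HasDerivAt F (F' y) y) (hF' : Continuous F') :
    ∫ x in a..b, F' (f x) * g x = F (f b) - F (f a) := by
  have hb : 0 ≤ b := ha.trans hab
  set f₀ : ℝ → ℝ := fun x => c + ∫ t in (0 : ℝ)..x, g t with hf₀
  have h1 : AbsolutelyContinuousOnInterval f₀ 0 b := by
    have h2 := hg.absolutelyContinuousOnInterval_intervalIntegral (c := 0) (by simp)
    have h3 : AbsolutelyContinuousOnInterval (fun _ : ℝ => c) 0 b :=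
      (LipschitzWith.const c).lipschitzOnWith.absolutelyContinuousOnInterval (K := 0)
    exact h3.add h2
  have hsub : uIcc a b ⊆ uIcc 0 b := by
    rw [uIcc_of_le hab, uIcc_of_le hb]
    exact Icc_subset_Icc ha le_rfl
  have h2 : AbsolutelyContinuousOnInterval f₀ a b := h1.mono hsub
  obtain ⟨K, hK⟩ : ∃ K, ∀ x ∈ uIcc a b, ‖f₀ x‖ ≤ K :=
    isCompact_uIcc.exists_bound_of_continuousOn h2.continuousOn
  have hFc : ContDiff ℝ 1 F := by
    rw [contDiff_one_iff_deriv]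
    refine ⟨fun y => (hF y).differentiableAt, ?_⟩
    rw [show deriv F = F' from funext fun y => (hF y).deriv]
    exact hF'
  obtain ⟨L, hL⟩ := hFc.contDiffOn.exists_lipschitzOnWith (s := Icc (-K) K) (by decide)
    (convex_Icc _ _) isCompact_Icc
  have h3 : AbsolutelyContinuousOnInterval (F ∘ f₀) a b :=
    AbsolutelyContinuousOnInterval.lipschitz_comp h2 hL fun x hx => abs_le.1 (hK x hx)
  have h4 := h3.integral_deriv_eq_sub
  have e1 : f a = f₀ a := hf a ⟨ha, hab⟩
  have e2 : f b = f₀ b := hf b ⟨hb, le_rfl⟩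
  rw [e1, e2]
  rw [Function.comp_apply, Function.comp_apply] at h4
  rw [← h4]
  refine intervalIntegral.integral_congr_ae ?_
  filter_upwards [hg.ae_hasDerivAt_integral] with x hx hxab
  have hx0 : x ∈ uIcc 0 b := hsub (uIoc_subset_uIcc hxab)
  have h5 : HasDerivAt f₀ (g x) x := (hx hx0 0 (by simp)).const_add c
  have h6 : f x = f₀ x := hf x (by rwa [uIcc_of_le hb] at hx0)
  rw [h6, ((hF (f₀ x)).comp x h5).deriv]

end ChainRule

section HalfLine

variable {f g F F' : ℝ → ℝ} {c : ℝ}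

theorem exists_ge_abs_lt (hf : MemLp f 2 (volume.restrict (Ici 0))) (X : ℝ) {ε : ℝ} (hε : 0 < ε) :
    ∃ x ≥ X, |f x| < ε := by
  by_contra! h
  have h1 : IntegrableOn (fun x => f x ^ 2) (Ioi (max X 0)) :=
    IntegrableOn.mono_set (t := Ici 0) hf.integrable_sq
      fun x hx => (le_max_right X 0).trans (le_of_lt hx)
  have h2 : IntegrableOn (fun _ : ℝ => ε ^ 2) (Ioi (max X 0)) := by
    refine Integrable.mono' h1 aestronglyMeasurable_const ?_
    refine (ae_restrict_iff' measurableSet_Ioi).2 (Eventually.of_forall fun x hx => ?_)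
    rw [Real.norm_of_nonneg (sq_nonneg ε), ← sq_abs (f x)]
    exact pow_le_pow_left₀ hε.le (h x ((le_max_left X 0).trans (le_of_lt hx))) 2
  rw [IntegrableOn, integrable_const_iff] at h2
  rcases h2 with h2 | h2
  · exact hε.ne' (by simpa using h2)
  · have := h2.measure_univ_lt_top
    simp at this

theorem comp_sub_comp_le (hgi : ∀ x, 0 ≤ x → IntervalIntegrable g volume 0 x)
    (hfg : ∀ x, 0 ≤ x → f x = c + ∫ t in (0 : ℝ)..x, g t)
    (hF : ∀ y, HasDerivAt F (F' y) y) (hF' : Continuous F') {a b : ℝ} (ha : 0 ≤ a) (hab : a ≤ b) :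
    |F (f b) - F (f a)| ≤ ∫ x in Ioc a b, |F' (f x) * g x| := by
  rw [← integral_comp_primitive ha hab (hgi b (ha.trans hab)) (fun x hx => hfg x hx.1) hF hF',
    intervalIntegral.integral_of_le hab]
  exact abs_integral_le_integral_abs

/-- A square integrable function takes arbitrarily small values arbitrarily far out, where `F (f b)`
is close to `F 0 = 0`; the variation of `F ∘ f` between `a` and such a point accounts for `F (f a)`.
-/
theorem comp_le_integral_Ioi (hf : MemLp f 2 (volume.restrict (Ici 0)))
    (hgi : ∀ x, 0 ≤ x → IntervalIntegrable g volume 0 x)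
    (hfg : ∀ x, 0 ≤ x → f x = c + ∫ t in (0 : ℝ)..x, g t)
    (hF : ∀ y, HasDerivAt F (F' y) y) (hF' : Continuous F') (hF0 : F 0 = 0)
    (hint : IntegrableOn (fun x => F' (f x) * g x) (Ici 0)) {a : ℝ} (ha : 0 ≤ a) :
    F (f a) ≤ ∫ x in Ioi a, |F' (f x) * g x| := by
  refine le_of_forall_pos_le_add fun ε hε => ?_
  obtain ⟨η, hη, hη2⟩ := Metric.continuousAt_iff.1 (hF 0).continuousAt ε hε
  obtain ⟨b, hb, hfb⟩ := exists_ge_abs_lt hf a hη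
  have h1 : |F (f b)| < ε := by
    have := hη2 (x := f b) (by simpa using hfb)
    simpa [hF0] using this
  have h2 := comp_sub_comp_le hgi hfg hF hF' ha hb
  have h3 : ∫ x in Ioc a b, |F' (f x) * g x| ≤ ∫ x in Ioi a, |F' (f x) * g x| := by
    refine setIntegral_mono_set ?_ (Eventually.of_forall fun x => abs_nonneg _)
      (Eventually.of_forall Ioc_subset_Ioi_self)
    exact IntegrableOn.mono_set hint.abs fun x hx => ha.trans (le_of_lt hx)
  have h4 := abs_lt.1 h1
  have h5 := abs_le.1 h2
  linarith

end HalfLine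

/-! ### The calibration and the sharp Gagliardo–Nirenberg constant. -/

section Scalar

/-- The integral `∫₀¹ s √(1 - s ^ (p - 2)) ds`: half of the kinetic energy of the soliton with
maximum `1`. -/
noncomputable def gnInt (p : ℝ) : ℝ := ∫ s in (0 : ℝ)..1, s * √(1 - s ^ (p - 2))

/-- The calibration density `s √(M ^ (p - 2) - |s| ^ (p - 2))`. -/
noncomputable def calibDensity (p M s : ℝ) : ℝ := s * √(M ^ (p - 2) - |s| ^ (p - 2))

/-- The calibration, that is, the primitive of `calibDensity` vanishing at `0`. -/
noncomputable def calib (p M y : ℝ) : ℝ := ∫ s in (0 : ℝ)..y, calibDensity p M s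

variable {p M : ℝ}

theorem continuous_calibDensity (hp : 2 < p) : Continuous (calibDensity p M) := by
  have : Continuous fun s : ℝ => |s| ^ (p - 2) :=
    continuous_abs.rpow_const fun _ => Or.inr (by linarith)
  unfold calibDensity
  fun_prop

theorem hasDerivAt_calib (hp : 2 < p) (y : ℝ) :
    HasDerivAt (calib p M) (calibDensity p M y) y :=
  ((continuous_calibDensity hp).integral_hasStrictDerivAt 0 y).hasDerivAt

theorem calib_zero : calib p M 0 = 0 := by simp [calib]

theorem calib_neg (y : ℝ) : calib p M (-y) = calib p M y := by
  have h := intervalIntegral.integral_comp_neg (a := 0) (b := y) (calibDensity p M)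
  rw [neg_zero] at h
  rw [calib, calib, intervalIntegral.integral_symm, ← h, ← intervalIntegral.integral_neg]
  refine intervalIntegral.integral_congr fun s _ => ?_
  simp [calibDensity]

theorem calib_abs (y : ℝ) : calib p M |y| = calib p M y := by
  rcases abs_choice y with h | h <;> rw [h]
  exact calib_neg y

theorem calib_one (y : ℝ) (hy : 0 ≤ y) : calib p 1 y = ∫ s in (0 : ℝ)..y, s * √(1 - s ^ (p - 2)) := by
  refine intervalIntegral.integral_congr fun s hs => ?_
  rw [uIcc_of_le hy] at hs
  simp only [calibDensity, Real.one_rpow, abs_of_nonneg hs.1]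

theorem gnInt_eq_calib : gnInt p = calib p 1 1 := (calib_one 1 zero_le_one).symm

theorem calib_self (hM : 0 < M) : calib p M M = M ^ ((p + 2) / 2) * gnInt p := by
  have h := intervalIntegral.integral_comp_mul_left (a := 0) (b := 1) (calibDensity p M) hM.ne'
  rw [mul_zero, mul_one, smul_eq_mul] at h
  have h2 : calib p M M = M * ∫ s in (0 : ℝ)..1, calibDensity p M (M * s) := by
    rw [h, ← mul_assoc, mul_inv_cancel₀ hM.ne', one_mul, calib]
  rw [h2, gnInt, ← intervalIntegral.integral_const_mul, ← intervalIntegral.integral_const_mul]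
  refine intervalIntegral.integral_congr fun s hs => ?_
  rw [uIcc_of_le zero_le_one] at hs
  have e1 : M ^ (p - 2) - |M * s| ^ (p - 2) = M ^ (p - 2) * (1 - s ^ (p - 2)) := by
    rw [abs_of_nonneg (mul_nonneg hM.le hs.1), Real.mul_rpow hM.le hs.1]
    ring
  have e2 : M ^ ((p + 2) / 2) = M * (M * √(M ^ (p - 2))) := by
    rw [Real.sqrt_eq_rpow, ← Real.rpow_mul hM.le]
    nth_rewrite 2 [← Real.rpow_one M]
    nth_rewrite 3 [← Real.rpow_one M]
    rw [← Real.rpow_add hM, ← Real.rpow_add hM]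
    congr 1
    ring
  simp only [calibDensity]
  rw [e1, Real.sqrt_mul (Real.rpow_nonneg hM.le _), e2]
  ring

theorem gnInt_pos (hp : 2 < p) : 0 < gnInt p := by
  have hc : Continuous fun s : ℝ => s * √(1 - s ^ (p - 2)) := by
    have : Continuous fun s : ℝ => s ^ (p - 2) :=
      continuous_id.rpow_const fun _ => Or.inr (by linarith)
    fun_prop
  refine intervalIntegral.intervalIntegral_pos_of_pos_on (hc.intervalIntegrable _ _) ?_ zero_lt_one
  intro s hs
  refine mul_pos hs.1 (Real.sqrt_pos.2 ?_)
  linarith [Real.rpow_lt_one hs.1.le hs.2 (by linarith : 0 < p - 2)]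

/-- The sharp constant in the Gagliardo–Nirenberg inequality, for functions with `θ` branches:
`θ = 2` for the line and `θ = 1` for the half-line. -/
noncomputable def gnConst (p θ : ℝ) : ℝ :=
  (4 * θ * gnInt p / (p - 2)) /
    ((θ * (p + 2) / (p - 2) * gnInt p) ^ ((p + 2) / 4) * (θ * gnInt p) ^ ((p - 2) / 4))

theorem gnConst_pos (hp : 2 < p) {θ : ℝ} (hθ : 0 < θ) : 0 < gnConst p θ := by
  have := gnInt_pos hp
  have : 0 < p - 2 := by linarith
  unfold gnConst
  positivity

/-- Maximisation over the maximum `M` of the function. -/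
theorem le_gnConst_mul (hp : 2 < p) {θ m N P : ℝ} (hθ : 0 < θ) (hm : 0 < m) (hN : 0 < N)
    (hM : 0 < M) (h : (θ * (M ^ ((p + 2) / 2) * gnInt p)) ^ 2 ≤ N * (M ^ (p - 2) * m - P)) :
    P ≤ gnConst p θ * m ^ ((p + 2) / 4) * N ^ ((p - 2) / 4) := by
  have hI := gnInt_pos hp
  have hp2 : 0 < p - 2 := by linarith
  set I := gnInt p
  set N₀ := θ * I with hN₀
  set m₀ := θ * (p + 2) / (p - 2) * I with hm₀
  have hN₀p : 0 < N₀ := by positivity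
  have hm₀p : 0 < m₀ := by positivity
  set β := (p - 2) / 4 with hβ
  have hβp : 0 < β := by positivity
  have hα : (p + 2) / 4 = β + 1 := by rw [hβ]; ring
  -- the normalised quotients
  set x := m / m₀
  set y := N / N₀
  have hx : 0 < x := by positivity
  have hy : 0 < y := by positivity
  -- Under `u ↦ α u(s ·)` the product of mass and kinetic energy scales as `α⁴`, just like the
  -- fourth power of the maximum. Thus `z` is scale invariant, equals `1` for rescaled solitons, and
  -- is the only free variable left.
  set z := M ^ (4 : ℝ) / (x * y) with hz
  have hzp : 0 < z := by positivity
  have hMz : M ^ (4 : ℝ) = z * (x * y) := by rw [hz]; field_simp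
  have e1 : M ^ (p - 2) = z ^ β * (x * y) ^ β := by
    rw [← Real.mul_rpow hzp.le (by positivity), ← hMz, ← Real.rpow_mul hM.le, hβ]
    congr 1; ring
  have e2 : (M ^ ((p + 2) / 2)) ^ 2 = z ^ (β + 1) * (x * y) ^ (β + 1) := by
    rw [← Real.mul_rpow hzp.le (by positivity), ← hMz, ← Real.rpow_mul hM.le, ← Real.rpow_natCast,
      ← Real.rpow_mul hM.le, hβ]
    congr 1; push_cast; ring
  have e3 : m = x * m₀ := by simp only [x]; field_simp
  have e4 : N = y * N₀ := by simp only [y]; field_simp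
  set A := x ^ (β + 1) * y ^ β with hA
  have hAp : 0 < A := by positivity
  have hxy : (x * y) ^ β * x = A := by
    rw [hA, Real.mul_rpow hx.le hy.le, Real.rpow_add_one hx.ne']; ring
  have hxy1 : (x * y) ^ (β + 1) = A * y := by
    rw [hA, Real.mul_rpow hx.le hy.le, Real.rpow_add_one hy.ne']; ring
  have h1 : P ≤ A * (z ^ β * m₀ - z ^ (β + 1) * N₀) := by
    have h2 : (θ * (M ^ ((p + 2) / 2) * I)) ^ 2 = N * (N₀ * (A * z ^ (β + 1))) := by
      calc (θ * (M ^ ((p + 2) / 2) * I)) ^ 2 = N₀ ^ 2 * (M ^ ((p + 2) / 2)) ^ 2 := by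
            rw [hN₀]; ring
        _ = _ := by rw [e2, hxy1, e4]; ring
    have h3 : M ^ (p - 2) * m = A * z ^ β * m₀ := by
      rw [e1, e3, ← hxy]; ring
    rw [h2, h3] at h
    have := le_of_mul_le_mul_left h hN
    linarith
  -- Since `m₀ = N₀ (β + 1) / β`, the maximum in `z` is at `z = 1`; Young's inequality replaces the
  -- differentiation.
  have h4 : z ^ β * m₀ - z ^ (β + 1) * N₀ ≤ 4 * θ * I / (p - 2) := by
    have hyoung := Real.geom_mean_le_arith_mean2_weighted (w₁ := β / (β + 1)) (w₂ := 1 / (β + 1))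
      (p₁ := z ^ (β + 1)) (p₂ := 1) (by positivity) (by positivity)
      (Real.rpow_nonneg hzp.le _) zero_le_one (by field_simp)
    rw [← Real.rpow_mul hzp.le, mul_div_cancel₀ _ (by positivity), Real.one_rpow, mul_one,
      mul_one] at hyoung
    have h5 := mul_le_mul_of_nonneg_right hyoung hm₀p.le
    have h6 : m₀ = N₀ * ((β + 1) / β) := by
      rw [hm₀, hN₀, hβ]; field_simp; ring
    have h7 : (β / (β + 1) * z ^ (β + 1) + 1 / (β + 1)) * m₀ = z ^ (β + 1) * N₀ + N₀ / β := by
      rw [h6]; field_simp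
    have h8 : N₀ / β = 4 * θ * I / (p - 2) := by
      rw [hN₀, hβ]; field_simp
    linarith
  have h9 : gnConst p θ * m ^ ((p + 2) / 4) * N ^ ((p - 2) / 4) = A * (4 * θ * I / (p - 2)) := by
    have : gnConst p θ = (4 * θ * I / (p - 2)) / (m₀ ^ (β + 1) * N₀ ^ β) := by
      rw [gnConst, hα]
    rw [this, hα, e3, e4, Real.mul_rpow hx.le hm₀p.le, Real.mul_rpow hy.le hN₀p.le, hA]
    have : 0 < m₀ ^ (β + 1) := by positivity
    have : 0 < N₀ ^ β := by positivity
    rw [← hβ]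
    field_simp
  rw [h9]
  exact h1.trans (mul_le_mul_of_nonneg_left h4 hAp.le)

end Scalar

end MetricGraph

/-! ### Gagliardo–Nirenberg inequalities on the line and the half-line. -/

namespace MetricGraph

open Filter Topology

/-- Every value of an `H¹` function is attained on at least `θ` disjoint branches going to `0`, in
the form in which this is used for calibrations. -/
def IsCalibrated (G : MetricGraph.{u, v}) (θ : ℝ) : Prop :=
  ∀ (w : G.L2 × G.L2) (f : G.E × ℝ → ℝ), f =ᵐ[G.edgeMeasure] w.1 → G.IsPrimitive f w.2 →
    ∀ F F' : ℝ → ℝ, (∀ y, HasDerivAt F (F' y) y) → Continuous F' → F 0 = 0 →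
      Integrable (fun z => F' (f z) * w.2 z) G.edgeMeasure →
      ∀ e, ∀ x ∈ G.interval e, θ * F (f (e, x)) ≤ ∫ z, |F' (f z) * w.2 z| ∂G.edgeMeasure

theorem ae_mem_interval {G : MetricGraph.{u, v}} [Countable G.E] :
    ∀ᵐ z ∂G.edgeMeasure, z.2 ∈ G.interval z.1 :=
  ae_edgeMeasure_iff.2 fun e => ae_restrict_mem (measurableSet_interval e)

theorem sq_integral_mul_le {α : Type*} [MeasurableSpace α] {ν : Measure α} {f g : α → ℝ}
    (hf : MemLp f 2 ν) (hg : MemLp g 2 ν) :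
    (∫ z, |f z * g z| ∂ν) ^ 2 ≤ (∫ z, f z ^ 2 ∂ν) * ∫ z, g z ^ 2 ∂ν := by
  have h := integral_mul_norm_le_Lp_mul_Lq (μ := ν) (f := f) (g := g) (p := 2) (q := 2)
    ⟨by norm_num, by norm_num, by norm_num⟩ (by simpa using hf) (by simpa using hg)
  have h0 : 0 ≤ ∫ z, |f z * g z| ∂ν := integral_nonneg fun z => abs_nonneg _
  have e1 : ∫ z, ‖f z‖ * ‖g z‖ ∂ν = ∫ z, |f z * g z| ∂ν := by simp [abs_mul]
  have e2 : ∀ k : α → ℝ, ((∫ z, ‖k z‖ ^ (2 : ℝ) ∂ν) ^ ((1 : ℝ) / 2)) ^ 2 = ∫ z, k z ^ 2 ∂ν := by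
    intro k
    rw [← Real.sqrt_eq_rpow, Real.sq_sqrt (integral_nonneg fun z => by positivity)]
    simp
  rw [e1] at h
  calc _ ≤ _ := pow_le_pow_left₀ h0 h 2
    _ = _ := by rw [mul_pow, e2, e2]

/-- The calibration `F(y) = y²` bounds the function, so its supremum `M` is finite. For the
calibration `calib p M`, `∫ F'(f)² = M^(p-2) μ - ‖f‖_p^p`, and Cauchy–Schwarz against `f'` gives `(θ
F(M))² ≤ ‖f'‖₂² (M^(p-2) μ - ‖f‖_p^p)`, which is then optimised in `M`. -/
theorem IsCalibrated.hasGNBound {G : MetricGraph.{u, v}} [Countable G.E] [Nonempty G.E] {θ : ℝ}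
    (hG : G.IsCalibrated θ) (hθ : 0 < θ) {p : ℝ} (hp : 2 < p) {μ : ℝ} (hμ : 0 < μ) :
    G.HasGNBound p μ (gnConst p θ * μ ^ ((p + 2) / 4)) := by
  rintro w ⟨⟨f, hfw, hfg⟩, hmass⟩
  have hp2 : 0 < p - 2 := by linarith
  have hf2 : MemLp f 2 G.edgeMeasure := (Lp.memLp w.1).ae_eq hfw.symm
  have hg2 : MemLp w.2 2 G.edgeMeasure := Lp.memLp w.2
  have hcal := hG w f hfw hfg
  -- the function is bounded
  have hbdd : ∃ K, ∀ e, ∀ x ∈ G.interval e, |f (e, x)| ≤ K := by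
    have h := hcal (fun y => y ^ 2) (fun y => 2 * y)
      (fun y => by simpa using hasDerivAt_pow 2 y) (by fun_prop) (by simp)
      ((hf2.const_mul 2).integrable_mul hg2)
    refine ⟨√((∫ z, |2 * f z * w.2 z| ∂G.edgeMeasure) / θ), fun e x hx => Real.abs_le_sqrt ?_⟩
    rw [le_div_iff₀ hθ, mul_comm]
    exact h e x hx
  obtain ⟨K, hK⟩ := hbdd
  set S : Set ℝ := {y | ∃ e, ∃ x ∈ G.interval e, y = |f (e, x)|} with hS
  have hSb : BddAbove S := ⟨K, by rintro _ ⟨e, x, hx, rfl⟩; exact hK e x hx⟩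
  have hSn : S.Nonempty := by
    obtain ⟨e⟩ := ‹Nonempty G.E›
    exact ⟨_, e, 0, ⟨le_rfl, by simp⟩, rfl⟩
  set M := sSup S with hMdef
  have hfM : ∀ e, ∀ x ∈ G.interval e, |f (e, x)| ≤ M := fun e x hx => le_csSup hSb ⟨e, x, hx, rfl⟩
  have hM0 : 0 ≤ M := by
    obtain ⟨_, e, x, hx, rfl⟩ := hSn
    exact (abs_nonneg _).trans (hfM e x hx)
  have hfMae : ∀ᵐ z ∂G.edgeMeasure, |f z| ≤ M := by
    filter_upwards [ae_mem_interval (G := G)] with z hz using hfM z.1 z.2 hz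
  have hm : ∫ z, f z ^ 2 ∂G.edgeMeasure = μ := by
    rw [← hmass, norm_sq_eq_integral]
    refine integral_congr_ae ?_
    filter_upwards [hfw] with z hz
    rw [hz]
  have hP : ∫ z, |w.1 z| ^ p ∂G.edgeMeasure = ∫ z, |f z| ^ p ∂G.edgeMeasure := by
    refine integral_congr_ae ?_
    filter_upwards [hfw] with z hz
    rw [hz]
  have hMpos : 0 < M := by
    refine hM0.lt_of_ne fun h => hμ.ne ?_
    rw [← hm, integral_eq_zero_of_ae]
    filter_upwards [hfMae] with z hz
    rw [← h] at hz
    simp [abs_eq_zero.1 (le_antisymm hz (abs_nonneg _))]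
  have hsplit : ∀ y : ℝ, |y| ^ p = |y| ^ (p - 2) * y ^ 2 := by
    intro y
    rw [← sq_abs y, ← Real.rpow_natCast |y| 2, ← Real.rpow_add_of_nonneg (abs_nonneg y) hp2.le
      (by norm_num)]
    norm_num
  have hle : ∀ y : ℝ, |y| ≤ M → |y| ^ (p - 2) ≤ M ^ (p - 2) := fun y hy =>
    Real.rpow_le_rpow (abs_nonneg y) hy hp2.le
  have hPint : Integrable (fun z => |f z| ^ p) G.edgeMeasure := by
    refine Integrable.mono' (hf2.integrable_sq.const_mul (M ^ (p - 2))) ?_ ?_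
    · exact (continuous_abs.rpow_const fun _ => Or.inr (by linarith)).comp_aestronglyMeasurable
        hf2.aestronglyMeasurable
    · filter_upwards [hfMae] with z hz
      rw [Real.norm_of_nonneg (Real.rpow_nonneg (abs_nonneg _) _), hsplit]
      exact mul_le_mul_of_nonneg_right (hle _ hz) (sq_nonneg _)
  have hdsq : ∀ y : ℝ, |y| ≤ M → calibDensity p M y ^ 2 = M ^ (p - 2) * y ^ 2 - |y| ^ p := by
    intro y hy
    rw [calibDensity, mul_pow, Real.sq_sqrt (sub_nonneg.2 (hle y hy)), hsplit]
    ring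
  have hdint : Integrable (fun z => M ^ (p - 2) * f z ^ 2 - |f z| ^ p) G.edgeMeasure :=
    (hf2.integrable_sq.const_mul _).sub hPint
  have hdsqae : (fun z => calibDensity p M (f z) ^ 2) =ᵐ[G.edgeMeasure]
      fun z => M ^ (p - 2) * f z ^ 2 - |f z| ^ p := by
    filter_upwards [hfMae] with z hz using hdsq _ hz
  have hdmem : MemLp (fun z => calibDensity p M (f z)) 2 G.edgeMeasure := by
    refine (memLp_two_iff_integrable_sq ?_).2 (hdint.congr hdsqae.symm)
    exact (continuous_calibDensity hp).comp_aestronglyMeasurable hf2.aestronglyMeasurable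
  have hkey : θ * calib p M M ≤ ∫ z, |calibDensity p M (f z) * w.2 z| ∂G.edgeMeasure := by
    have h := hcal (calib p M) (calibDensity p M) (hasDerivAt_calib hp) (continuous_calibDensity hp)
      calib_zero (hdmem.integrable_mul hg2)
    -- The supremum `M` is only known to be in the closure of the set of values, so the bound is
    -- carried to `M` by continuity of `calib`.
    have hcl : IsClosed {y | θ * calib p M y ≤
        ∫ z, |calibDensity p M (f z) * w.2 z| ∂G.edgeMeasure} := by
      have : Continuous (calib p M) :=
        continuous_iff_continuousAt.2 fun y => (hasDerivAt_calib hp y).continuousAt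
      exact isClosed_le (by fun_prop) continuous_const
    refine hcl.closure_subset_iff.2 ?_ (csSup_mem_closure hSn hSb)
    rintro _ ⟨e, x, hx, rfl⟩
    change θ * calib p M |f (e, x)| ≤ _
    rw [calib_abs]
    exact h e x hx
  have hCS := sq_integral_mul_le hdmem hg2
  rw [integral_congr_ae hdsqae, integral_sub (hf2.integrable_sq.const_mul _) hPint,
    integral_const_mul, hm, ← norm_sq_eq_integral] at hCS
  have hI := gnInt_pos hp
  rw [calib_self hMpos] at hkey
  have hfin : (θ * (M ^ ((p + 2) / 2) * gnInt p)) ^ 2 ≤ ‖w.2‖ ^ 2 *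
      (M ^ (p - 2) * μ - ∫ z, |f z| ^ p ∂G.edgeMeasure) := by
    calc _ ≤ _ := pow_le_pow_left₀ (by positivity) hkey 2
      _ ≤ _ := hCS
      _ = _ := by ring
  have hN : 0 < ‖w.2‖ ^ 2 := by
    refine (sq_nonneg _).lt_of_ne fun h => ?_
    rw [← h, zero_mul] at hfin
    have : 0 < (θ * (M ^ ((p + 2) / 2) * gnInt p)) ^ 2 := by positivity
    linarith
  have := le_gnConst_mul hp hθ hμ hN hMpos hfin
  rw [hP]
  refine this.trans (le_of_eq ?_)
  congr 1
  rw [← Real.rpow_natCast, ← Real.rpow_mul (norm_nonneg _)]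
  congr 1
  push_cast
  ring

instance : Countable line.E := inferInstanceAs (Countable Bool)
instance : Nonempty line.E := inferInstanceAs (Nonempty Bool)
instance : Fintype line.E := inferInstanceAs (Fintype Bool)
instance : Countable halfLine.E := inferInstanceAs (Countable Unit)
instance : Nonempty halfLine.E := inferInstanceAs (Nonempty Unit)
instance : Fintype halfLine.E := inferInstanceAs (Fintype Unit)

theorem interval_line (e : line.E) : line.interval e = Ici 0 := interval_of_eq_top rfl

theorem interval_halfLine (e : halfLine.E) : halfLine.interval e = Ici 0 := interval_of_eq_top rfl

section Star

variable {G : MetricGraph.{u, v}} {w : G.L2 × G.L2} {f : G.E × ℝ → ℝ}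
  {F F' : ℝ → ℝ}

theorem comp_le_integral_edge (hl : ∀ e, G.interval e = Ici 0)
    (hfw : f =ᵐ[G.edgeMeasure] w.1) (hfg : G.IsPrimitive f w.2)
    (hF : ∀ y, HasDerivAt F (F' y) y) (hF' : Continuous F') (hF0 : F 0 = 0)
    (hint : Integrable (fun z => F' (f z) * w.2 z) G.edgeMeasure) (e : G.E) {x : ℝ} (hx : 0 ≤ x) :
    F (f (e, x)) ≤ ∫ t in Ioi x, |F' (f (e, t)) * w.2 (e, t)| := by
  obtain ⟨c, hc⟩ := hfg
  refine comp_le_integral_Ioi (f := fun t => f (e, t)) (g := fun t => w.2 (e, t))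
    (c := c (G.src e)) ?_ ?_ ?_ hF hF' hF0 ?_ hx
  · have := memLp_edge ((Lp.memLp w.1).ae_eq hfw.symm) e
    rwa [hl e] at this
  · intro t ht
    exact intervalIntegrable_edge (Lp.memLp w.2) (by rw [hl e]; exact ht)
  · intro t ht
    exact (hc e).1 t (by rw [hl e]; exact ht)
  · have := integrable_edge hint e
    rwa [hl e] at this

theorem comp_sub_le_integral_edge (hl : ∀ e, G.interval e = Ici 0)
    (hfg : G.IsPrimitive f w.2)
    (hF : ∀ y, HasDerivAt F (F' y) y) (hF' : Continuous F') (e : G.E) {x : ℝ} (hx : 0 ≤ x) :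
    F (f (e, x)) - F (f (e, 0)) ≤ ∫ t in Ioc 0 x, |F' (f (e, t)) * w.2 (e, t)| := by
  obtain ⟨c, hc⟩ := hfg
  refine (le_abs_self _).trans ?_
  refine comp_sub_comp_le (f := fun t => f (e, t)) (g := fun t => w.2 (e, t))
    (c := c (G.src e)) ?_ ?_ hF hF' le_rfl hx
  · intro t ht
    exact intervalIntegrable_edge (Lp.memLp w.2) (by rw [hl e]; exact ht)
  · intro t ht
    exact (hc e).1 t (by rw [hl e]; exact ht)

theorem integral_Ici_split {h : ℝ → ℝ} (hh : IntegrableOn h (Ici 0)) {x : ℝ} (hx : 0 ≤ x) :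
    ∫ t in Ici 0, h t = (∫ t in Ioc 0 x, h t) + ∫ t in Ioi x, h t := by
  rw [integral_Ici_eq_integral_Ioi, ← Ioc_union_Ioi_eq_Ioi hx]
  exact setIntegral_union (Ioc_disjoint_Ioi le_rfl) measurableSet_Ioi
    (hh.mono_set fun t ht => ht.1.le) (hh.mono_set fun t ht => hx.trans (le_of_lt ht))

end Star

/-- The one branch is the ray from `x` to infinity. -/
theorem isCalibrated_halfLine : halfLine.IsCalibrated 1 := by
  intro w f hfw hfg F F' hF hF' hF0 hint e x hx
  have hx0 : 0 ≤ x := hx.1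
  rw [integral_edgeMeasure hint.abs, tsum_fintype, one_mul]
  have hu : (Finset.univ : Finset halfLine.E) = {e} := Finset.ext fun a => by
    simp only [Finset.mem_univ, Finset.mem_singleton, true_iff]
    exact Subsingleton.elim (α := Unit) a e
  rw [hu, Finset.sum_singleton, interval_halfLine]
  have hi : IntegrableOn (fun t => |F' (f (e, t)) * w.2 (e, t)|) (Ici 0) := by
    have := integrable_edge hint.abs e
    rwa [interval_halfLine] at this
  rw [integral_Ici_split hi hx0]
  have h1 := comp_le_integral_edge interval_halfLine hfw hfg hF hF' hF0 hint e hx0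
  have h2 : 0 ≤ ∫ t in Ioc 0 x, |F' (f (e, t)) * w.2 (e, t)| :=
    integral_nonneg fun t => abs_nonneg _
  linarith

theorem sum_line (e : Bool) (h : Bool → ℝ) : ∑ b : Bool, h b = h e + h !e := by
  cases e <;> simp [add_comm]

/-- The two branches are the ray beyond `x` on its own half-line, and the segment back to the vertex
followed by the whole other half-line; continuity at the vertex glues the latter two pieces. -/
theorem isCalibrated_line : line.IsCalibrated 2 := by
  intro w f hfw hfg F F' hF hF' hF0 hint e x hx
  have hx0 : 0 ≤ x := hx.1
  obtain ⟨e', he'⟩ : ∃ e' : line.E, ∀ h : line.E → ℝ, ∑ b, h b = h e + h e' :=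
    ⟨(!e : Bool), sum_line e⟩
  have hi : ∀ e : line.E, IntegrableOn (fun t => |F' (f (e, t)) * w.2 (e, t)|) (Ici 0) := by
    intro e
    have := integrable_edge hint.abs e
    rwa [interval_line] at this
  rw [integral_edgeMeasure hint.abs, tsum_fintype, he', interval_line, interval_line,
    integral_Ici_split (hi e) hx0, integral_Ici_eq_integral_Ioi]
  have h1 := comp_le_integral_edge interval_line hfw hfg hF hF' hF0 hint e hx0
  have h2 := comp_le_integral_edge interval_line hfw hfg hF hF' hF0 hint e' le_rfl
  have h3 := comp_sub_le_integral_edge interval_line hfg hF hF' e hx0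
  have h4 : f (e, 0) = f (e', 0) := by
    obtain ⟨c, hc⟩ := hfg
    rw [(hc e).1 0 ⟨le_rfl, by simp⟩, (hc e').1 0 ⟨le_rfl, by simp⟩,
      intervalIntegral.integral_same, intervalIntegral.integral_same]
    rfl
  rw [h4] at h3
  linarith

end MetricGraph

/-! ### Continuous families in `H1` supported in finitely many edges. -/

namespace MetricGraph

open Filter Topology

variable {G : MetricGraph.{u, v}}

section FiniteSupport

variable {S : Finset G.E} {X : ℝ}

theorem isCompact_interval_inter (e : G.E) (X : ℝ) : IsCompact (G.interval e ∩ Iic X) := by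
  by_cases h : G.len e = ⊤
  · rw [interval_of_eq_top h, Ici_inter_Iic]
    exact isCompact_Icc
  · rw [interval_of_ne_top h]
    exact isCompact_Icc.inter_right isClosed_Iic

theorem setIntegral_interval_inter {e : G.E} {h : ℝ → ℝ}
    (h0 : ∀ x ∈ G.interval e, X < x → h x = 0) :
    ∫ x in G.interval e ∩ Iic X, h x = ∫ x in G.interval e, h x := by
  refine (setIntegral_eq_of_subset_of_forall_sdiff_eq_zero (measurableSet_interval e)
    inter_subset_left fun x hx => ?_).symm
  exact h0 x hx.1 (not_le.1 fun hle => hx.2 ⟨hx.1, hle⟩)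

variable [Countable G.E]

/-- The premise `e ∈ S → X < x` holds for every point of an edge outside `S` and for the points
beyond `X` on an edge of `S`, so this single implication confines the support to a finite union of
compact pieces. -/
theorem integrable_of_finite_support {F : G.E × ℝ → ℝ} (hF : ∀ e, Continuous fun x => F (e, x))
    (h0 : ∀ e, ∀ x ∈ G.interval e, (e ∈ S → X < x) → F (e, x) = 0) :
    Integrable F G.edgeMeasure := by
  have h1 : ∀ e, IntegrableOn (fun x => F (e, x)) (G.interval e) := by
    intro e
    have h2 : IntegrableOn (fun x => F (e, x)) (G.interval e ∩ Iic X) :=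
      (hF e).continuousOn.integrableOn_compact (isCompact_interval_inter e X)
    refine h2.of_forall_sdiff_eq_zero (measurableSet_interval e) fun x hx => ?_
    exact h0 e x hx.1 fun _ => not_le.1 fun hle => hx.2 ⟨hx.1, hle⟩
  refine integrable_sum_measure (fun e =>
    (measurableEmbedding_prodMk_left e).integrable_map_iff.2 (h1 e)) ?_
  refine summable_of_ne_finset_zero (s := S) fun e he => ?_
  rw [integral_map_edge (fun z => ‖F z‖) e]
  refine setIntegral_eq_zero_of_forall_eq_zero fun x hx => ?_
  rw [h0 e x hx fun h => absurd h he, norm_zero]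

theorem integral_of_finite_support {F : G.E × ℝ → ℝ} (hF : ∀ e, Continuous fun x => F (e, x))
    (h0 : ∀ e, ∀ x ∈ G.interval e, (e ∈ S → X < x) → F (e, x) = 0) :
    ∫ z, F z ∂G.edgeMeasure = ∑ e ∈ S, ∫ x in G.interval e, F (e, x) := by
  rw [integral_edgeMeasure (integrable_of_finite_support hF h0)]
  refine tsum_eq_sum fun e he => ?_
  refine setIntegral_eq_zero_of_forall_eq_zero fun x hx => ?_
  exact h0 e x hx fun h => absurd h he

theorem memLp_of_finite_support {F : G.E × ℝ → ℝ} (hF : ∀ e, Continuous fun x => F (e, x))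
    (h0 : ∀ e, ∀ x ∈ G.interval e, (e ∈ S → X < x) → F (e, x) = 0) :
    MemLp F 2 G.edgeMeasure := by
  refine (memLp_two_iff_integrable_sq
    (integrable_of_finite_support hF h0).aestronglyMeasurable).2 ?_
  refine integrable_of_finite_support (S := S) (X := X) (fun e => (hF e).pow 2) fun e x hx h => ?_
  simp [h0 e x hx h]

/-- On the common compact support the squared `L²` distance to `U s₀` is a finite sum of integrals
depending continuously on the parameter, and it vanishes at `s₀`. -/
theorem exists_L2_family {I : Set ℝ} {k : ℝ → G.E → ℝ → ℝ}
    (hk : ∀ e, Continuous fun q : ℝ × ℝ => k q.1 e q.2)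
    (h0 : ∀ s ∈ I, ∀ e, ∀ x ∈ G.interval e, (e ∈ S → X < x) → k s e x = 0) :
    ∃ U : ℝ → G.L2, ContinuousOn U I ∧
      ∀ s ∈ I, U s =ᵐ[G.edgeMeasure] fun z => k s z.1 z.2 := by
  classical
  have hc : ∀ s e, Continuous fun x => k s e x := fun s e =>
    (hk e).comp (by fun_prop : Continuous fun x : ℝ => (s, x))
  have hmem : ∀ s ∈ I, MemLp (fun z : G.E × ℝ => k s z.1 z.2) 2 G.edgeMeasure := fun s hs =>
    memLp_of_finite_support (S := S) (X := X) (hc s) (h0 s hs)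
  let U : ℝ → G.L2 := fun s => if hs : s ∈ I then (hmem s hs).toLp _ else 0
  have hU : ∀ s (hs : s ∈ I), U s = (hmem s hs).toLp _ := fun s hs => dif_pos hs
  refine ⟨U, ?_, fun s hs => by rw [hU s hs]; exact (hmem s hs).coeFn_toLp⟩
  intro s₀ hs₀
  let D : ℝ → ℝ := fun s => ∑ e ∈ S, ∫ x in G.interval e ∩ Iic X, (k s e x - k s₀ e x) ^ 2
  have hD : Continuous D := by
    refine continuous_finsetSum _ fun e _ => ?_
    refine continuous_parametric_integral_of_continuous ?_ (isCompact_interval_inter e X)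
    have h1 := hk e
    have h2 : Continuous fun q : ℝ × ℝ => k s₀ e q.2 := (hc s₀ e).comp continuous_snd
    exact (h1.sub h2).pow 2
  have hnorm : ∀ s ∈ I, ‖U s - U s₀‖ ^ 2 = D s := by
    intro s hs
    rw [hU s hs, hU s₀ hs₀, ← MemLp.toLp_sub, norm_sq_toLp]
    rw [integral_of_finite_support (S := S) (X := X)]
    · refine Finset.sum_congr rfl fun e he => ?_
      refine (setIntegral_interval_inter fun x hx hXx => ?_).symm
      change (k s e x - k s₀ e x) ^ 2 = 0
      rw [h0 s hs e x hx fun _ => hXx, h0 s₀ hs₀ e x hx fun _ => hXx]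
      norm_num
    · intro e
      exact ((hc s e).sub (hc s₀ e)).pow 2
    · intro e x hx h
      simp [h0 s hs e x hx h, h0 s₀ hs₀ e x hx h]
  have hD0 : D s₀ = 0 := by simp [D]
  rw [ContinuousWithinAt, tendsto_iff_norm_sub_tendsto_zero]
  have h1 : Tendsto (fun s => √(D s)) (𝓝[I] s₀) (𝓝 0) := by
    have := (Real.continuous_sqrt.comp hD).tendsto s₀
    rw [Function.comp_apply, hD0, Real.sqrt_zero] at this
    exact this.mono_left nhdsWithin_le_nhds
  refine h1.congr' ?_
  filter_upwards [self_mem_nhdsWithin] with s hs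
  rw [← hnorm s hs, Real.sqrt_sq (norm_nonneg _)]

end FiniteSupport

/-- A family of functions on the graph, differentiable along each edge and supported in the parts
`[0, X]` of finitely many edges, gives a continuous family in `H¹`. -/
theorem exists_H1_family [Countable G.E] {S : Finset G.E} {X : ℝ} {I : Set ℝ} {f g : ℝ → G.E → ℝ → ℝ}
    (hf : ∀ e, Continuous fun q : ℝ × ℝ => f q.1 e q.2)
    (hg : ∀ e, Continuous fun q : ℝ × ℝ => g q.1 e q.2)
    (hfg : ∀ s e x, HasDerivAt (f s e) (g s e x) x)
    (hf0 : ∀ s ∈ I, ∀ e, ∀ x ∈ G.interval e, (e ∈ S → X < x) → f s e x = 0)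
    (hg0 : ∀ s ∈ I, ∀ e, ∀ x ∈ G.interval e, (e ∈ S → X < x) → g s e x = 0)
    (hvert : ∀ s ∈ I, ∃ c : G.V → ℝ, ∀ e, f s e 0 = c (G.src e) ∧
      ∀ h : G.len e ≠ ⊤, f s e (G.len e).toReal = c (G.tgt e h)) :
    ∃ U : ℝ → G.L2 × G.L2, ContinuousOn U I ∧ ∀ s ∈ I, U s ∈ G.H1 ∧
      ‖(U s).1‖ ^ 2 = ∑ e ∈ S, ∫ x in G.interval e, f s e x ^ 2 ∧
      ‖(U s).2‖ ^ 2 = ∑ e ∈ S, ∫ x in G.interval e, g s e x ^ 2 ∧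
      ∀ p : ℝ, 0 < p → ∫ z, |(U s).1 z| ^ p ∂G.edgeMeasure =
        ∑ e ∈ S, ∫ x in G.interval e, |f s e x| ^ p := by
  obtain ⟨U, hU, hUf⟩ := exists_L2_family hf hf0
  obtain ⟨W, hW, hWg⟩ := exists_L2_family hg hg0
  have hfc : ∀ s e, Continuous fun x => f s e x := fun s e =>
    (hf e).comp (by fun_prop : Continuous fun x : ℝ => (s, x))
  have hgc : ∀ s e, Continuous fun x => g s e x := fun s e =>
    (hg e).comp (by fun_prop : Continuous fun x : ℝ => (s, x))
  refine ⟨fun s => (U s, W s), hU.prodMk hW, fun s hs => ⟨?_, ?_, ?_, ?_⟩⟩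
  · refine ⟨fun z => f s z.1 z.2, (hUf s hs).symm, ?_⟩
    obtain ⟨c, hc⟩ := hvert s hs
    refine IsPrimitive.congr (g := fun z => g s z.1 z.2) ⟨c, fun e => ⟨fun x hx => ?_, (hc e).2⟩⟩
      (hWg s hs).symm
    change f s e x = c (G.src e) + ∫ t in (0 : ℝ)..x, g s e t
    rw [intervalIntegral.integral_eq_sub_of_hasDerivAt (fun t _ => hfg s e t)
      ((hgc s e).intervalIntegrable _ _), (hc e).1]
    ring
  · rw [norm_sq_eq_integral, ← integral_of_finite_support (F := fun z => f s z.1 z.2 ^ 2)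
      (S := S) (X := X) (fun e => (hfc s e).pow 2)]
    · refine integral_congr_ae ?_
      filter_upwards [hUf s hs] with z hz
      rw [hz]
    · intro e x hx h
      simp [hf0 s hs e x hx h]
  · rw [norm_sq_eq_integral, ← integral_of_finite_support (F := fun z => g s z.1 z.2 ^ 2)
      (S := S) (X := X) (fun e => (hgc s e).pow 2)]
    · refine integral_congr_ae ?_
      filter_upwards [hWg s hs] with z hz
      rw [hz]
    · intro e x hx h
      simp [hg0 s hs e x hx h]
  · intro p hp
    rw [← integral_of_finite_support (F := fun z => |f s z.1 z.2| ^ p)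
      (S := S) (X := X) (fun e => (hfc s e).abs.rpow_const fun _ => Or.inr hp.le)]
    · refine integral_congr_ae ?_
      filter_upwards [hUf s hs] with z hz
      rw [hz]
    · intro e x hx h
      simp [hf0 s hs e x hx h, Real.zero_rpow hp.ne']

end MetricGraph

/-! ### From families of test functions to bounds for the level. -/

namespace MetricGraph

open Filter Topology

variable {G : MetricGraph.{u, v}} {p θ μ : ℝ}

theorem integral_rpow_smul {w : G.L2 × G.L2} {c : ℝ} :
    ∫ z, |(c • w).1 z| ^ p ∂G.edgeMeasure = |c| ^ p * ∫ z, |w.1 z| ^ p ∂G.edgeMeasure := by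
  rw [← integral_const_mul]
  refine integral_congr_ae ?_
  filter_upwards [Lp.coeFn_smul c w.1] with z hz
  rw [Prod.smul_fst, hz, Pi.smul_apply, smul_eq_mul, abs_mul,
    Real.mul_rpow (abs_nonneg _) (abs_nonneg _)]

theorem rpow_half_mul {x a : ℝ} (hx : 0 ≤ x) : (x ^ 2) ^ (a / 2) = x ^ a := by
  rw [← Real.rpow_natCast, ← Real.rpow_mul hx]
  congr 1
  push_cast
  ring

/-- The multiple of `w` that has mass `μ`. -/
noncomputable def normalize (μ : ℝ) (w : G.L2 × G.L2) : G.L2 × G.L2 := (√μ / ‖w.1‖) • w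

theorem normalize_mem_H1mass [Countable G.E] {w : G.L2 × G.L2} (hμ : 0 ≤ μ) (hw : w ∈ G.H1)
    (h0 : 0 < ‖w.1‖) : normalize μ w ∈ G.H1mass μ := by
  refine ⟨smul_mem_H1 hw _, ?_⟩
  rw [normalize, Prod.smul_fst, norm_smul, norm_div, norm_norm, div_mul_cancel₀ _ h0.ne',
    Real.norm_of_nonneg (Real.sqrt_nonneg _), Real.sq_sqrt hμ]

theorem norm_normalize_snd_sq {w : G.L2 × G.L2} (hμ : 0 ≤ μ) :
    ‖(normalize μ w).2‖ ^ 2 = μ * (‖w.2‖ ^ 2 / ‖w.1‖ ^ 2) := by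
  rw [normalize, Prod.smul_snd, norm_smul, norm_div, norm_norm, mul_pow, div_pow,
    Real.norm_of_nonneg (Real.sqrt_nonneg _), Real.sq_sqrt hμ]
  ring

/-- `w` reaches the fraction `r` of the constant `gnConst p θ` in the Gagliardo–Nirenberg
inequality. -/
def ReachesGN (p θ r : ℝ) (w : G.L2 × G.L2) : Prop :=
  r * gnConst p θ * (‖w.1‖ ^ 2) ^ ((p + 2) / 4) * (‖w.2‖ ^ 2) ^ ((p - 2) / 4) ≤
    ∫ z, |w.1 z| ^ p ∂G.edgeMeasure

theorem ReachesGN.mono {r r' : ℝ} {w : G.L2 × G.L2} (h : ReachesGN p θ r w) (hp : 2 < p)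
    (hθ : 0 < θ) (hr : r' ≤ r) : ReachesGN p θ r' w := by
  refine le_trans ?_ h
  have := gnConst_pos hp hθ
  gcongr

/-- The exponents `(p + 2)/2` and `(p - 2)/2` of the two norms add up to `p`, so the quotient is
unchanged by normalisation. A large quotient bounds the energy from above by the fibre function with
coefficient enlarged by `r`. -/
theorem ReachesGN.energy_normalize_le {r ρ : ℝ} {w : G.L2 × G.L2} (h : ReachesGN p θ r w)
    (hp : 0 < p) (hρ : 0 ≤ ρ) (hμ : 0 < μ) (h0 : 0 < ‖w.1‖) :
    G.energy p ρ (normalize μ w) ≤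
      fiber ((p - 2) / 2) (ρ / p * (r * (gnConst p θ * μ ^ ((p + 2) / 4)))) ‖(normalize μ w).2‖ := by
  have hc : 0 < √μ / ‖w.1‖ := div_pos (Real.sqrt_pos.2 hμ) h0
  have h1 : r * (gnConst p θ * μ ^ ((p + 2) / 4)) * ‖(normalize μ w).2‖ ^ ((p - 2) / 2) ≤
      ∫ z, |(normalize μ w).1 z| ^ p ∂G.edgeMeasure := by
    rw [normalize, integral_rpow_smul, Prod.smul_snd, norm_smul, Real.norm_of_nonneg hc.le,
      abs_of_pos hc]
    refine le_trans (le_of_eq ?_) (mul_le_mul_of_nonneg_left h (Real.rpow_nonneg hc.le p))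
    rw [show (p + 2) / 4 = (p + 2) / 2 / 2 by ring, show (p - 2) / 4 = (p - 2) / 2 / 2 by ring,
      rpow_half_mul h0.le, rpow_half_mul (norm_nonneg _)]
    have e1 : μ ^ ((p + 2) / 2 / 2) = (√μ / ‖w.1‖) ^ ((p + 2) / 2) * ‖w.1‖ ^ ((p + 2) / 2) := by
      rw [← Real.mul_rpow hc.le h0.le, div_mul_cancel₀ _ h0.ne', ← rpow_half_mul (Real.sqrt_nonneg μ),
        Real.sq_sqrt hμ.le]
    have e2 : (√μ / ‖w.1‖) ^ p =
        (√μ / ‖w.1‖) ^ ((p + 2) / 2) * (√μ / ‖w.1‖) ^ ((p - 2) / 2) := by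
      rw [← Real.rpow_add hc]
      congr 1
      ring
    rw [e1, e2, Real.mul_rpow hc.le (norm_nonneg _)]
    ring
  have h2 := mul_le_mul_of_nonneg_left h1 (div_nonneg hρ hp.le)
  rw [energy, fiber]
  linarith

theorem exists_fiber_neg {q a : ℝ} (hq : 2 < q) (ha : 0 < a) :
    ∃ K : ℝ, ∀ x, 0 ≤ x → K ≤ x ^ 2 → fiber q a x < 0 := by
  have h := (tendsto_rpow_atTop (by linarith : 0 < q - 2)).eventually_gt_atTop (1 / (2 * a))
  obtain ⟨X, hX⟩ := eventually_atTop.1 (h.and (eventually_gt_atTop 0))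
  refine ⟨X ^ 2, fun x hx0 hx => ?_⟩
  have hXx : X ≤ x := abs_le_of_sq_le_sq' hx hx0 |>.2
  obtain ⟨h1, hxpos⟩ := hX x hXx
  have h2 : x ^ q = x ^ (q - 2) * x ^ 2 := by
    rw [← Real.rpow_natCast x 2, ← Real.rpow_add hxpos]
    norm_num
  have h3 : 1 / 2 < a * x ^ (q - 2) := by
    calc 1 / 2 = a * (1 / (2 * a)) := by field_simp
      _ < _ := mul_lt_mul_of_pos_left h1 ha
  rw [fiber, h2]
  nlinarith [pow_pos hxpos 2]

/-- A continuous family of test functions whose kinetic energy becomes infinite bounds the mountain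
pass level, for small masses. -/
theorem exists_level_le_of_reachesGN [Countable G.E] (hp : 6 < p) (hθ : 0 < θ) {r₀ s₀ : ℝ}
    (hr₀ : 0 < r₀) {U : ℝ → G.L2 × G.L2} (hU : ContinuousOn U (Ici s₀))
    (hH1 : ∀ s ≥ s₀, U s ∈ G.H1) (hm : ∀ s ≥ s₀, 0 < ‖(U s).1‖)
    (hinf : ∀ K : ℝ, ∃ s ≥ s₀, K ≤ ‖(U s).2‖ ^ 2 / ‖(U s).1‖ ^ 2)
    (hQ : ∀ s₁ ≥ s₀, ∃ r > r₀, ∀ s ∈ Icc s₀ s₁, ReachesGN p θ r (U s)) :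
    ∃ μ₀ : ℝ, 0 < μ₀ ∧ ∀ μ : ℝ, 0 < μ → μ ≤ μ₀ → ∃ r > r₀,
      ∀ δ : ℝ, (G.setA μ δ).Nonempty → ∀ ρ ∈ Icc (1 / 2 : ℝ) 1,
        G.level p μ δ ρ ≤
          (fiberMax ((p - 2) / 2) (ρ / p * (r * (gnConst p θ * μ ^ ((p + 2) / 4)))) : EReal) := by
  have hq : 2 < (p - 2) / 2 := by linarith
  have hK := gnConst_pos (by linarith : 2 < p) hθ
  set k := ‖(U s₀).2‖ ^ 2 / ‖(U s₀).1‖ ^ 2 with hkdef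
  have hk : 0 ≤ k := by positivity
  set a₀ := 1 / p * ((r₀ + 1) * gnConst p θ) with ha₀
  have ha₀p : 0 < a₀ := by positivity
  have hb := fiberMax_pos hq ha₀p
  -- After normalisation the first member has kinetic energy `k μ`. For `μ ≤ 1`, `ρ ≤ 1` and `r ≤ r₀
  -- + 1` the coefficient is at most `a₀`, so the barrier height is at least `fiberMax a₀`; this
  -- choice of `μ₀` keeps `k μ` below it.
  refine ⟨min 1 (fiberMax ((p - 2) / 2) a₀ / (k + 1)), by positivity, fun μ hμ hμ₀ => ?_⟩
  have hμ1 : μ ≤ 1 := hμ₀.trans (min_le_left _ _)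
  have hμk : k * μ ≤ fiberMax ((p - 2) / 2) a₀ := by
    have := hμ₀.trans (min_le_right _ _)
    rw [le_div_iff₀ (by positivity)] at this
    nlinarith
  set Λ := gnConst p θ * μ ^ ((p + 2) / 4) with hΛ
  have hΛp : 0 < Λ := by positivity
  -- The end `s₁` of the path is fixed using only `r₀` and `ρ = 1/2`, hence before `r`, which may
  -- depend on `s₁`.
  obtain ⟨K, hKneg⟩ := exists_fiber_neg hq (a := 1 / 2 / p * (r₀ * Λ)) (by positivity)
  obtain ⟨s₁, hs₁, hKs₁⟩ := hinf (K / μ)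
  obtain ⟨r', hr', hQr'⟩ := hQ s₁ hs₁
  -- Capping `r` makes the bound by `a₀` valid, so that `μ₀` could be chosen before `r`.
  set r := min r' (r₀ + 1)
  have hr : r₀ < r := lt_min hr' (by linarith)
  have hrp : 0 < r := hr₀.trans hr
  have hQr : ∀ s ∈ Icc s₀ s₁, ReachesGN p θ r (U s) := fun s hs =>
    (hQr' s hs).mono (by linarith) hθ (min_le_left _ _)
  refine ⟨r, hr, fun δ hA ρ hρ => ?_⟩
  have hρ0 : 0 < ρ := by linarith [hρ.1]
  have ha : 0 < ρ / p * (r * Λ) := by positivity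
  refine level_le_of_family (k := k * μ) (s₀ := s₀) (s₁ := s₁) (v := fun s => normalize μ (U s))
    (by linarith) hρ0.le hμ hs₁ hA ?_ ?_ ?_ ?_ ?_ ?_
  · have hUc : ContinuousOn U (Icc s₀ s₁) := hU.mono Icc_subset_Ici_self
    have hn : ContinuousOn (fun s => √μ / ‖(U s).1‖) (Icc s₀ s₁) :=
      continuousOn_const.div hUc.fst.norm fun s hs => (hm s hs.1).ne'
    exact hn.smul hUc
  · exact fun s hs => normalize_mem_H1mass hμ.le (hH1 s hs.1) (hm s hs.1)
  · intro s hs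
    exact ((hQr s hs).energy_normalize_le (by linarith) hρ0.le hμ (hm s hs.1)).trans
      (fiber_le_fiberMax hq ha (norm_nonneg _))
  · have hs : s₁ ∈ Icc s₀ s₁ := ⟨hs₁, le_rfl⟩
    refine ⟨normalize_mem_H1mass hμ.le (hH1 s₁ hs₁) (hm s₁ hs₁), ?_⟩
    refine (((hQr s₁ hs).mono (by linarith) hθ hr.le).energy_normalize_le (by linarith)
      (by norm_num) hμ (hm s₁ hs₁)).trans_lt (hKneg _ (norm_nonneg _) ?_)
    rw [norm_normalize_snd_sq hμ.le]
    rwa [div_le_iff₀' hμ] at hKs₁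
  · rw [norm_normalize_snd_sq hμ.le, mul_comm]
  · refine hμk.trans (fiberMax_anti hq ha ?_)
    have h1 : Λ ≤ gnConst p θ :=
      mul_le_of_le_one_right hK.le (Real.rpow_le_one hμ.le hμ1 (by linarith))
    have h2 : r ≤ r₀ + 1 := min_le_right _ _
    have h3 := hρ.2
    rw [ha₀]
    gcongr

end MetricGraph

/-! ### The soliton and its integrals over `[0, R]`. -/

namespace MetricGraph

open Filter Topology

/-- The soliton with maximum `1`. -/
noncomputable def soliton (p y : ℝ) : ℝ := Real.cosh ((p - 2) / 2 * y) ^ (-(2 / (p - 2)))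

/-- Minus the logarithmic derivative of the soliton. -/
noncomputable def solitonRate (p y : ℝ) : ℝ := Real.tanh ((p - 2) / 2 * y)

variable {p : ℝ}

theorem soliton_pos (y : ℝ) : 0 < soliton p y := Real.rpow_pos_of_pos (Real.cosh_pos _) _

theorem soliton_zero : soliton p 0 = 1 := by simp [soliton]

theorem soliton_neg (y : ℝ) : soliton p (-y) = soliton p y := by
  rw [soliton, soliton, mul_neg, Real.cosh_neg]

theorem soliton_le_soliton (hp : 2 < p) {y R : ℝ} (hR : 0 ≤ R) (h : R ≤ |y|) :
    soliton p y ≤ soliton p R := by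
  have hp2 : 0 < p - 2 := by linarith
  refine Real.rpow_le_rpow_of_nonpos (Real.cosh_pos _) (Real.cosh_le_cosh.2 ?_)
    (neg_nonpos.2 (by positivity))
  rw [abs_mul, abs_mul, abs_of_nonneg hR]
  gcongr

theorem soliton_le_one (hp : 2 < p) (y : ℝ) : soliton p y ≤ 1 :=
  (soliton_le_soliton hp le_rfl (abs_nonneg y)).trans_eq soliton_zero

theorem solitonRate_zero : solitonRate p 0 = 0 := by simp [solitonRate]

theorem solitonRate_nonneg (hp : 2 < p) {y : ℝ} (hy : 0 ≤ y) : 0 ≤ solitonRate p y := by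
  have : 0 < p - 2 := by linarith
  rw [solitonRate, Real.tanh_eq_sinh_div_cosh]
  exact div_nonneg (Real.sinh_nonneg_iff.2 (by positivity)) (Real.cosh_pos _).le

theorem soliton_rpow (hp : 2 < p) (y : ℝ) :
    soliton p y ^ (p - 2) = 1 - solitonRate p y ^ 2 := by
  have hp2 : p - 2 ≠ 0 := by linarith
  have hc := Real.cosh_pos ((p - 2) / 2 * y)
  rw [soliton, ← Real.rpow_mul hc.le, neg_mul, div_mul_cancel₀ _ hp2, solitonRate,
    Real.tanh_eq_sinh_div_cosh, Real.rpow_neg hc.le, Real.rpow_two]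
  have := Real.cosh_sq ((p - 2) / 2 * y)
  generalize (p - 2) / 2 * y = x at *
  field_simp
  linarith

theorem solitonRate_sq_le_one (hp : 2 < p) (y : ℝ) : solitonRate p y ^ 2 ≤ 1 := by
  have := Real.rpow_nonneg (soliton_pos (p := p) y).le (p - 2)
  rw [soliton_rpow hp] at this
  linarith

theorem soliton_rpow_self (hp : 2 < p) (y : ℝ) :
    soliton p y ^ p = soliton p y ^ 2 * (1 - solitonRate p y ^ 2) := by
  rw [← soliton_rpow hp, ← Real.rpow_natCast, ← Real.rpow_add (soliton_pos y)]
  norm_num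

theorem hasDerivAt_soliton (hp : 2 < p) (y : ℝ) :
    HasDerivAt (soliton p) (-(soliton p y * solitonRate p y)) y := by
  have hp2 : p - 2 ≠ 0 := by linarith
  have hc := Real.cosh_pos ((p - 2) / 2 * y)
  have h1 : HasDerivAt (fun y : ℝ => (p - 2) / 2 * y) ((p - 2) / 2) y := by
    simpa using (hasDerivAt_id y).const_mul ((p - 2) / 2)
  have h2 := h1.cosh.rpow_const (p := -(2 / (p - 2))) (Or.inl hc.ne')
  convert! h2 using 1
  rw [soliton, solitonRate, Real.tanh_eq_sinh_div_cosh, Real.rpow_sub_one hc.ne']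
  field_simp

theorem hasDerivAt_solitonRate (y : ℝ) :
    HasDerivAt (solitonRate p) ((p - 2) / 2 * (1 - solitonRate p y ^ 2)) y := by
  have hc := Real.cosh_pos ((p - 2) / 2 * y)
  have h1 : HasDerivAt (fun y : ℝ => (p - 2) / 2 * y) ((p - 2) / 2) y := by
    simpa using (hasDerivAt_id y).const_mul ((p - 2) / 2)
  have h2 := h1.sinh.div h1.cosh hc.ne'
  have e : solitonRate p = fun y => Real.sinh ((p - 2) / 2 * y) / Real.cosh ((p - 2) / 2 * y) := by
    funext y
    rw [solitonRate, Real.tanh_eq_sinh_div_cosh]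
  rw [e]
  convert! h2 using 1
  simp only
  field_simp

theorem continuous_soliton (hp : 2 < p) : Continuous (soliton p) :=
  continuous_iff_continuousAt.2 fun y => (hasDerivAt_soliton hp y).continuousAt

theorem continuous_solitonRate : Continuous (solitonRate p) :=
  continuous_iff_continuousAt.2 fun y => (hasDerivAt_solitonRate y).continuousAt

theorem tendsto_soliton (hp : 2 < p) : Tendsto (soliton p) atTop (𝓝 0) := by
  have hp2 : 0 < p - 2 := by linarith
  have h1 : Tendsto (fun y : ℝ => Real.cosh ((p - 2) / 2 * y)) atTop atTop := by
    refine tendsto_atTop_mono (f := fun y => 1 / 2 * ((p - 2) / 2 * y)) (fun y => ?_) ?_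
    · have h2 := Real.add_one_le_exp ((p - 2) / 2 * y)
      have h3 := Real.exp_pos (-((p - 2) / 2 * y))
      rw [Real.cosh_eq]
      linarith
    · exact (tendsto_id.const_mul_atTop (by positivity : 0 < (p - 2) / 2)).const_mul_atTop
        (by norm_num)
  exact (tendsto_rpow_neg_atTop (by positivity : 0 < 2 / (p - 2))).comp h1

section Core

/-- The kinetic energy of the soliton on `[0, R]`. -/
noncomputable def coreKinetic (p R : ℝ) : ℝ :=
  ∫ y in (0 : ℝ)..R, (soliton p y * solitonRate p y) ^ 2

/-- The `p`-th power norm of the soliton on `[0, R]`. -/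
noncomputable def corePower (p R : ℝ) : ℝ := ∫ y in (0 : ℝ)..R, soliton p y ^ p

theorem continuous_soliton_rpow (hp : 2 < p) : Continuous fun y => soliton p y ^ p :=
  (continuous_soliton hp).rpow_const fun y => Or.inl (soliton_pos y).ne'

theorem core_mass (hp : 2 < p) (R : ℝ) :
    ∫ y in (0 : ℝ)..R, soliton p y ^ 2 = coreKinetic p R + corePower p R := by
  have h1 := continuous_soliton hp
  have h2 := continuous_solitonRate (p := p)
  have h3 := continuous_soliton_rpow hp
  rw [coreKinetic, corePower, ← intervalIntegral.integral_add
    (Continuous.intervalIntegrable (by fun_prop) _ _) (h3.intervalIntegrable _ _)]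
  refine intervalIntegral.integral_congr fun y _ => ?_
  rw [soliton_rpow_self hp]
  ring

/-- The soliton saturates the calibration: `-φ' = calibDensity p 1 φ` for `y ≥ 0`, so `φ'²` is the
derivative of `-calib p 1 φ`. As `R → ∞` this tends to `gnInt p`. -/
theorem coreKinetic_eq (hp : 2 < p) {R : ℝ} (hR : 0 ≤ R) :
    coreKinetic p R = gnInt p - calib p 1 (soliton p R) := by
  have h1 := continuous_soliton hp
  have h2 := continuous_solitonRate (p := p)
  have hd : ∀ y ∈ uIcc 0 R, HasDerivAt (fun y => -calib p 1 (soliton p y))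
      ((soliton p y * solitonRate p y) ^ 2) y := by
    intro y hy
    rw [uIcc_of_le hR] at hy
    convert! ((hasDerivAt_calib (M := 1) hp (soliton p y)).comp y (hasDerivAt_soliton hp y)).neg
      using 1
    rw [calibDensity, abs_of_pos (soliton_pos y), soliton_rpow hp, Real.one_rpow, sub_sub_cancel,
      Real.sqrt_sq (solitonRate_nonneg hp hy.1)]
    ring
  rw [coreKinetic, intervalIntegral.integral_eq_sub_of_hasDerivAt hd
    (Continuous.intervalIntegrable (by fun_prop) _ _), soliton_zero, gnInt_eq_calib]
  ring

/-- Integrate the derivative of `φ² T`, where `T = solitonRate p` and `T' = (p-2)/2 (1 - T²)`.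
Together with `core_mass`, this expresses mass, kinetic energy and power through `gnInt` and
boundary terms at `R`. -/
theorem corePower_eq (hp : 2 < p) (R : ℝ) :
    (p - 2) / 2 * corePower p R =
      2 * coreKinetic p R + soliton p R ^ 2 * solitonRate p R := by
  have h1 := continuous_soliton hp
  have h2 := continuous_solitonRate (p := p)
  have h3 := continuous_soliton_rpow hp
  have hd : ∀ y ∈ uIcc 0 R, HasDerivAt (fun y => soliton p y ^ 2 * solitonRate p y)
      ((p - 2) / 2 * soliton p y ^ p - 2 * (soliton p y * solitonRate p y) ^ 2) y := by
    intro y _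
    convert! ((hasDerivAt_soliton hp y).pow 2).mul (hasDerivAt_solitonRate y) using 1
    rw [soliton_rpow_self hp]
    simp
    ring
  have h4 := intervalIntegral.integral_eq_sub_of_hasDerivAt hd
    (Continuous.intervalIntegrable (by fun_prop) _ _)
  rw [intervalIntegral.integral_sub (Continuous.intervalIntegrable (by fun_prop) _ _)
    (Continuous.intervalIntegrable (by fun_prop) _ _), intervalIntegral.integral_const_mul,
    intervalIntegral.integral_const_mul, solitonRate_zero] at h4
  rw [corePower, coreKinetic]
  linarith

theorem continuous_mul_sqrt (hp : 2 < p) : Continuous fun s : ℝ => s * √(1 - s ^ (p - 2)) := by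
  have : Continuous fun s : ℝ => s ^ (p - 2) :=
    continuous_id.rpow_const fun _ => Or.inr (by linarith)
  fun_prop

/-- For `s ≤ t = φ(R)` one has `√(1 - s^(p-2)) ≥ √(1 - t^(p-2)) = solitonRate p R`, for `R ≥ 0`;
integrate against `s`. -/
theorem le_two_mul_calib (hp : 2 < p) (R : ℝ) :
    soliton p R ^ 2 * solitonRate p R ≤ 2 * calib p 1 (soliton p R) := by
  have ht := soliton_pos (p := p) R
  set t := soliton p R with htdef
  have h1 : ∫ s in (0 : ℝ)..t, s * solitonRate p R ≤ ∫ s in (0 : ℝ)..t, s * √(1 - s ^ (p - 2)) := by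
    refine intervalIntegral.integral_mono_on ht.le (Continuous.intervalIntegrable (by fun_prop) _ _)
      ((continuous_mul_sqrt hp).intervalIntegrable _ _) fun s hs => ?_
    refine mul_le_mul_of_nonneg_left (Real.le_sqrt_of_sq_le ?_) hs.1
    have h2 : s ^ (p - 2) ≤ t ^ (p - 2) := Real.rpow_le_rpow hs.1 hs.2 (by linarith)
    rw [htdef, soliton_rpow hp] at h2
    linarith
  rw [← calib_one t ht.le, intervalIntegral.integral_mul_const, integral_id] at h1
  linarith

/-- Integrate `√(1 - x) ≤ 1 - x/2` at `x = s^(p-2)`. The term `t^p / p` is kept because the signpost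
estimate is decided at order `t^p`. -/
theorem two_mul_calib_le (hp : 2 < p) {t : ℝ} (ht : 0 ≤ t) (ht1 : t ≤ 1) :
    2 * calib p 1 t ≤ t ^ 2 - t ^ p / p := by
  have hint : Continuous fun s : ℝ => s ^ (p - 1) :=
    continuous_id.rpow_const fun _ => Or.inr (by linarith)
  have h1 : ∫ s in (0 : ℝ)..t, s * √(1 - s ^ (p - 2)) ≤
      ∫ s in (0 : ℝ)..t, (s - 1 / 2 * s ^ (p - 1)) := by
    refine intervalIntegral.integral_mono_on ht ((continuous_mul_sqrt hp).intervalIntegrable _ _)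
      (Continuous.intervalIntegrable (by fun_prop) _ _) fun s hs => ?_
    have h2 : s ^ (p - 1) = s * s ^ (p - 2) := by
      rw [← Real.rpow_one_add' hs.1 (by linarith)]
      congr 1
      ring
    have h3 : s ^ (p - 2) ≤ 1 := Real.rpow_le_one hs.1 (hs.2.trans ht1) (by linarith)
    have h4 : √(1 - s ^ (p - 2)) ≤ 1 - 1 / 2 * s ^ (p - 2) := by
      rw [Real.sqrt_le_left (by linarith)]
      nlinarith [sq_nonneg (s ^ (p - 2))]
    rw [h2]
    nlinarith [mul_le_mul_of_nonneg_left h4 hs.1]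
  rw [← calib_one t ht, intervalIntegral.integral_sub (Continuous.intervalIntegrable (by fun_prop) _ _)
    (Continuous.intervalIntegrable (by fun_prop) _ _), integral_id,
    intervalIntegral.integral_const_mul, integral_rpow (Or.inl (by linarith)), sub_add_cancel,
    Real.zero_rpow (by linarith)] at h1
  have : 1 / 2 * ((t ^ p - 0) / p) = (t ^ p / p) / 2 := by ring
  rw [this] at h1
  linarith

end Core

end MetricGraph

/-! ### Compactly supported profiles: the polynomial tail and the truncated soliton. -/

namespace MetricGraph

open Filter Topology

variable {p : ℝ}

/-- The squared positive part is continuously differentiable, whence the squares in `tail` and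
`truncSoliton`. -/
theorem hasDerivAt_max_sq (x : ℝ) : HasDerivAt (fun x : ℝ => max x 0 ^ 2) (2 * max x 0) x := by
  rcases lt_trichotomy x 0 with h | rfl | h
  · rw [max_eq_right h.le, mul_zero]
    refine (hasDerivAt_const x (0 : ℝ)).congr_of_eventuallyEq ?_
    filter_upwards [Iio_mem_nhds h] with y hy
    rw [max_eq_right (le_of_lt (mem_Iio.1 hy))]
    norm_num
  · rw [hasDerivAt_iff_isLittleO_nhds_zero]
    refine Asymptotics.IsBigO.trans_isLittleO (Asymptotics.IsBigO.of_bound 1 ?_)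
      (Asymptotics.isLittleO_pow_id one_lt_two)
    refine Eventually.of_forall fun y => ?_
    rw [one_mul, zero_add, max_self, mul_zero, smul_zero, sub_zero, zero_pow two_ne_zero, sub_zero,
      norm_pow, norm_pow]
    refine pow_le_pow_left₀ (norm_nonneg _) ?_ 2
    rcases le_total y 0 with hy | hy
    · simp [max_eq_right hy]
    · rw [max_eq_left hy]
  · rw [max_eq_left h.le]
    have h1 : HasDerivAt (fun x : ℝ => x ^ 2) (2 * x) x := by simpa using hasDerivAt_pow 2 x
    refine h1.congr_of_eventuallyEq ?_
    filter_upwards [Ioi_mem_nhds h] with y hy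
    rw [max_eq_left (le_of_lt (mem_Ioi.1 hy))]

section Tail

/-- A compactly supported decreasing profile on the half-line, with value `1` at `0`. -/
noncomputable def tail (y : ℝ) : ℝ := max (1 - y / 6) 0 ^ 2

/-- The derivative of `tail`. -/
noncomputable def tailDeriv (y : ℝ) : ℝ := -(1 / 3 * max (1 - y / 6) 0)

theorem hasDerivAt_tail (y : ℝ) : HasDerivAt tail (tailDeriv y) y := by
  have h : HasDerivAt (fun y : ℝ => 1 - y / 6) (-(1 / 6)) y := by
    simpa using ((hasDerivAt_id y).div_const 6).const_sub 1
  convert! (hasDerivAt_max_sq (1 - y / 6)).comp y h using 1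
  rw [tailDeriv]
  ring

theorem continuous_tail : Continuous tail := by unfold tail; fun_prop

theorem continuous_tailDeriv : Continuous tailDeriv := by unfold tailDeriv; fun_prop

theorem tail_zero : tail 0 = 1 := by simp [tail]

theorem tail_of_le {y : ℝ} (hy : 6 ≤ y) : tail y = 0 := by
  rw [tail, max_eq_right (by linarith)]
  norm_num

theorem tailDeriv_of_le {y : ℝ} (hy : 6 ≤ y) : tailDeriv y = 0 := by
  rw [tailDeriv, max_eq_right (by linarith)]
  norm_num

theorem integral_max_rpow {a : ℝ} (ha : 0 < a) :
    ∫ y in (0 : ℝ)..6, max (1 - y / 6) 0 ^ a = 6 / (a + 1) := by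
  have h1 : ∫ y in (0 : ℝ)..6, max (1 - y / 6) 0 ^ a = ∫ y in (0 : ℝ)..6, (1 - y / 6) ^ a := by
    refine intervalIntegral.integral_congr fun y hy => ?_
    rw [uIcc_of_le (by norm_num)] at hy
    rw [max_eq_left (by linarith [hy.2])]
  have h2 := intervalIntegral.integral_comp_sub_div (a := 0) (b := 6) (fun x : ℝ => x ^ a)
    (by norm_num : (6 : ℝ) ≠ 0) 1
  rw [h1, h2]
  norm_num
  rw [integral_rpow (Or.inl (by linarith)), Real.zero_rpow (by linarith), Real.one_rpow]
  ring

theorem integral_tail_sq : ∫ y in (0 : ℝ)..6, tail y ^ 2 = 6 / 5 := by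
  have h := integral_max_rpow (a := 4) (by norm_num)
  norm_num at h
  rw [← h]
  refine intervalIntegral.integral_congr fun y _ => ?_
  simp only [tail]
  rw [← pow_mul]

theorem integral_tailDeriv_sq : ∫ y in (0 : ℝ)..6, tailDeriv y ^ 2 = 2 / 9 := by
  have h := integral_max_rpow (a := 2) (by norm_num)
  norm_num at h
  have h1 : ∫ y in (0 : ℝ)..6, tailDeriv y ^ 2 =
      ∫ y in (0 : ℝ)..6, 1 / 9 * max (1 - y / 6) 0 ^ 2 := by
    refine intervalIntegral.integral_congr fun y _ => ?_
    simp only [tailDeriv]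
    ring
  rw [h1, intervalIntegral.integral_const_mul, h]
  norm_num

theorem integral_tail_rpow (hp : 0 < p) :
    ∫ y in (0 : ℝ)..6, |tail y| ^ p = 6 / (2 * p + 1) := by
  rw [← integral_max_rpow (a := 2 * p) (by positivity)]
  refine intervalIntegral.integral_congr fun y _ => ?_
  simp only [tail]
  rw [abs_of_nonneg (sq_nonneg _), ← Real.rpow_natCast, ← Real.rpow_mul (le_max_right _ _)]
  norm_num

end Tail

section Truncation

/-- The soliton truncated at the height `t`, in a continuously differentiable way. -/
noncomputable def truncSoliton (p t y : ℝ) : ℝ := max (soliton p y - t) 0 ^ 2 / soliton p y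

/-- The derivative of `truncSoliton`. -/
noncomputable def truncSolitonDeriv (p t y : ℝ) : ℝ :=
  -(soliton p y * solitonRate p y) *
    (2 * (max (soliton p y - t) 0 / soliton p y) - (max (soliton p y - t) 0 / soliton p y) ^ 2)

variable {t : ℝ}

theorem hasDerivAt_truncSoliton (hp : 2 < p) (y : ℝ) :
    HasDerivAt (truncSoliton p t) (truncSolitonDeriv p t y) y := by
  have h0 := hasDerivAt_soliton hp y
  have hz := (soliton_pos (p := p) y).ne'
  have h1 := (hasDerivAt_max_sq (soliton p y - t)).comp y (h0.sub_const t)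
  convert! h1.div h0 hz using 1
  rw [truncSolitonDeriv]
  simp only [Function.comp_apply]
  field_simp
  ring

theorem continuous_truncSoliton (hp : 2 < p) : Continuous (truncSoliton p t) :=
  continuous_iff_continuousAt.2 fun y => (hasDerivAt_truncSoliton hp y).continuousAt

theorem continuous_truncSolitonDeriv (hp : 2 < p) : Continuous (truncSolitonDeriv p t) := by
  have h1 := continuous_soliton hp
  have h2 := continuous_solitonRate (p := p)
  have h3 : Continuous fun y => max (soliton p y - t) 0 / soliton p y :=
    Continuous.div (by fun_prop) h1 fun y => (soliton_pos y).ne'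
  unfold truncSolitonDeriv
  fun_prop

theorem truncSoliton_neg (y : ℝ) : truncSoliton p t (-y) = truncSoliton p t y := by
  rw [truncSoliton, truncSoliton, soliton_neg]

theorem truncSolitonDeriv_neg (y : ℝ) : truncSolitonDeriv p t (-y) = -truncSolitonDeriv p t y := by
  have : solitonRate p (-y) = -solitonRate p y := by
    rw [solitonRate, solitonRate, mul_neg, Real.tanh_neg]
  rw [truncSolitonDeriv, truncSolitonDeriv, soliton_neg, this]
  ring

theorem truncSoliton_of_le {y : ℝ} (h : soliton p y ≤ t) : truncSoliton p t y = 0 := by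
  rw [truncSoliton, max_eq_right (by linarith)]
  simp

theorem truncSolitonDeriv_of_le {y : ℝ} (h : soliton p y ≤ t) : truncSolitonDeriv p t y = 0 := by
  rw [truncSolitonDeriv, max_eq_right (by linarith)]
  simp

theorem truncSoliton_nonneg (y : ℝ) : 0 ≤ truncSoliton p t y :=
  div_nonneg (sq_nonneg _) (soliton_pos y).le

theorem max_div_soliton_mem (ht : 0 ≤ t) (y : ℝ) :
    max (soliton p y - t) 0 / soliton p y ∈ Icc (0 : ℝ) 1 := by
  have hz := soliton_pos (p := p) y
  refine ⟨div_nonneg (le_max_right _ _) hz.le, (div_le_one hz).2 (max_le (by linarith) hz.le)⟩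

theorem truncSoliton_eq (y : ℝ) :
    truncSoliton p t y = soliton p y * (max (soliton p y - t) 0 / soliton p y) ^ 2 := by
  have hz := soliton_pos (p := p) y
  rw [truncSoliton]
  field_simp

theorem truncSoliton_le (ht : 0 ≤ t) (y : ℝ) : truncSoliton p t y ≤ soliton p y := by
  rw [truncSoliton_eq]
  obtain ⟨h0, h1⟩ := max_div_soliton_mem (p := p) ht y
  exact mul_le_of_le_one_right (soliton_pos y).le (pow_le_one₀ h0 h1)

theorem truncSolitonDeriv_sq_le (ht : 0 ≤ t) (y : ℝ) :
    truncSolitonDeriv p t y ^ 2 ≤ (soliton p y * solitonRate p y) ^ 2 := by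
  obtain ⟨h0, h1⟩ := max_div_soliton_mem (p := p) ht y
  set r := max (soliton p y - t) 0 / soliton p y with hr
  have h2 : 0 ≤ 2 * r - r ^ 2 := by nlinarith
  have h3 : 2 * r - r ^ 2 ≤ 1 := by nlinarith [sq_nonneg (r - 1)]
  rw [truncSolitonDeriv, mul_pow, neg_sq, ← hr]
  exact mul_le_of_le_one_right (sq_nonneg _) (pow_le_one₀ h2 h3)

/-- The truncation is `φ r²` with `r = (1 - t/φ)₊`. Bernoulli gives `r^(2p) ≥ 1 - 2p t/φ`, trivially
so when `t > φ`, and `φ^(p-1) ≤ φ²` because `φ ≤ 1` and `p ≥ 3`. -/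
theorem le_truncSoliton_rpow (hp : 3 ≤ p) (ht : 0 ≤ t) (y : ℝ) :
    soliton p y ^ p - 2 * p * t * soliton p y ^ 2 ≤ truncSoliton p t y ^ p := by
  have hz := soliton_pos (p := p) y
  have hz1 := soliton_le_one (p := p) (by linarith) y
  obtain ⟨h0, -⟩ := max_div_soliton_mem (p := p) ht y
  set z := soliton p y with hzdef
  set r := max (z - t) 0 / z with hr
  have h1 : truncSoliton p t y ^ p = z ^ p * r ^ (2 * p) := by
    rw [truncSoliton_eq, Real.mul_rpow hz.le (by positivity), Real.rpow_mul h0, Real.rpow_two]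
  have h2 : 1 - 2 * p * (t / z) ≤ r ^ (2 * p) := by
    by_cases htz : t ≤ z
    · have h3 : r = 1 + -(t / z) := by
        rw [hr, max_eq_left (by linarith)]
        field_simp
        ring
      have h4 := one_add_mul_self_le_rpow_one_add (s := -(t / z)) (p := 2 * p)
        (by rw [neg_le_neg_iff, div_le_one hz]; exact htz) (by linarith)
      rw [h3]
      linarith
    · have h3 : 1 ≤ t / z := by rw [one_le_div hz]; linarith
      have h4 := Real.rpow_nonneg h0 (2 * p)
      nlinarith
  have h5 : z ^ p * (t / z) ≤ t * z ^ 2 := by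
    have h6 : z ^ (p - 1) ≤ z ^ (2 : ℝ) := Real.rpow_le_rpow_of_exponent_ge hz hz1 (by linarith)
    rw [Real.rpow_two] at h6
    have h7 : z ^ p = z ^ (p - 1) * z := by
      rw [← Real.rpow_add_one hz.ne']
      congr 1
      ring
    rw [h7]
    calc z ^ (p - 1) * z * (t / z) = t * z ^ (p - 1) := by field_simp
      _ ≤ t * z ^ 2 := mul_le_mul_of_nonneg_left h6 ht
  have h8 := mul_le_mul_of_nonneg_left h2 (Real.rpow_nonneg hz.le p)
  rw [h1]
  nlinarith [mul_le_mul_of_nonneg_left h5 (by linarith : 0 ≤ 2 * p)]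

end Truncation

section Estimates

variable {R : ℝ}

theorem two_mul_calib_le_sq (hp : 2 < p) (R : ℝ) :
    2 * calib p 1 (soliton p R) ≤ soliton p R ^ 2 := by
  have h := two_mul_calib_le hp (soliton_pos R).le (soliton_le_one hp R)
  have : 0 ≤ soliton p R ^ p / p :=
    div_nonneg (Real.rpow_nonneg (soliton_pos R).le _) (by linarith)
  linarith

theorem calib_soliton_nonneg (hp : 2 < p) (hR : 0 ≤ R) : 0 ≤ calib p 1 (soliton p R) := by
  have h := le_two_mul_calib hp R
  have := mul_nonneg (sq_nonneg (soliton p R)) (solitonRate_nonneg hp hR)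
  linarith

theorem coreKinetic_le (hp : 2 < p) (hR : 0 ≤ R) : coreKinetic p R ≤ gnInt p := by
  rw [coreKinetic_eq hp hR]
  linarith [calib_soliton_nonneg hp hR]

theorem corePower_le (hp : 2 < p) (hR : 0 ≤ R) : corePower p R ≤ 4 * gnInt p / (p - 2) := by
  have h := corePower_eq hp R
  rw [coreKinetic_eq hp hR] at h
  have h2 := le_two_mul_calib hp R
  rw [le_div_iff₀ (by linarith)]
  nlinarith

theorem le_corePower (hp : 2 < p) (hR : 0 ≤ R) :
    4 * gnInt p / (p - 2) - 2 / (p - 2) * soliton p R ^ 2 ≤ corePower p R := by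
  have hp2 : 0 < p - 2 := by linarith
  have h := corePower_eq hp R
  rw [coreKinetic_eq hp hR] at h
  have h2 := two_mul_calib_le_sq hp R
  have h3 := mul_nonneg (sq_nonneg (soliton p R)) (solitonRate_nonneg hp hR)
  have : corePower p R = 2 / (p - 2) * ((p - 2) / 2 * corePower p R) := by field_simp
  rw [this, h]
  have h4 : 4 * gnInt p / (p - 2) - 2 / (p - 2) * soliton p R ^ 2 =
      2 / (p - 2) * (2 * gnInt p - soliton p R ^ 2) := by ring
  rw [h4]
  refine mul_le_mul_of_nonneg_left (by linarith) (by positivity)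

theorem core_mass_le (hp : 2 < p) (hR : 0 ≤ R) :
    ∫ y in (0 : ℝ)..R, soliton p y ^ 2 ≤ (p + 2) / (p - 2) * gnInt p := by
  have hp2 : 0 < p - 2 := by linarith
  rw [core_mass hp]
  have h1 := coreKinetic_le hp hR
  have h2 := corePower_le hp hR
  have : (p + 2) / (p - 2) * gnInt p = gnInt p + 4 * gnInt p / (p - 2) := by
    field_simp
    ring
  linarith

/-- Compactly supported even profiles that are nearly optimal in the Gagliardo–Nirenberg
inequality on the half-line. -/
theorem exists_profile (hp : 6 < p) {r : ℝ} (hr0 : 0 < r) (hr : r < 1) :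
    ∃ (h h' : ℝ → ℝ) (R : ℝ), 0 < R ∧ Continuous h ∧ Continuous h' ∧
      (∀ y, HasDerivAt h (h' y) y) ∧ (∀ y, h (-y) = h y) ∧ (∀ y, h' (-y) = -h' y) ∧
      (∀ y, R ≤ |y| → h y = 0 ∧ h' y = 0) ∧
      (0 < ∫ y in (0 : ℝ)..R, h y ^ 2) ∧ (0 < ∫ y in (0 : ℝ)..R, h' y ^ 2) ∧
      ∫ y in (0 : ℝ)..R, h y ^ 2 ≤ (p + 2) / (p - 2) * gnInt p ∧
      ∫ y in (0 : ℝ)..R, h' y ^ 2 ≤ gnInt p ∧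
      r * (4 * gnInt p / (p - 2)) ≤ ∫ y in (0 : ℝ)..R, |h y| ^ p := by
  have hp2 : 2 < p := by linarith
  have hI := gnInt_pos hp2
  have hPh : 0 < 4 * gnInt p / (p - 2) := div_pos (by linarith) (by linarith)
  set C := (p + 2) / (p - 2) * gnInt p with hC
  have hlim : Tendsto (fun R => 2 / (p - 2) * soliton p R ^ 2 + 2 * p * soliton p R * C) atTop
      (𝓝 0) := by
    have h := tendsto_soliton hp2
    have h2 := ((h.pow 2).const_mul (2 / (p - 2))).add ((h.const_mul (2 * p)).mul_const C)
    simpa using h2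
  have hev : ∀ᶠ R in atTop, 2 / (p - 2) * soliton p R ^ 2 + 2 * p * soliton p R * C <
      (1 - r) * (4 * gnInt p / (p - 2)) :=
    hlim.eventually_lt_const (mul_pos (by linarith) hPh)
  obtain ⟨R, ⟨hRlim, hRt⟩, hRpos⟩ := ((hev.and
    ((tendsto_soliton hp2).eventually_lt_const (by norm_num : (0 : ℝ) < 1))).and
    (eventually_gt_atTop 0)).exists
  set t := soliton p R with ht
  have ht0 : 0 ≤ t := (soliton_pos R).le
  have hc := continuous_truncSoliton (t := t) hp2
  have hc' := continuous_truncSolitonDeriv (t := t) hp2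
  have hsc := continuous_soliton hp2
  have hrc := continuous_solitonRate (p := p)
  have hspc := continuous_soliton_rpow hp2
  have hpc : Continuous fun y => |truncSoliton p t y| ^ p :=
    hc.abs.rpow_const fun _ => Or.inr (by linarith)
  have hvan : ∀ y, R ≤ |y| → soliton p y ≤ t := fun y hy => soliton_le_soliton hp2 hRpos.le hy
  have hmass : ∫ y in (0 : ℝ)..R, truncSoliton p t y ^ 2 ≤ C := by
    refine le_trans (intervalIntegral.integral_mono_on hRpos.le
      (Continuous.intervalIntegrable (by fun_prop) _ _)
      (Continuous.intervalIntegrable (by fun_prop) _ _) fun y _ => ?_) (core_mass_le hp2 hRpos.le)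
    exact pow_le_pow_left₀ (truncSoliton_nonneg y) (truncSoliton_le ht0 y) 2
  have hkin : ∫ y in (0 : ℝ)..R, truncSolitonDeriv p t y ^ 2 ≤ gnInt p := by
    refine le_trans (intervalIntegral.integral_mono_on hRpos.le
      (Continuous.intervalIntegrable (by fun_prop) _ _)
      (Continuous.intervalIntegrable (by fun_prop) _ _) fun y _ => ?_) (coreKinetic_le hp2 hRpos.le)
    exact truncSolitonDeriv_sq_le ht0 y
  have hpow : r * (4 * gnInt p / (p - 2)) ≤ ∫ y in (0 : ℝ)..R, |truncSoliton p t y| ^ p := by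
    have h1 : ∫ y in (0 : ℝ)..R, (soliton p y ^ p - 2 * p * t * soliton p y ^ 2) ≤
        ∫ y in (0 : ℝ)..R, |truncSoliton p t y| ^ p := by
      refine intervalIntegral.integral_mono_on hRpos.le
        (Continuous.intervalIntegrable (by fun_prop) _ _)
        (Continuous.intervalIntegrable (by fun_prop) _ _) fun y _ => ?_
      rw [abs_of_nonneg (truncSoliton_nonneg y)]
      exact le_truncSoliton_rpow (by linarith) ht0 y
    rw [intervalIntegral.integral_sub (Continuous.intervalIntegrable (by fun_prop) _ _)
      (Continuous.intervalIntegrable (by fun_prop) _ _), intervalIntegral.integral_const_mul] at h1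
    have h2 := le_corePower hp2 hRpos.le
    have h3 : 2 * p * t * ∫ y in (0 : ℝ)..R, soliton p y ^ 2 ≤ 2 * p * t * C :=
      mul_le_mul_of_nonneg_left (core_mass_le hp2 hRpos.le) (by positivity)
    rw [corePower] at h2
    linarith
  -- Since `0 ≤ h ≤ 1`, the mass dominates the power, which is already bounded below; this makes the
  -- mass positive.
  have hle : ∫ y in (0 : ℝ)..R, |truncSoliton p t y| ^ p ≤
      ∫ y in (0 : ℝ)..R, truncSoliton p t y ^ 2 := by
    refine intervalIntegral.integral_mono_on hRpos.le
      (Continuous.intervalIntegrable (by fun_prop) _ _)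
      (Continuous.intervalIntegrable (by fun_prop) _ _) fun y _ => ?_
    have h0 := truncSoliton_nonneg (p := p) (t := t) y
    rw [abs_of_nonneg h0, ← Real.rpow_two]
    exact Real.rpow_le_rpow_of_exponent_ge_of_imp h0
      ((truncSoliton_le ht0 y).trans (soliton_le_one hp2 y)) (by linarith)
      fun _ h => absurd h (by linarith)
  have hkinpos : 0 < ∫ y in (0 : ℝ)..R, truncSolitonDeriv p t y ^ 2 := by
    have h0 : truncSoliton p t 0 = (1 - t) ^ 2 := by
      rw [truncSoliton, soliton_zero, max_eq_left (by linarith), div_one]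
    have hR0 : truncSoliton p t R = 0 := truncSoliton_of_le le_rfl
    have h1 : ∫ y in (0 : ℝ)..R, truncSolitonDeriv p t y = -(1 - t) ^ 2 := by
      rw [intervalIntegral.integral_eq_sub_of_hasDerivAt
        (fun y _ => hasDerivAt_truncSoliton hp2 y) (hc'.intervalIntegrable _ _), hR0, h0]
      ring
    -- The mean descent from `(1 - t)²` to `0` over `[0, R]`; expanding `∫ (h' + c)² ≥ 0` bounds the
    -- kinetic energy below by `c (1 - t)² > 0`.
    set c := (1 - t) ^ 2 / R with hcdef
    have hcpos : 0 < c := div_pos (pow_pos (by linarith) 2) hRpos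
    have h2 : 0 ≤ ∫ y in (0 : ℝ)..R, (truncSolitonDeriv p t y + c) ^ 2 :=
      intervalIntegral.integral_nonneg hRpos.le fun y _ => sq_nonneg _
    have h3 : ∫ y in (0 : ℝ)..R, (truncSolitonDeriv p t y + c) ^ 2 =
        (∫ y in (0 : ℝ)..R, truncSolitonDeriv p t y ^ 2) - c * (1 - t) ^ 2 := by
      have e : ∀ y, (truncSolitonDeriv p t y + c) ^ 2 =
          truncSolitonDeriv p t y ^ 2 + 2 * c * truncSolitonDeriv p t y + c ^ 2 := fun y => by ring
      simp_rw [e]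
      rw [intervalIntegral.integral_add (Continuous.intervalIntegrable (by fun_prop) _ _)
        (Continuous.intervalIntegrable (by fun_prop) _ _),
        intervalIntegral.integral_add (Continuous.intervalIntegrable (by fun_prop) _ _)
        (Continuous.intervalIntegrable (by fun_prop) _ _), intervalIntegral.integral_const_mul, h1,
        intervalIntegral.integral_const, smul_eq_mul]
      have : (R - 0) * c ^ 2 = c * (1 - t) ^ 2 := by
        rw [hcdef]
        field_simp
        ring
      rw [this]
      ring
    have : 0 < c * (1 - t) ^ 2 := mul_pos hcpos (pow_pos (by linarith) 2)
    linarith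
  exact ⟨truncSoliton p t, truncSolitonDeriv p t, R, hRpos, hc, hc', hasDerivAt_truncSoliton hp2,
    truncSoliton_neg, truncSolitonDeriv_neg,
    fun y hy => ⟨truncSoliton_of_le (hvan y hy), truncSolitonDeriv_of_le (hvan y hy)⟩,
    (mul_pos hr0 hPh).trans_le (hpow.trans hle), hkinpos, hmass, hkin, hpow⟩

end Estimates

end MetricGraph

/-! ### Dilated profiles placed on edges. -/

namespace MetricGraph

open Filter Topology

variable {G : MetricGraph.{u, v}}

section Integrals

theorem intervalIntegral_comp_mul_of_support {F : ℝ → ℝ} (hF : Continuous F) {s Y c : ℝ}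
    (hs : 0 < s) (h0 : ∀ y, Y ≤ y → F y = 0) (hc : Y ≤ s * c) :
    ∫ x in (0 : ℝ)..c, F (s * x) = s⁻¹ * ∫ y in (0 : ℝ)..Y, F y := by
  rw [intervalIntegral.integral_comp_mul_left _ hs.ne', mul_zero, smul_eq_mul,
    ← intervalIntegral.integral_add_adjacent_intervals (hF.intervalIntegrable 0 Y)
      (hF.intervalIntegrable Y (s * c))]
  have : ∫ y in Y..(s * c), F y = 0 := by
    rw [intervalIntegral.integral_congr (g := fun _ => 0), intervalIntegral.integral_zero]
    intro y hy
    rw [uIcc_of_le hc] at hy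
    exact h0 y hy.1
  rw [this, add_zero]

theorem setIntegral_interval_of_support {e : G.E} {h : ℝ → ℝ} {c : ℝ} (hc : c ∈ G.interval e)
    (h0 : ∀ x ∈ G.interval e, c < x → h x = 0) :
    ∫ x in G.interval e, h x = ∫ x in (0 : ℝ)..c, h x := by
  have : G.interval e ∩ Iic c = Icc 0 c :=
    Set.ext fun x => ⟨fun hx => ⟨hx.1.1, hx.2⟩, fun hx => ⟨Icc_subset_interval hc hx, hx.2⟩⟩
  rw [← setIntegral_interval_inter h0, this, integral_Icc_eq_integral_Ioc,
    intervalIntegral.integral_of_le hc.1]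

/-- `τ (x - x₀)` is the distance of the point `x` of the edge `e` from one of its ends. -/
def IsEndCoord (G : MetricGraph.{u, v}) (e : G.E) (τ x₀ : ℝ) : Prop :=
  (τ = 1 ∧ x₀ = 0) ∨ (τ = -1 ∧ G.len e ≠ ⊤ ∧ x₀ = (G.len e).toReal)

theorem IsEndCoord.sq_eq_one {e : G.E} {τ x₀ : ℝ} (h : G.IsEndCoord e τ x₀) : τ ^ 2 = 1 := by
  rcases h with ⟨rfl, -⟩ | ⟨rfl, -⟩ <;> norm_num

/-- Integral of a profile placed at an end of an edge. -/
theorem setIntegral_end {e : G.E} {τ x₀ : ℝ} (he : G.IsEndCoord e τ x₀) {F : ℝ → ℝ}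
    (hF : Continuous F) {s Y : ℝ} (hs : 0 < s) (hY : 0 ≤ Y) (h0 : ∀ y, Y ≤ y → F y = 0)
    (hlen : ENNReal.ofReal (Y / s) ≤ G.len e) :
    ∫ x in G.interval e, F (s * (τ * (x - x₀))) = s⁻¹ * ∫ y in (0 : ℝ)..Y, F y := by
  rcases he with ⟨rfl, rfl⟩ | ⟨rfl, hl, rfl⟩
  · simp only [one_mul, sub_zero]
    rw [setIntegral_interval_of_support (c := Y / s) ⟨by positivity, hlen⟩]
    · exact intervalIntegral_comp_mul_of_support hF hs h0 (by field_simp; rfl)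
    · intro x _ hx
      rw [div_lt_iff₀' hs] at hx
      exact h0 _ hx.le
  · have hL := toReal_len_pos hl
    have hYL : Y ≤ s * (G.len e).toReal := by
      rw [← div_le_iff₀' hs]
      exact (ENNReal.ofReal_le_iff_le_toReal hl).1 hlen
    rw [interval_of_ne_top hl, integral_Icc_eq_integral_Ioc,
      ← intervalIntegral.integral_of_le hL.le]
    have h1 := intervalIntegral.integral_comp_sub_left (a := 0) (b := (G.len e).toReal)
      (fun x => F (s * x)) (G.len e).toReal
    rw [sub_self, sub_zero] at h1
    rw [← intervalIntegral_comp_mul_of_support hF hs h0 hYL, ← h1]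
    refine intervalIntegral.integral_congr fun x _ => ?_
    congr 2
    ring

/-- Integral of an even profile placed around the point `x₀` of an edge. -/
theorem setIntegral_center {e : G.E} {x₀ : ℝ} (hx₀ : 2 * x₀ ∈ G.interval e) {F : ℝ → ℝ}
    (hF : Continuous F) (heven : ∀ y, F (-y) = F y) {s : ℝ} (hs : 0 < s)
    (h0 : ∀ x ∈ G.interval e, 2 * x₀ < x → F (s * (1 * (x - x₀))) = 0) :
    ∫ x in G.interval e, F (s * (1 * (x - x₀))) = s⁻¹ * (2 * ∫ y in (0 : ℝ)..(s * x₀), F y) := by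
  rw [setIntegral_interval_of_support hx₀ h0]
  simp only [one_mul]
  have h1 := intervalIntegral.integral_comp_sub_right (a := 0) (b := 2 * x₀)
    (fun x => F (s * x)) x₀
  rw [h1, intervalIntegral.integral_comp_mul_left _ hs.ne', smul_eq_mul,
    ← intervalIntegral.integral_add_adjacent_intervals (hF.intervalIntegrable _ 0)
      (hF.intervalIntegrable 0 _)]
  have h2 := intervalIntegral.integral_comp_neg (a := 0) (b := s * x₀) F
  rw [neg_zero] at h2
  have h3 : ∫ y in s * (0 - x₀)..0, F y = ∫ y in (0 : ℝ)..(s * x₀), F y := by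
    rw [show s * (0 - x₀) = -(s * x₀) by ring, ← h2]
    exact intervalIntegral.integral_congr fun y _ => heven y
  rw [h3, show 2 * x₀ - x₀ = x₀ by ring]
  ring

end Integrals

/-- Families of `H¹` functions obtained by placing dilated profiles on finitely many edges. -/
theorem exists_profile_family [Countable G.E] {S : Finset G.E} {X : ℝ} {I : Set ℝ}
    {a : ℝ → G.E → ℝ} {h h' : G.E → ℝ → ℝ} {τ x₀ : G.E → ℝ}
    (ha : ∀ e, Continuous fun s => a s e) (hh' : ∀ e, Continuous (h' e))
    (hd : ∀ e y, HasDerivAt (h e) (h' e y) y) (hτ : ∀ e, τ e ^ 2 = 1)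
    (h0 : ∀ s ∈ I, ∀ e, ∀ x ∈ G.interval e, (e ∈ S → X < x) →
      a s e = 0 ∨ (h e (s * (τ e * (x - x₀ e))) = 0 ∧ h' e (s * (τ e * (x - x₀ e))) = 0))
    (hvert : ∀ s ∈ I, ∃ c : G.V → ℝ, ∀ e,
      a s e * h e (s * (τ e * (0 - x₀ e))) = c (G.src e) ∧
      ∀ hl : G.len e ≠ ⊤,
        a s e * h e (s * (τ e * ((G.len e).toReal - x₀ e))) = c (G.tgt e hl)) :
    ∃ U : ℝ → G.L2 × G.L2, ContinuousOn U I ∧ ∀ s ∈ I, U s ∈ G.H1 ∧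
      ‖(U s).1‖ ^ 2 =
        ∑ e ∈ S, a s e ^ 2 * ∫ x in G.interval e, h e (s * (τ e * (x - x₀ e))) ^ 2 ∧
      ‖(U s).2‖ ^ 2 =
        ∑ e ∈ S, a s e ^ 2 * (s ^ 2 * ∫ x in G.interval e, h' e (s * (τ e * (x - x₀ e))) ^ 2) ∧
      ∀ p : ℝ, 0 < p → ∫ z, |(U s).1 z| ^ p ∂G.edgeMeasure =
        ∑ e ∈ S, |a s e| ^ p * ∫ x in G.interval e, |h e (s * (τ e * (x - x₀ e)))| ^ p := by
  have hh : ∀ e, Continuous (h e) := fun e =>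
    continuous_iff_continuousAt.2 fun y => (hd e y).continuousAt
  have hcoord : ∀ e, Continuous fun q : ℝ × ℝ => q.1 * (τ e * (q.2 - x₀ e)) := fun e => by fun_prop
  obtain ⟨U, hU, hUs⟩ := exists_H1_family (S := S) (X := X) (I := I)
    (f := fun s e x => a s e * h e (s * (τ e * (x - x₀ e))))
    (g := fun s e x => a s e * (h' e (s * (τ e * (x - x₀ e))) * (s * τ e)))
    (fun e => ((ha e).comp continuous_fst).mul ((hh e).comp (hcoord e)))
    (fun e => ((ha e).comp continuous_fst).mul (((hh' e).comp (hcoord e)).mul (by fun_prop)))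
    (fun s e x => by
      have h1 : HasDerivAt (fun x : ℝ => s * (τ e * (x - x₀ e))) (s * τ e) x := by
        simpa using (((hasDerivAt_id x).sub_const (x₀ e)).const_mul (τ e)).const_mul s
      exact ((hd e _).comp x h1).const_mul (a s e))
    (fun s hs e x hx hS => by
      rcases h0 s hs e x hx hS with h | h <;> simp [h])
    (fun s hs e x hx hS => by
      rcases h0 s hs e x hx hS with h | h <;> simp [h])
    hvert
  refine ⟨U, hU, fun s hs => ?_⟩
  obtain ⟨h1, h2, h3, h4⟩ := hUs s hs
  refine ⟨h1, ?_, ?_, fun p hp => ?_⟩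
  · rw [h2]
    refine Finset.sum_congr rfl fun e _ => ?_
    rw [← integral_const_mul]
    simp only [mul_pow]
  · rw [h3]
    refine Finset.sum_congr rfl fun e _ => ?_
    rw [← integral_const_mul, ← integral_const_mul]
    simp only [mul_pow, hτ e]
    refine integral_congr_ae (Eventually.of_forall fun x => ?_)
    simp only
    ring
  · rw [h4 p hp]
    refine Finset.sum_congr rfl fun e _ => ?_
    rw [← integral_const_mul]
    simp only [abs_mul, Real.mul_rpow (abs_nonneg _) (abs_nonneg _)]

/-- On a graph made of half-lines glued at one point, there are functions of every mass and
kinetic energy. -/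
theorem exists_norm_snd_eq [Fintype G.E] [Nonempty G.E] (hl : ∀ e, G.len e = ⊤) {μ x : ℝ} (hμ : 0 < μ) (hx : 0 < x) :
    ∃ w ∈ G.H1mass μ, ‖w.2‖ = x := by
  -- The dilated tail has kinetic energy over mass equal to `s² (2/9) / (6/5) = 5 s² / 27`, whatever
  -- the number of half-lines; at mass `μ` this dilation gives kinetic energy `x²`.
  set s := x * √(27 / (5 * μ)) with hs
  have hsp : 0 < s := by positivity
  obtain ⟨U, -, hU⟩ := exists_profile_family (G := G) (S := Finset.univ) (X := 6 / s) (I := {s})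
    (a := fun _ _ => 1) (h := fun _ => tail) (h' := fun _ => tailDeriv) (τ := fun _ => 1)
    (x₀ := fun _ => 0) (fun e => continuous_const) (fun e => continuous_tailDeriv)
    (fun e => hasDerivAt_tail) (fun e => by norm_num)
    (by
      rintro _ rfl e y hy hS
      have : 6 ≤ s * (1 * (y - 0)) := by
        have := hS (Finset.mem_univ e)
        rw [div_lt_iff₀' hsp] at this
        linarith
      exact Or.inr ⟨tail_of_le this, tailDeriv_of_le this⟩)
    (by
      rintro _ rfl
      refine ⟨fun _ => 1, fun e => ⟨?_, fun h => absurd (hl e) h⟩⟩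
      simp [tail_zero])
  obtain ⟨h1, h2, h3, -⟩ := hU s rfl
  have hend : ∀ e, G.IsEndCoord e 1 0 := fun e => Or.inl ⟨rfl, rfl⟩
  have hm : ∀ e, ∫ y in G.interval e, tail (s * (1 * (y - 0))) ^ 2 = s⁻¹ * (6 / 5) := fun e => by
    rw [setIntegral_end (hend e) (F := fun y => tail y ^ 2) (continuous_tail.pow 2) hsp
      (by norm_num : (0 : ℝ) ≤ 6) (fun y hy => by simp [tail_of_le hy]) (by simp [hl e]),
      integral_tail_sq]
  have hk : ∀ e, ∫ y in G.interval e, tailDeriv (s * (1 * (y - 0))) ^ 2 = s⁻¹ * (2 / 9) :=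
    fun e => by
      rw [setIntegral_end (hend e) (F := fun y => tailDeriv y ^ 2) (continuous_tailDeriv.pow 2) hsp
        (by norm_num : (0 : ℝ) ≤ 6) (fun y hy => by simp [tailDeriv_of_le hy]) (by simp [hl e]),
        integral_tailDeriv_sq]
  simp only [hm, hk] at h2 h3
  simp only [Finset.sum_const, one_pow, one_mul, nsmul_eq_mul] at h2 h3
  have hcard : (0 : ℝ) < (Finset.univ : Finset G.E).card :=
    Nat.cast_pos.2 Finset.univ_nonempty.card_pos
  have hpos : 0 < ‖(U s).1‖ := by
    have : 0 < ‖(U s).1‖ ^ 2 := by rw [h2]; positivity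
    exact (norm_nonneg _).lt_of_ne fun h => by simp [← h] at this
  refine ⟨normalize μ (U s), normalize_mem_H1mass hμ.le h1 hpos, ?_⟩
  have : ‖(normalize μ (U s)).2‖ ^ 2 = x ^ 2 := by
    rw [norm_normalize_snd_sq hμ.le, h2, h3]
    have hs2 : s ^ 2 = x ^ 2 * (27 / (5 * μ)) := by
      rw [hs, mul_pow, Real.sq_sqrt (by positivity)]
    have hs1 : s⁻¹ ≠ 0 := by positivity
    calc _ = μ * s ^ 2 * (5 / 27) := by
          field_simp
          norm_num
      _ = x ^ 2 := by
        rw [hs2]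
        field_simp
  exact (pow_left_inj₀ (norm_nonneg _) hx.le two_ne_zero).1 this

end MetricGraph

/-! ### The scale-invariant quotient, and bumps inside an edge. -/

namespace MetricGraph

open Filter Topology

variable {G : MetricGraph.{u, v}} {p θ : ℝ}

section Quotient

/-- The powers of `s` cancel, as `-(p + 2)/4 + (p - 2)/4 = -1`; only the undilated integrals `a`,
`b`, `c` matter. -/
theorem reachesGN_of_scaled {w : G.L2 × G.L2} {r s a b c : ℝ} (hs : 0 < s) (ha : 0 ≤ a)
    (hb : 0 ≤ b) (hm : ‖w.1‖ ^ 2 = s⁻¹ * a) (hN : ‖w.2‖ ^ 2 = s * b)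
    (hP : ∫ z, |w.1 z| ^ p ∂G.edgeMeasure = s⁻¹ * c)
    (h : r * gnConst p θ * a ^ ((p + 2) / 4) * b ^ ((p - 2) / 4) ≤ c) : ReachesGN p θ r w := by
  have hs' : 0 < s⁻¹ := inv_pos.2 hs
  rw [ReachesGN, hm, hN, hP, Real.mul_rpow hs'.le ha, Real.mul_rpow hs.le hb]
  have e : s⁻¹ ^ ((p + 2) / 4) * s ^ ((p - 2) / 4) = s⁻¹ := by
    rw [Real.inv_rpow hs.le, ← Real.rpow_neg hs.le, ← Real.rpow_add hs, ← Real.rpow_neg_one]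
    congr 1
    ring
  calc _ = s⁻¹ ^ ((p + 2) / 4) * s ^ ((p - 2) / 4) *
        (r * gnConst p θ * a ^ ((p + 2) / 4) * b ^ ((p - 2) / 4)) := by ring
    _ ≤ s⁻¹ * c := by
      rw [e]
      exact mul_le_mul_of_nonneg_left h hs'.le

/-- `gnConst p θ` is the quotient of `θ` half-solitons, with mass `θ (p+2)/(p-2) gnInt`, kinetic
energy `θ gnInt` and power `4 θ gnInt/(p-2)`; the quotient is monotone in each of the three. -/
theorem gnConst_mul_le (hp : 2 < p) (hθ : 0 < θ) {r a b c : ℝ} (hr : 0 ≤ r) (ha : 0 ≤ a)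
    (hb : 0 ≤ b) (ham : a ≤ θ * ((p + 2) / (p - 2) * gnInt p)) (hbN : b ≤ θ * gnInt p)
    (hc : r * (θ * (4 * gnInt p / (p - 2))) ≤ c) :
    r * gnConst p θ * a ^ ((p + 2) / 4) * b ^ ((p - 2) / 4) ≤ c := by
  have hp2 : 0 < p - 2 := by linarith
  have hI := gnInt_pos hp
  have hK := gnConst_pos hp hθ
  have h1 : a ^ ((p + 2) / 4) ≤ (θ * (p + 2) / (p - 2) * gnInt p) ^ ((p + 2) / 4) :=
    Real.rpow_le_rpow ha (ham.trans_eq (by ring)) (by linarith)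
  have h2 : b ^ ((p - 2) / 4) ≤ (θ * gnInt p) ^ ((p - 2) / 4) :=
    Real.rpow_le_rpow hb hbN (by linarith)
  refine le_trans ?_ hc
  have h3 : gnConst p θ * ((θ * (p + 2) / (p - 2) * gnInt p) ^ ((p + 2) / 4) *
      (θ * gnInt p) ^ ((p - 2) / 4)) = θ * (4 * gnInt p / (p - 2)) := by
    rw [gnConst, div_mul_cancel₀]
    · ring
    · positivity
  rw [← h3]
  calc _ ≤ r * gnConst p θ * (θ * (p + 2) / (p - 2) * gnInt p) ^ ((p + 2) / 4) *
        (θ * gnInt p) ^ ((p - 2) / 4) := by gcongr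
    _ = _ := by ring

/-- The shares `(p + 2)/(2p)` and `(p - 2)/(2p)` of mass and kinetic energy in their sum, for the
soliton, are exactly the weights in the quotient. Hence the weighted mean inequality lets the sum `a
+ b` alone be compared with the soliton's, so that an increase of one may be paid for by the other.
-/
theorem gnConst_mul_le_of_add (hp : 2 < p) (hθ : 0 < θ) {r a b c : ℝ} (ha : 0 < a) (hb : 0 < b)
    (hr : 0 ≤ r)
    (hab : r ^ (2 / p) * (a + b) ≤ θ * ((p + 2) / (p - 2) * gnInt p) + θ * gnInt p)
    (hc : θ * (4 * gnInt p / (p - 2)) ≤ c) :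
    r * gnConst p θ * a ^ ((p + 2) / 4) * b ^ ((p - 2) / 4) ≤ c := by
  have hp2 : 0 < p - 2 := by linarith
  have hp0 : 0 < p := by linarith
  have hI := gnInt_pos hp
  set N₀ := θ * gnInt p with hN₀
  set m₀ := θ * (p + 2) / (p - 2) * gnInt p with hm₀
  have hN₀p : 0 < N₀ := by positivity
  have hm₀p : 0 < m₀ := by positivity
  have hm₀' : θ * ((p + 2) / (p - 2) * gnInt p) = m₀ := by rw [hm₀]; ring
  rw [hm₀'] at hab
  -- weighted arithmetic–geometric mean inequality for the two quotients
  have h1 := Real.geom_mean_le_arith_mean2_weighted (w₁ := (p + 2) / (2 * p))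
    (w₂ := (p - 2) / (2 * p)) (p₁ := a / m₀) (p₂ := b / N₀) (by positivity) (by positivity)
    (by positivity) (by positivity) (by field_simp; ring)
  have h2 : (p + 2) / (2 * p) * (a / m₀) + (p - 2) / (2 * p) * (b / N₀) = (a + b) / (m₀ + N₀) := by
    rw [hm₀, hN₀]
    field_simp
    ring
  rw [h2] at h1
  have h3 : (a / m₀) ^ ((p + 2) / 4) * (b / N₀) ^ ((p - 2) / 4) ≤
      ((a + b) / (m₀ + N₀)) ^ (p / 2) := by
    refine le_trans (le_of_eq ?_) (Real.rpow_le_rpow (by positivity) h1 (by positivity))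
    rw [Real.mul_rpow (by positivity) (by positivity), ← Real.rpow_mul (by positivity),
      ← Real.rpow_mul (by positivity)]
    congr 2 <;> field_simp <;> norm_num
  have h4 : r * ((a + b) / (m₀ + N₀)) ^ (p / 2) ≤ 1 := by
    have h5 : r = (r ^ (2 / p)) ^ (p / 2) := by
      rw [← Real.rpow_mul hr, show 2 / p * (p / 2) = 1 by field_simp, Real.rpow_one]
    rw [h5, ← Real.mul_rpow (Real.rpow_nonneg hr _) (by positivity)]
    refine Real.rpow_le_one (by positivity) ?_ (by positivity)
    rw [← mul_div_assoc, div_le_one (by positivity)]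
    exact hab
  refine le_trans ?_ hc
  have h6 : gnConst p θ * a ^ ((p + 2) / 4) * b ^ ((p - 2) / 4) =
      θ * (4 * gnInt p / (p - 2)) * ((a / m₀) ^ ((p + 2) / 4) * (b / N₀) ^ ((p - 2) / 4)) := by
    have hg : gnConst p θ = (4 * θ * gnInt p / (p - 2)) /
        (m₀ ^ ((p + 2) / 4) * N₀ ^ ((p - 2) / 4)) := rfl
    rw [hg, Real.div_rpow ha.le hm₀p.le, Real.div_rpow hb.le hN₀p.le]
    have : 0 < m₀ ^ ((p + 2) / 4) := by positivity
    have : 0 < N₀ ^ ((p - 2) / 4) := by positivity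
    field_simp
  have hP : 0 < θ * (4 * gnInt p / (p - 2)) := by positivity
  calc _ = θ * (4 * gnInt p / (p - 2)) *
        (r * ((a / m₀) ^ ((p + 2) / 4) * (b / N₀) ^ ((p - 2) / 4))) := by
          rw [mul_assoc, mul_assoc, ← mul_assoc (gnConst p θ), h6]
          ring
    _ ≤ θ * (4 * gnInt p / (p - 2)) * 1 := by
      refine mul_le_mul_of_nonneg_left ?_ hP.le
      exact (mul_le_mul_of_nonneg_left h3 hr).trans h4
    _ = _ := mul_one _

/-- Variant of `exists_level_le_of_reachesGN` for dilated profiles. -/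
theorem exists_level_le_of_scaled [Countable G.E] (hp : 6 < p) (hθ : 0 < θ) {r₀ s₀ A B : ℝ}
    (hr₀ : 0 < r₀) (hs₀ : 0 < s₀) {U : ℝ → G.L2 × G.L2} {a b c : ℝ → ℝ}
    (hU : ContinuousOn U (Ici s₀)) (hH1 : ∀ s ≥ s₀, U s ∈ G.H1)
    (hm : ∀ s ≥ s₀, ‖(U s).1‖ ^ 2 = s⁻¹ * a s) (hN : ∀ s ≥ s₀, ‖(U s).2‖ ^ 2 = s * b s)
    (hP : ∀ s ≥ s₀, ∫ z, |(U s).1 z| ^ p ∂G.edgeMeasure = s⁻¹ * c s)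
    (ha : ∀ s ≥ s₀, 0 < a s) (haA : ∀ s ≥ s₀, a s ≤ A) (hB : 0 < B) (hb : ∀ s ≥ s₀, B ≤ b s)
    (hQ : ∀ s₁ ≥ s₀, ∃ r > r₀, ∀ s ∈ Icc s₀ s₁,
      r * gnConst p θ * a s ^ ((p + 2) / 4) * b s ^ ((p - 2) / 4) ≤ c s) :
    ∃ μ₀ : ℝ, 0 < μ₀ ∧ ∀ μ : ℝ, 0 < μ → μ ≤ μ₀ → ∃ r > r₀,
      ∀ δ : ℝ, (G.setA μ δ).Nonempty → ∀ ρ ∈ Icc (1 / 2 : ℝ) 1,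
        G.level p μ δ ρ ≤
          (fiberMax ((p - 2) / 2) (ρ / p * (r * (gnConst p θ * μ ^ ((p + 2) / 4)))) : EReal) := by
  refine exists_level_le_of_reachesGN hp hθ hr₀ hU hH1 (fun s hs => ?_) (fun K => ?_)
    fun s₁ hs₁ => ?_
  · have h1 : 0 < ‖(U s).1‖ ^ 2 := by
      rw [hm s hs]
      exact mul_pos (inv_pos.2 (hs₀.trans_le hs)) (ha s hs)
    exact (norm_nonneg _).lt_of_ne fun h => by simp [← h] at h1
  · have hA : 0 < A := (ha s₀ le_rfl).trans_le (haA s₀ le_rfl)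
    -- The ratio is `s² b/a ≥ s² B/A`; with `s ≥ 1` and `s ≥ K A/B` it is at least `K`.
    refine ⟨max s₀ (max 1 (K * (A / B))), le_max_left _ _, ?_⟩
    set s := max s₀ (max 1 (K * (A / B)))
    have hs : s₀ ≤ s := le_max_left _ _
    have hs1 : 1 ≤ s := (le_max_left _ _).trans (le_max_right _ _)
    have hsK : K * (A / B) ≤ s := (le_max_right _ _).trans (le_max_right _ _)
    have hsp : 0 < s := hs₀.trans_le hs
    rw [hm s hs, hN s hs]
    have h1 : s * b s / (s⁻¹ * a s) = s ^ 2 * (b s / a s) := by field_simp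
    have h2 : B / A ≤ b s / a s := div_le_div₀ (hB.le.trans (hb s hs)) (hb s hs) (ha s hs) (haA s hs)
    rw [h1]
    calc K = K * (A / B) * (B / A) := by field_simp
      _ ≤ s ^ 2 * (b s / a s) := by
        refine mul_le_mul ?_ h2 (by positivity) (by positivity)
        nlinarith
  · obtain ⟨r, hr, h⟩ := hQ s₁ hs₁
    refine ⟨r, hr, fun s hs => ?_⟩
    exact reachesGN_of_scaled (hs₀.trans_le hs.1) (ha s hs.1).le (hB.le.trans (hb s hs.1))
      (hm s hs.1) (hN s hs.1) (hP s hs.1) (h s hs)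

end Quotient

section Bump

theorem intervalIntegral_of_support {F : ℝ → ℝ} (hF : Continuous F) {Y c : ℝ}
    (h0 : ∀ y, Y ≤ y → F y = 0) (hc : Y ≤ c) :
    ∫ x in (0 : ℝ)..c, F x = ∫ y in (0 : ℝ)..Y, F y := by
  simpa using intervalIntegral_comp_mul_of_support hF one_pos h0 (by simpa using hc)

theorem exists_two_mul_mem_interval (e : G.E) : ∃ x : ℝ, 0 < x ∧ 2 * x ∈ G.interval e := by
  by_cases h : G.len e = ⊤
  · exact ⟨1, one_pos, by rw [interval_of_eq_top h]; norm_num⟩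
  · have := toReal_len_pos h
    refine ⟨(G.len e).toReal / 2, by positivity, ?_⟩
    rw [interval_of_ne_top h]
    constructor <;> linarith

/-- Bumps in the interior of an edge. -/
theorem exists_level_le_of_edge [Countable G.E] (hp : 6 < p) (e : G.E) {r₀ : ℝ} (hr₀ : 0 < r₀)
    (hr₀1 : r₀ < 1) :
    ∃ μ₀ : ℝ, 0 < μ₀ ∧ ∀ μ : ℝ, 0 < μ → μ ≤ μ₀ → ∃ r > r₀,
      ∀ δ : ℝ, (G.setA μ δ).Nonempty → ∀ ρ ∈ Icc (1 / 2 : ℝ) 1,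
        G.level p μ δ ρ ≤
          (fiberMax ((p - 2) / 2) (ρ / p * (r * (gnConst p 2 * μ ^ ((p + 2) / 4)))) : EReal) := by
  classical
  obtain ⟨h, h', R, hR, hc, hc', hd, heven, hodd, h0, hm0, hk0, hm, hk, hpw⟩ :=
    exists_profile hp (r := (1 + r₀) / 2) (by linarith) (by linarith)
  obtain ⟨x₁, hx₁, hx₁e⟩ := exists_two_mul_mem_interval e
  -- From this dilation on, the bump centred at `x₁` is supported in `[0, 2 x₁]`, inside the edge,
  -- and vanishes at all vertices.
  set s₀ := R / x₁ with hs₀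
  have hs₀p : 0 < s₀ := by positivity
  have hsR : ∀ s ≥ s₀, R ≤ s * x₁ := fun s hs => by
    rwa [ge_iff_le, hs₀, div_le_iff₀ hx₁] at hs
  have hout : ∀ s ≥ s₀, ∀ x, 2 * x₁ ≤ x → R ≤ |s * (1 * (x - x₁))| := by
    intro s hs x hx
    have hsp := hs₀p.trans_le hs
    refine (hsR s hs).trans (le_trans ?_ (le_abs_self _))
    nlinarith
  obtain ⟨U, hU, hUs⟩ := exists_profile_family (G := G) (S := {e}) (X := 2 * x₁) (I := Ici s₀)
    (a := fun _ e' => if e' = e then 1 else 0) (h := fun _ => h) (h' := fun _ => h')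
    (τ := fun _ => 1) (x₀ := fun _ => x₁) (fun _ => continuous_const) (fun _ => hc')
    (fun _ => hd) (fun _ => one_pow 2)
    (by
      intro s hs e' x hx hS
      by_cases he : e' = e
      · exact Or.inr (h0 _ (hout s hs x (hS (Finset.mem_singleton.2 he)).le))
      · exact Or.inl (if_neg he))
    (by
      intro s hs
      refine ⟨fun _ => 0, fun e' => ?_⟩
      by_cases he : e' = e
      · subst he
        refine ⟨?_, fun hl => ?_⟩
        · rw [(h0 _ _).1, mul_zero]
          rw [one_mul, zero_sub, mul_neg, abs_neg]
          exact (hsR s hs).trans (le_abs_self _)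
        · rw [(h0 _ (hout s hs _ _)).1, mul_zero]
          rw [interval_of_ne_top hl] at hx₁e
          exact hx₁e.2
      · simp [he])
  have key : ∀ F : ℝ → ℝ, Continuous F → (∀ y, F (-y) = F y) → (∀ y, R ≤ |y| → F y = 0) →
      ∀ s ≥ s₀, ∫ x in G.interval e, F (s * (1 * (x - x₁))) =
        s⁻¹ * (2 * ∫ y in (0 : ℝ)..R, F y) := by
    intro F hF hFe hF0 s hs
    rw [setIntegral_center hx₁e hF hFe (hs₀p.trans_le hs) fun x _ hx => hF0 _ (hout s hs x hx.le),
      intervalIntegral_of_support hF (fun y hy => hF0 y (hy.trans (le_abs_self y))) (hsR s hs)]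
  have hpc : Continuous fun y => |h y| ^ p := hc.abs.rpow_const fun _ => Or.inr (by linarith)
  refine exists_level_le_of_scaled hp two_pos hr₀ hs₀p (U := U)
    (a := fun _ => 2 * ∫ y in (0 : ℝ)..R, h y ^ 2) (b := fun _ => 2 * ∫ y in (0 : ℝ)..R, h' y ^ 2)
    (c := fun _ => 2 * ∫ y in (0 : ℝ)..R, |h y| ^ p) (B := 2 * ∫ y in (0 : ℝ)..R, h' y ^ 2)
    hU (fun s hs => (hUs s hs).1) ?_ ?_ ?_ (fun _ _ => by positivity) (fun _ _ => le_rfl)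
    (by positivity) (fun _ _ => le_rfl) ?_
  · intro s hs
    rw [(hUs s hs).2.1, Finset.sum_singleton, if_pos rfl, one_pow, one_mul,
      key (fun y => h y ^ 2) (hc.pow 2) (fun y => by simp only [heven])
        (fun y hy => by simp [(h0 y hy).1]) s hs]
  · intro s hs
    have hsp := hs₀p.trans_le hs
    rw [(hUs s hs).2.2.1, Finset.sum_singleton, if_pos rfl, one_pow, one_mul,
      key (fun y => h' y ^ 2) (hc'.pow 2) (fun y => by simp only [hodd, neg_sq])
        (fun y hy => by simp [(h0 y hy).2]) s hs]
    field_simp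
  · intro s hs
    rw [(hUs s hs).2.2.2 p (by linarith), Finset.sum_singleton, if_pos rfl, abs_one, Real.one_rpow,
      one_mul, key (fun y => |h y| ^ p) hpc (fun y => by simp only [heven])
        (fun y hy => by simp [(h0 y hy).1, Real.zero_rpow (by linarith : p ≠ 0)]) s hs]
  · intro s₁ _
    -- The integrals do not depend on `s`, so the profile's own fraction, strictly between `r₀` and
    -- `1`, serves for all `s`.
    refine ⟨(1 + r₀) / 2, by linarith, fun s _ => ?_⟩
    refine gnConst_mul_le (by linarith) two_pos (by linarith) (by positivity) (by positivity)
      (by linarith) (by linarith) ?_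
    rw [mul_left_comm]
    linarith

end Bump

end MetricGraph

/-! ### Edge ends at a vertex; pendants and signposts. -/

namespace MetricGraph

open Filter Topology

variable {G : MetricGraph.{u, v}} {p : ℝ}

section Ends

theorem eq_and_eq_of_encard_add {α : Type*} {A B A₀ B₀ : Set α} (hA : A₀ ⊆ A) (hB : B₀ ⊆ B)
    (hA₀ : A₀.Finite) (hB₀ : B₀.Finite) (h : A.encard + B.encard = A₀.encard + B₀.encard) :
    A = A₀ ∧ B = B₀ := by
  have h1 : A.encard ≤ A₀.encard := by
    have : A.encard + B₀.encard ≤ A₀.encard + B₀.encard := by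
      rw [← h]
      gcongr
    exact (ENat.add_le_add_iff_right hB₀.encard_lt_top.ne).1 this
  have h2 : B.encard ≤ B₀.encard := by
    have : A₀.encard + B.encard ≤ A₀.encard + B₀.encard := by
      rw [← h]
      gcongr
    exact (ENat.add_le_add_iff_left hA₀.encard_lt_top.ne).1 this
  exact ⟨(hA₀.eq_of_subset_of_encard_le hA h1).symm, (hB₀.eq_of_subset_of_encard_le hB h2).symm⟩

/-- The edge ends at a vertex `v` are one end of the edge `b`, with coordinate `τ (x - x₀)`, and
both ends of the edges of the set `L`. -/
def HasEnds (G : MetricGraph.{u, v}) (w : G.V) (b : G.E) (L : Set G.E) (τ x₀ : ℝ) : Prop :=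
  G.IsEndCoord b τ x₀ ∧ (∀ e, G.src e = w ↔ e ∈ L ∨ (e = b ∧ τ = 1)) ∧
    ∀ e (h : G.len e ≠ ⊤), G.tgt e h = w ↔ e ∈ L ∨ (e = b ∧ τ = -1)

/-- The known ends (both ends of each loop in `L`, one of `b`) already exhaust the finite degree, so
by counting there are no others. Used with `L = ∅` at the tip of a pendant and with one loop at a
signpost. -/
theorem exists_hasEnds {w : G.V} {b : G.E} {L : Set G.E} (hb : G.IsEndpoint b w)
    (hLb : b ∉ L) (hL : ∀ l ∈ L, G.IsLoopAt l w) (hfin : L.Finite)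
    (hdeg : G.degree w = L.encard + L.encard + 1) : ∃ τ x₀, G.HasEnds w b L τ x₀ := by
  have hsub1 : L ⊆ {e : G.E | G.src e = w} := fun l hl => (hL l hl).1
  have hsub2 : L ⊆ {e : G.E | ∃ h : G.len e ≠ ⊤, G.tgt e h = w} := fun l hl => (hL l hl).2
  have hins : (insert b L).encard = L.encard + 1 := encard_insert_of_notMem hLb
  rcases hb with hb | hb
  · obtain ⟨h1, h2⟩ := eq_and_eq_of_encard_add (A := {e : G.E | G.src e = w})
      (B := {e : G.E | ∃ h : G.len e ≠ ⊤, G.tgt e h = w}) (A₀ := insert b L) (B₀ := L)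
      (insert_subset hb hsub1) hsub2 (hfin.insert b) hfin
      (by rw [hins, add_right_comm]; exact hdeg)
    refine ⟨1, 0, Or.inl ⟨rfl, rfl⟩, fun e => ?_, fun e he => ?_⟩
    · have := Set.ext_iff.1 h1 e
      simp only [mem_ofPred_eq, mem_insert_iff] at this
      rw [this]
      tauto
    · have := Set.ext_iff.1 h2 e
      simp only [mem_ofPred_eq] at this
      rw [← this]
      refine ⟨fun h => Or.inl ⟨he, h⟩, ?_⟩
      rintro (⟨_, h⟩ | ⟨_, h⟩)
      · exact h
      · norm_num at h
  · obtain ⟨h1, h2⟩ := eq_and_eq_of_encard_add (A := {e : G.E | G.src e = w})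
      (B := {e : G.E | ∃ h : G.len e ≠ ⊤, G.tgt e h = w}) (A₀ := L) (B₀ := insert b L)
      hsub1 (insert_subset hb hsub2) hfin (hfin.insert b)
      (by rw [hins, ← add_assoc]; exact hdeg)
    refine ⟨-1, (G.len b).toReal, Or.inr ⟨rfl, hb.1, rfl⟩, fun e => ?_, fun e he => ?_⟩
    · have := Set.ext_iff.1 h1 e
      simp only [mem_ofPred_eq] at this
      rw [this]
      refine ⟨Or.inl, ?_⟩
      rintro (h | ⟨_, h⟩)
      · exact h
      · norm_num at h
    · have := Set.ext_iff.1 h2 e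
      simp only [mem_ofPred_eq, mem_insert_iff] at this
      constructor
      · intro h
        have := this.1 ⟨he, h⟩
        tauto
      · intro h
        obtain ⟨_, h'⟩ := this.2 (by tauto)
        exact h'

/-- For checking the vertex condition whichever way `b` is oriented: a profile in the coordinate of
`HasEnds` takes its value `F 0` at `w` and has died out at the other end. -/
theorem HasEnds.src_value {w : G.V} {b : G.E} {L : Set G.E} {τ x₀ : ℝ} (h : G.HasEnds w b L τ x₀)
    (hl : G.len b ≠ ⊤) {F : ℝ → ℝ} {s Y : ℝ} (h0 : ∀ y, Y ≤ y → F y = 0)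
    (hY : Y ≤ s * (G.len b).toReal) (hbL : b ∉ L) :
    (G.src b = w → F (s * (τ * (0 - x₀))) = F 0) ∧
    (G.src b ≠ w → F (s * (τ * (0 - x₀))) = 0) ∧
    (G.tgt b hl = w → F (s * (τ * ((G.len b).toReal - x₀))) = F 0) ∧
    (G.tgt b hl ≠ w → F (s * (τ * ((G.len b).toReal - x₀))) = 0) := by
  obtain ⟨hc, hs, ht⟩ := h
  rw [ne_eq, ne_eq, hs, ht]
  rcases hc with ⟨rfl, rfl⟩ | ⟨rfl, -, rfl⟩
  · refine ⟨fun _ => by simp, fun h => absurd (Or.inr ⟨rfl, rfl⟩) h, fun h => ?_, fun _ => ?_⟩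
    · rcases h with h | ⟨_, h⟩
      · exact absurd h hbL
      · norm_num at h
    · rw [one_mul, sub_zero]
      exact h0 _ hY
  · refine ⟨fun h => ?_, fun _ => ?_, fun _ => by simp, fun h => absurd (Or.inr ⟨rfl, rfl⟩) h⟩
    · rcases h with h | ⟨_, h⟩
      · exact absurd h hbL
      · norm_num at h
    · rw [show s * (-1 * (0 - (G.len b).toReal)) = s * (G.len b).toReal by ring]
      exact h0 _ hY

end Ends

section Pendant

/-- Half bumps at the tip of a pendant. -/
theorem exists_level_le_of_pendant [Countable G.E] (hp : 6 < p) (hG : G.HasPendant) {r₀ : ℝ}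
    (hr₀ : 0 < r₀) (hr₀1 : r₀ < 1) :
    ∃ μ₀ : ℝ, 0 < μ₀ ∧ ∀ μ : ℝ, 0 < μ → μ ≤ μ₀ → ∃ r > r₀,
      ∀ δ : ℝ, (G.setA μ δ).Nonempty → ∀ ρ ∈ Icc (1 / 2 : ℝ) 1,
        G.level p μ δ ρ ≤
          (fiberMax ((p - 2) / 2) (ρ / p * (r * (gnConst p 1 * μ ^ ((p + 2) / 4)))) : EReal) := by
  classical
  obtain ⟨e, w, hl, hew, hdeg⟩ := hG
  obtain ⟨τ, x₀, hE⟩ := exists_hasEnds (L := ∅) hew (notMem_empty e) (fun l hl => absurd hl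
    (notMem_empty l)) finite_empty (by simpa using hdeg)
  obtain ⟨h, h', R, hR, hc, hc', hd, -, -, h0, hm0, hk0, hm, hk, hpw⟩ :=
    exists_profile hp (r := (1 + r₀) / 2) (by linarith) (by linarith)
  have h0' : ∀ y, R ≤ y → h y = 0 ∧ h' y = 0 := fun y hy => h0 y (hy.trans (le_abs_self y))
  have hL := toReal_len_pos hl
  set s₀ := R / (G.len e).toReal with hs₀
  have hs₀p : 0 < s₀ := by positivity
  have hsR : ∀ s ≥ s₀, R ≤ s * (G.len e).toReal := fun s hs => by
    rwa [ge_iff_le, hs₀, div_le_iff₀ hL] at hs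
  obtain ⟨U, hU, hUs⟩ := exists_profile_family (G := G) (S := {e}) (X := (G.len e).toReal)
    (I := Ici s₀) (a := fun _ e' => if e' = e then 1 else 0) (h := fun _ => h) (h' := fun _ => h')
    (τ := fun _ => τ) (x₀ := fun _ => x₀) (fun _ => continuous_const) (fun _ => hc')
    (fun _ => hd) (fun _ => hE.1.sq_eq_one)
    (by
      intro s hs e' x hx hS
      by_cases he : e' = e
      · subst he
        rw [interval_of_ne_top hl] at hx
        exact absurd (hS (Finset.mem_singleton.2 rfl)) (not_lt.2 hx.2)
      · exact Or.inl (if_neg he))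
    (by
      intro s hs
      -- The maximum `h 0` sits at the tip; no other edge ends there, so the function extends by
      -- zero to the rest of the graph.
      refine ⟨fun w' => if w' = w then h 0 else 0, fun e' => ?_⟩
      by_cases he : e' = e
      · subst he
        obtain ⟨v1, v2, v3, v4⟩ := hE.src_value hl (fun y hy => (h0' y hy).1) (hsR s hs)
          (notMem_empty e')
        refine ⟨?_, fun _ => ?_⟩
        · by_cases hw : G.src e' = w
          · simp only [if_true, one_mul, v1 hw, if_pos hw]
          · simp only [if_true, one_mul, v2 hw, if_neg hw]
        · by_cases hw : G.tgt e' hl = w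
          · simp only [if_true, one_mul, v3 hw, if_pos hw]
          · simp only [if_true, one_mul, v4 hw, if_neg hw]
      · have h1 : G.src e' ≠ w := fun hw => by simpa [he] using (hE.2.1 e').1 hw
        have h2 : ∀ hl', G.tgt e' hl' ≠ w := fun hl' hw => by
          simpa [he] using (hE.2.2 e' hl').1 hw
        simp [he, h1, h2])
  have key : ∀ F : ℝ → ℝ, Continuous F → (∀ y, R ≤ y → F y = 0) →
      ∀ s ≥ s₀, ∫ x in G.interval e, F (s * (τ * (x - x₀))) = s⁻¹ * ∫ y in (0 : ℝ)..R, F y := by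
    intro F hF hF0 s hs
    have hsp := hs₀p.trans_le hs
    refine setIntegral_end hE.1 hF hsp hR.le hF0 ?_
    rw [ENNReal.ofReal_le_iff_le_toReal hl, div_le_iff₀' hsp]
    exact hsR s hs
  have hpc : Continuous fun y => |h y| ^ p := hc.abs.rpow_const fun _ => Or.inr (by linarith)
  refine exists_level_le_of_scaled hp one_pos hr₀ hs₀p (U := U)
    (a := fun _ => ∫ y in (0 : ℝ)..R, h y ^ 2) (b := fun _ => ∫ y in (0 : ℝ)..R, h' y ^ 2)
    (c := fun _ => ∫ y in (0 : ℝ)..R, |h y| ^ p) (B := ∫ y in (0 : ℝ)..R, h' y ^ 2)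
    hU (fun s hs => (hUs s hs).1) ?_ ?_ ?_ (fun _ _ => hm0) (fun _ _ => le_rfl)
    hk0 (fun _ _ => le_rfl) ?_
  · intro s hs
    rw [(hUs s hs).2.1, Finset.sum_singleton, if_pos rfl, one_pow, one_mul,
      key (fun y => h y ^ 2) (hc.pow 2) (fun y hy => by simp [(h0' y hy).1]) s hs]
  · intro s hs
    have hsp := hs₀p.trans_le hs
    rw [(hUs s hs).2.2.1, Finset.sum_singleton, if_pos rfl, one_pow, one_mul,
      key (fun y => h' y ^ 2) (hc'.pow 2) (fun y hy => by simp [(h0' y hy).2]) s hs]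
    field_simp
  · intro s hs
    rw [(hUs s hs).2.2.2 p (by linarith), Finset.sum_singleton, if_pos rfl, abs_one, Real.one_rpow,
      one_mul, key (fun y => |h y| ^ p) hpc
        (fun y hy => by simp [(h0' y hy).1, Real.zero_rpow (by linarith : p ≠ 0)]) s hs]
  · intro s₁ _
    refine ⟨(1 + r₀) / 2, by linarith, fun s _ => ?_⟩
    exact gnConst_mul_le (by linarith) one_pos (by linarith) hm0.le hk0.le
      (by rwa [one_mul]) (by rwa [one_mul]) (by rwa [one_mul])

end Pendant

section Signpost

/-- By `T² = 1 - φ^(p-2)`, the bound `φ^(p-2) < 9/25` gives `T > 4/5`. The bound on `φ²` keeps the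
kinetic energy of the signpost family above `gnInt`. -/
theorem exists_solitonRate_ge (hp : 2 < p) :
    ∃ R₀ : ℝ, 0 < R₀ ∧ ∀ R ≥ R₀, 4 / 5 ≤ solitonRate p R ∧ soliton p R ^ 2 ≤ gnInt p := by
  have hI := gnInt_pos hp
  have ht := tendsto_soliton hp
  have h1 : Tendsto (fun R => soliton p R ^ (p - 2)) atTop (𝓝 0) := by
    have := ht.rpow_const (p := p - 2) (Or.inr (by linarith))
    rwa [Real.zero_rpow (by linarith)] at this
  have h2 : Tendsto (fun R => soliton p R ^ 2) atTop (𝓝 0) := by simpa using ht.pow 2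
  obtain ⟨R₀, hR₀⟩ := eventually_atTop.1 ((h1.eventually_lt_const
    (by norm_num : (0 : ℝ) < 9 / 25)).and ((h2.eventually_lt_const hI).and (eventually_gt_atTop 0)))
  refine ⟨R₀, (hR₀ R₀ le_rfl).2.2, fun R hR => ?_⟩
  obtain ⟨h3, h4, h5⟩ := hR₀ R hR
  refine ⟨?_, h4.le⟩
  rw [soliton_rpow hp] at h3
  have h6 := solitonRate_nonneg hp h5.le
  nlinarith

/-- The two tails beyond `R` carry power about `2 t^p / p`, less than the `6 t^p / (2p + 1)` of the
wide polynomial tail. Precisely, `1 - T² = t^(p-2)` and `T ≥ 4/5` give `t² (1 - T) ≤ 5/9 t^p`, so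
`(p-2)/2` times the power lost on one side is at most `(5/9 - 1/p) t^p`. -/
theorem corePower_add_ge (hp : 6 < p) {R : ℝ} (hR : 0 ≤ R) (hT : 4 / 5 ≤ solitonRate p R) :
    2 * (4 * gnInt p / (p - 2)) ≤ 2 * corePower p R + soliton p R ^ p * (6 / (2 * p + 1)) := by
  have hp2 : 2 < p := by linarith
  have hp2' : 0 < p - 2 := by linarith
  have h := corePower_eq hp2 R
  rw [coreKinetic_eq hp2 hR] at h
  have h2 := two_mul_calib_le hp2 (soliton_pos R).le (soliton_le_one hp2 R)
  have h3 := soliton_rpow_self hp2 R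
  set t := soliton p R
  set T := solitonRate p R
  have htp : 0 ≤ t ^ p := Real.rpow_nonneg (soliton_pos R).le p
  have h4 : t ^ 2 * (1 - T) ≤ 5 / 9 * t ^ p := by
    have h5 : t ^ 2 * (1 - T) * (1 + T) = t ^ p := by rw [h3]; ring
    have hT1 : T ^ 2 ≤ 1 := solitonRate_sq_le_one hp2 R
    have h6 : 0 ≤ t ^ 2 * (1 - T) := mul_nonneg (sq_nonneg _) (by nlinarith)
    nlinarith
  have h7 : 5 / 9 - 1 / p ≤ (p - 2) / 2 * (3 / (2 * p + 1)) := by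
    rw [div_sub_div _ _ (by norm_num) (by linarith), div_mul_div_comm,
      div_le_div_iff₀ (by linarith) (by linarith)]
    nlinarith
  have h8 : (p - 2) / 2 * (4 * gnInt p / (p - 2)) = 2 * gnInt p := by
    field_simp
    norm_num
  have h9 := mul_le_mul_of_nonneg_right h7 htp
  have h10 : (p - 2) / 2 * (4 * gnInt p / (p - 2)) ≤
      (p - 2) / 2 * (corePower p R + t ^ p * (3 / (2 * p + 1))) := by
    rw [h8, mul_add, h]
    have e : t ^ p / p = 1 / p * t ^ p := by ring
    rw [e] at h2
    nlinarith
  have h11 := le_of_mul_le_mul_left h10 (by positivity)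
  have e : t ^ p * (6 / (2 * p + 1)) = 2 * (t ^ p * (3 / (2 * p + 1))) := by ring
  rw [e]
  linarith

/-- By `corePower_eq`, mass plus kinetic energy of the two cores is `p · corePower - 2 t² T`, at
most the full soliton's sum minus `8/5 t²`. The tail adds only `(6/5 + 2/9) t² = 64/45 t²`, leaving
the gain `8/45 t²`. -/
theorem signpost_add_le (hp : 2 < p) {R : ℝ} (hR : 0 ≤ R) (hT : 4 / 5 ≤ solitonRate p R) :
    (2 * (∫ y in (0 : ℝ)..R, soliton p y ^ 2) + soliton p R ^ 2 * (6 / 5)) +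
        (2 * coreKinetic p R + soliton p R ^ 2 * (2 / 9)) ≤
      2 * ((p + 2) / (p - 2) * gnInt p) + 2 * gnInt p - 8 / 45 * soliton p R ^ 2 := by
  have hp2 : 0 < p - 2 := by linarith
  have h := corePower_eq hp R
  have h1 := corePower_le hp hR
  rw [core_mass hp]
  have h2 : 2 * ((p + 2) / (p - 2) * gnInt p) + 2 * gnInt p =
      p * (4 * gnInt p / (p - 2)) := by
    field_simp
    ring
  rw [h2]
  have h3 := mul_le_mul_of_nonneg_left h1 (by linarith : 0 ≤ p)
  have h4 := mul_le_mul_of_nonneg_left hT (sq_nonneg (soliton p R))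
  nlinarith

/-- Solitons centred on the loop of a signpost, with a short tail on its bounded edge. -/
theorem exists_level_le_of_signpost [Countable G.E] (hp : 6 < p) (hG : G.HasSignpost) :
    ∃ μ₀ : ℝ, 0 < μ₀ ∧ ∀ μ : ℝ, 0 < μ → μ ≤ μ₀ → ∃ r > (1 : ℝ),
      ∀ δ : ℝ, (G.setA μ δ).Nonempty → ∀ ρ ∈ Icc (1 / 2 : ℝ) 1,
        G.level p μ δ ρ ≤
          (fiberMax ((p - 2) / 2) (ρ / p * (r * (gnConst p 2 * μ ^ ((p + 2) / 4)))) : EReal) := by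
  classical
  obtain ⟨l, b, w, hlw, hbl, hbne, hbw, hdeg⟩ := hG
  have hp2 : 2 < p := by linarith
  have hI := gnInt_pos hp2
  obtain ⟨hll, hltgt⟩ := hlw.2
  obtain ⟨τ, x₀, hE⟩ := exists_hasEnds (L := {l}) hbw (by simpa using hbne)
    (fun l' hl' => by rw [mem_singleton_iff.1 hl']; exact hlw) (finite_singleton l)
    (by rw [hdeg, encard_singleton]; norm_num)
  obtain ⟨R₀, hR₀, hR₀s⟩ := exists_solitonRate_ge hp2
  have hLl := toReal_len_pos hll
  have hLb := toReal_len_pos hbl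
  set x₁ := (G.len l).toReal / 2 with hx₁
  have hx₁p : 0 < x₁ := by positivity
  have h2x₁ : 2 * x₁ = (G.len l).toReal := by rw [hx₁]; ring
  -- The first bound makes the asymptotic estimates valid at the vertex, at rescaled distance `s x₁`
  -- from the centre of the loop; the second lets the tail, of rescaled length `6`, fit on the
  -- bounded edge.
  set s₀ := max (R₀ / x₁) (6 / (G.len b).toReal) with hs₀
  have hs₀p : 0 < s₀ := lt_max_of_lt_left (by positivity)
  have hsR : ∀ s ≥ s₀, R₀ ≤ s * x₁ := fun s hs => by
    rw [← div_le_iff₀ hx₁p]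
    exact (le_max_left _ _).trans hs
  have hs6 : ∀ s ≥ s₀, 6 ≤ s * (G.len b).toReal := fun s hs => by
    rw [← div_le_iff₀ hLb]
    exact (le_max_right _ _).trans hs
  have hsc := continuous_soliton hp2
  have hrc := continuous_solitonRate (p := p)
  have htc : Continuous fun s => soliton p (s * x₁) := by fun_prop
  obtain ⟨U, hU, hUs⟩ := exists_profile_family (G := G) (S := {l, b})
    (X := max (G.len l).toReal (G.len b).toReal) (I := Ici s₀)
    (a := fun s e => if e = l then 1 else if e = b then soliton p (s * x₁) else 0)
    (h := fun e => if e = l then soliton p else tail)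
    (h' := fun e => if e = l then fun y => -(soliton p y * solitonRate p y) else tailDeriv)
    (τ := fun e => if e = l then 1 else τ) (x₀ := fun e => if e = l then x₁ else x₀)
    (fun e => by
      by_cases h1 : e = l
      · simp only [h1, if_true]; exact continuous_const
      · by_cases h2 : e = b
        · simp only [h2, hbne, if_true, if_false]; exact htc
        · simp only [h1, h2, if_false]; exact continuous_const)
    (fun e => by
      by_cases h1 : e = l
      · simp only [h1, if_true]; fun_prop
      · simp only [h1, if_false]; exact continuous_tailDeriv)
    (fun e y => by
      by_cases h1 : e = l
      · simp only [h1, if_true]; exact hasDerivAt_soliton hp2 y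
      · simp only [h1, if_false]; exact hasDerivAt_tail y)
    (fun e => by
      by_cases h1 : e = l
      · simp [h1]
      · simpa [h1] using hE.1.sq_eq_one)
    (by
      intro s hs e x hx hS
      by_cases h1 : e = l
      · subst h1
        rw [interval_of_ne_top hll] at hx
        exact absurd (hS (by simp)) (not_lt.2 (hx.2.trans (le_max_left _ _)))
      · by_cases h2 : e = b
        · subst h2
          rw [interval_of_ne_top hbl] at hx
          exact absurd (hS (by simp)) (not_lt.2 (hx.2.trans (le_max_right _ _)))
        · exact Or.inl (by simp [h1, h2]))
    (by
      intro s hs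
      -- By evenness the soliton has the same value at both ends of the loop; the amplitude of the
      -- tail is chosen to match it.
      refine ⟨fun w' => if w' = w then soliton p (s * x₁) else 0, fun e => ?_⟩
      by_cases h1 : e = l
      · subst h1
        refine ⟨?_, fun hl' => ?_⟩
        · simp only [if_true, hlw.1]
          rw [show s * (1 * (0 - x₁)) = -(s * x₁) by ring, soliton_neg, one_mul]
        · simp only [if_true, hltgt]
          rw [← h2x₁, show s * (1 * (2 * x₁ - x₁)) = s * x₁ by ring, one_mul]
      · by_cases h2 : e = b
        · subst h2
          obtain ⟨v1, v2, v3, v4⟩ := hE.src_value hbl (F := tail) (fun y hy => tail_of_le hy)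
            (hs6 s hs) (by simpa using h1)
          simp only [h1, if_true, if_false]
          refine ⟨?_, fun hl' => ?_⟩
          · by_cases hw : G.src e = w
            · rw [v1 hw, if_pos hw, tail_zero, mul_one]
            · rw [v2 hw, if_neg hw, mul_zero]
          · by_cases hw : G.tgt e hl' = w
            · rw [v3 hw, if_pos hw, tail_zero, mul_one]
            · rw [v4 hw, if_neg hw, mul_zero]
        · have h3 : G.src e ≠ w := fun hw => by simpa [h1, h2] using (hE.2.1 e).1 hw
          have h4 : ∀ hl', G.tgt e hl' ≠ w := fun hl' hw => by
            simpa [h1, h2] using (hE.2.2 e hl').1 hw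
          simp [h1, h2, h3, h4])
  have keyl : ∀ F : ℝ → ℝ, Continuous F → (∀ y, F (-y) = F y) → ∀ s ≥ s₀,
      ∫ x in G.interval l, F (s * (1 * (x - x₁))) =
        s⁻¹ * (2 * ∫ y in (0 : ℝ)..(s * x₁), F y) := by
    intro F hF hFe s hs
    have h2 : 2 * x₁ ∈ G.interval l := by
      rw [interval_of_ne_top hll, h2x₁]
      exact ⟨hLl.le, le_rfl⟩
    refine setIntegral_center h2 hF hFe (hs₀p.trans_le hs) fun x hx hlt => ?_
    rw [interval_of_ne_top hll, ← h2x₁] at hx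
    exact absurd hx.2 (not_le.2 hlt)
  have keyb : ∀ F : ℝ → ℝ, Continuous F → (∀ y, 6 ≤ y → F y = 0) → ∀ s ≥ s₀,
      ∫ x in G.interval b, F (s * (τ * (x - x₀))) = s⁻¹ * ∫ y in (0 : ℝ)..6, F y := by
    intro F hF hF0 s hs
    have hsp := hs₀p.trans_le hs
    refine setIntegral_end hE.1 hF hsp (by norm_num) hF0 ?_
    rw [ENNReal.ofReal_le_iff_le_toReal hbl, div_le_iff₀' hsp]
    exact hs6 s hs
  have hspc := continuous_soliton_rpow hp2
  have htpc : Continuous fun y => |tail y| ^ p :=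
    continuous_tail.abs.rpow_const fun _ => Or.inr (by linarith)
  have hmass : ∀ s ≥ s₀, 0 ≤ s * x₁ := fun s hs => hR₀.le.trans (hsR s hs)
  refine exists_level_le_of_scaled hp two_pos one_pos hs₀p (U := U)
    (a := fun s => 2 * (∫ y in (0 : ℝ)..(s * x₁), soliton p y ^ 2) +
      soliton p (s * x₁) ^ 2 * (6 / 5))
    (b := fun s => 2 * coreKinetic p (s * x₁) + soliton p (s * x₁) ^ 2 * (2 / 9))
    (c := fun s => 2 * corePower p (s * x₁) + soliton p (s * x₁) ^ p * (6 / (2 * p + 1)))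
    (A := 2 * ((p + 2) / (p - 2) * gnInt p) + 6 / 5) (B := gnInt p)
    hU (fun s hs => (hUs s hs).1) ?_ ?_ ?_ ?_ ?_ hI ?_ ?_
  · intro s hs
    rw [(hUs s hs).2.1, Finset.sum_pair hbne.symm]
    simp only [if_true, hbne, if_false]
    rw [keyl (fun y => soliton p y ^ 2) (hsc.pow 2) (fun y => by simp only [soliton_neg]) s hs,
      keyb (fun y => tail y ^ 2) (continuous_tail.pow 2) (fun y hy => by simp [tail_of_le hy]) s hs,
      integral_tail_sq]
    ring
  · intro s hs
    have hsp := hs₀p.trans_le hs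
    rw [(hUs s hs).2.2.1, Finset.sum_pair hbne.symm]
    simp only [if_true, hbne, if_false, neg_sq]
    rw [keyl (fun y => (soliton p y * solitonRate p y) ^ 2) (by fun_prop)
        (fun y => by
          simp only [soliton_neg]
          rw [solitonRate, mul_neg, Real.tanh_neg, ← solitonRate, mul_neg, neg_sq]) s hs,
      keyb (fun y => tailDeriv y ^ 2) (continuous_tailDeriv.pow 2)
        (fun y hy => by simp [tailDeriv_of_le hy]) s hs, integral_tailDeriv_sq, ← coreKinetic]
    field_simp
  · intro s hs
    rw [(hUs s hs).2.2.2 p (by linarith), Finset.sum_pair hbne.symm]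
    simp only [if_true, hbne, if_false, abs_of_pos (soliton_pos _), abs_one, Real.one_rpow]
    rw [keyl (fun y => soliton p y ^ p) hspc (fun y => by simp only [soliton_neg]) s hs,
      keyb (fun y => |tail y| ^ p) htpc
        (fun y hy => by simp [tail_of_le hy, Real.zero_rpow (by linarith : p ≠ 0)]) s hs,
      integral_tail_rpow (by linarith), ← corePower]
    ring
  · intro s hs
    have h1 : 0 ≤ ∫ y in (0 : ℝ)..(s * x₁), soliton p y ^ 2 :=
      intervalIntegral.integral_nonneg (hmass s hs) fun y _ => sq_nonneg _
    have h2 := pow_pos (soliton_pos (p := p) (s * x₁)) 2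
    positivity
  · intro s hs
    have h1 := core_mass_le hp2 (hmass s hs)
    have h2 : soliton p (s * x₁) ^ 2 ≤ 1 :=
      pow_le_one₀ (soliton_pos _).le (soliton_le_one hp2 _)
    linarith
  · intro s hs
    have h1 := two_mul_calib_le_sq hp2 (s * x₁)
    have h2 := (hR₀s _ (hsR s hs)).2
    have h3 := sq_nonneg (soliton p (s * x₁))
    rw [coreKinetic_eq hp2 (hmass s hs)]
    linarith
  · intro s₁ hs₁
    have hT₀ : 0 < 2 * ((p + 2) / (p - 2) * gnInt p) + 2 * gnInt p := by
      have : 0 < (p + 2) / (p - 2) := div_pos (by linarith) (by linarith)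
      positivity
    set T₀ := 2 * ((p + 2) / (p - 2) * gnInt p) + 2 * gnInt p with hT₀def
    -- The relative gain at `s₁`, the smallest over `[s₀, s₁]` as the soliton decreases. It
    -- degenerates as `s₁ → ∞`, so `r` must depend on `s₁`. On this interval the sum is at most `(1
    -- - y) T₀`, and `(1 + y)(1 - y) ≤ 1`.
    set y := 8 / 45 * soliton p (s₁ * x₁) ^ 2 / T₀ with hy
    have hyp : 0 < y := by
      have := pow_pos (soliton_pos (p := p) (s₁ * x₁)) 2
      positivity
    refine ⟨(1 + y) ^ (p / 2), Real.one_lt_rpow (by linarith) (by linarith), fun s hs => ?_⟩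
    have hT := (hR₀s _ (hsR s hs.1)).1
    have hm := hmass s hs.1
    have hsol := pow_pos (soliton_pos (p := p) (s * x₁)) 2
    have hkin : 0 ≤ coreKinetic p (s * x₁) :=
      intervalIntegral.integral_nonneg hm fun y _ => sq_nonneg _
    have hmas : 0 ≤ ∫ y in (0 : ℝ)..(s * x₁), soliton p y ^ 2 :=
      intervalIntegral.integral_nonneg hm fun y _ => sq_nonneg _
    refine gnConst_mul_le_of_add hp2 two_pos (by positivity) (by positivity) (by positivity) ?_
      (corePower_add_ge hp hm hT)
    rw [← Real.rpow_mul (by linarith), show p / 2 * (2 / p) = 1 by field_simp, Real.rpow_one,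
      ← hT₀def]
    have h1 := signpost_add_le hp2 hm hT
    rw [← hT₀def] at h1
    have h2 : soliton p (s₁ * x₁) ≤ soliton p (s * x₁) := by
      refine soliton_le_soliton hp2 hm (le_trans ?_ (le_abs_self _))
      exact mul_le_mul_of_nonneg_right hs.2 hx₁p.le
    have h3 : soliton p (s₁ * x₁) ^ 2 ≤ soliton p (s * x₁) ^ 2 :=
      pow_le_pow_left₀ (soliton_pos _).le h2 2
    have h4 : 8 / 45 * soliton p (s₁ * x₁) ^ 2 = y * T₀ := by
      rw [hy]
      field_simp
    refine (mul_le_mul_of_nonneg_left h1 (by linarith)).trans ?_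
    have h5 : T₀ - 8 / 45 * soliton p (s * x₁) ^ 2 ≤ T₀ - y * T₀ := by linarith
    refine (mul_le_mul_of_nonneg_left h5 (by linarith)).trans ?_
    nlinarith [mul_pos hT₀ (pow_pos hyp 2)]

end Signpost

end MetricGraph

/-! ### Comparison of levels and conclusion. -/

namespace MetricGraph

open Filter Topology

variable {G : MetricGraph.{u, v}} {p : ℝ}

theorem not_nonempty_setA [IsEmpty G.E] {μ δ : ℝ} (hμ : 0 < μ) : ¬ (G.setA μ δ).Nonempty := by
  rintro ⟨w, hw, -⟩
  have h := norm_sq_eq_integral w.1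
  rw [hw.2, integral_of_isEmpty] at h
  exact hμ.ne' h

theorem line_hasGNBound (hp : 2 < p) {μ : ℝ} (hμ : 0 < μ) :
    line.HasGNBound p μ (gnConst p 2 * μ ^ ((p + 2) / 4)) :=
  isCalibrated_line.hasGNBound two_pos hp hμ

theorem halfLine_hasGNBound (hp : 2 < p) {μ : ℝ} (hμ : 0 < μ) :
    halfLine.HasGNBound p μ (gnConst p 1 * μ ^ ((p + 2) / 4)) :=
  isCalibrated_halfLine.hasGNBound one_pos hp hμ

/-- Comparison of the level of `G` with that of a graph with a Gagliardo-Nirenberg bound. -/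
theorem level_le_mul_of_gnBound {G' : MetricGraph.{0, 0}} (hp : 6 < p) {μ Λ r r₀ ε δ δ' ρ : ℝ}
    (h : G'.HasGNBound p μ Λ) (hΛ : 0 < Λ) (hex : ∀ x > 0, ∃ w ∈ G'.H1mass μ, ‖w.2‖ = x)
    (hρ : ρ ∈ Icc (1 / 2 : ℝ) 1) (hδ' : G'.IsMountainPass p μ δ') (hε : 0 < ε)
    (hr₀ : r₀ = (1 + ε) ^ (-(((p - 2) / 2 - 2) / 2))) (hr : r₀ < r)
    (hG : G.level p μ δ ρ ≤ (fiberMax ((p - 2) / 2) (ρ / p * (r * Λ)) : EReal)) :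
    G.level p μ δ ρ ≤ ((1 + ε : ℝ) : EReal) * G'.level p μ δ' ρ := by
  have hq : 2 < (p - 2) / 2 := by linarith
  have hρ0 : 0 < ρ := by linarith [hρ.1]
  have ha : 0 < ρ / p * Λ := by positivity
  have hr₀p : 0 < r₀ := by rw [hr₀]; positivity
  have h1 : fiberMax ((p - 2) / 2) (ρ / p * (r * Λ)) ≤
      (1 + ε) * fiberMax ((p - 2) / 2) (ρ / p * Λ) := by
    rw [show ρ / p * (r * Λ) = r * (ρ / p * Λ) by ring]
    refine (fiberMax_anti hq (mul_pos hr₀p ha) (mul_le_mul_of_nonneg_right hr.le ha.le)).trans ?_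
    rw [fiberMax_mul hq ha hr₀p, hr₀, ← Real.rpow_mul (by linarith), ← Real.rpow_natCast,
      ← Real.rpow_mul (by linarith)]
    -- The threshold `r₀ = (1 + ε)^(-(q-2)/2)` is the one for which the homogeneity factor
    -- `r₀^(-2/(q-2))` equals `1 + ε`.
    rw [show -(((p - 2) / 2 - 2) / 2) * -((p - 2) / 2 - 2)⁻¹ * ((2 : ℕ) : ℝ) = 1 by
      rw [neg_mul_neg, Nat.cast_ofNat, mul_right_comm, div_mul_cancel₀ _ two_ne_zero]
      exact mul_inv_cancel₀ (by linarith), Real.rpow_one]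
  refine hG.trans ((EReal.coe_le_coe_iff.2 h1).trans ?_)
  rw [EReal.coe_mul]
  exact mul_le_mul_of_nonneg_left (h.fiberMax_le_level hp hΛ hex hρ hδ')
    (EReal.coe_nonneg.2 (by linarith))

theorem level_lt_of_gnBound {G' : MetricGraph.{0, 0}} (hp : 6 < p) {μ Λ r δ δ' ρ : ℝ}
    (h : G'.HasGNBound p μ Λ) (hΛ : 0 < Λ) (hex : ∀ x > 0, ∃ w ∈ G'.H1mass μ, ‖w.2‖ = x)
    (hρ : ρ ∈ Icc (1 / 2 : ℝ) 1) (hδ' : G'.IsMountainPass p μ δ') (hr : 1 < r)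
    (hG : G.level p μ δ ρ ≤ (fiberMax ((p - 2) / 2) (ρ / p * (r * Λ)) : EReal)) :
    G.level p μ δ ρ < G'.level p μ δ' ρ := by
  have hq : 2 < (p - 2) / 2 := by linarith
  have hρ0 : 0 < ρ := by linarith [hρ.1]
  have ha : 0 < ρ / p * Λ := by positivity
  have h1 : fiberMax ((p - 2) / 2) (ρ / p * (r * Λ)) < fiberMax ((p - 2) / 2) (ρ / p * Λ) := by
    rw [show ρ / p * (r * Λ) = r * (ρ / p * Λ) by ring, fiberMax_mul hq ha (by linarith)]
    refine mul_lt_of_lt_one_left (fiberMax_pos hq ha) ?_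
    refine pow_lt_one₀ (by positivity) ?_ two_ne_zero
    refine Real.rpow_lt_one_of_one_lt_of_neg hr ?_
    rw [neg_lt_zero, inv_pos]
    linarith
  exact hG.trans_lt ((EReal.coe_lt_coe_iff.2 h1).trans_le (h.fiberMax_le_level hp hΛ hex hρ hδ'))

end MetricGraph

theorem proposition4p3 (p : ℝ) (hp : 6 < p) :
    -- the levels of the line and of the half-line are well defined
    (∀ μ : ℝ, 0 < μ →
      (∃ δ, MetricGraph.line.IsMountainPass p μ δ) ∧
      (∃ δ, MetricGraph.halfLine.IsMountainPass p μ δ)) ∧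
    ∀ G : MetricGraph.{u, v}, G.InClassG →
      (∀ ε : ℝ, 0 < ε → ∃ μ₀ : ℝ, 0 < μ₀ ∧ ∀ μ : ℝ, 0 < μ → μ ≤ μ₀ →
        ∀ δ : ℝ, 0 < δ → (G.setA μ δ).Nonempty →
        ∀ δ' : ℝ, MetricGraph.line.IsMountainPass p μ δ' →
        ∀ ρ ∈ Icc (1 / 2 : ℝ) 1,
          G.level p μ δ ρ ≤ ((1 + ε : ℝ) : EReal) * MetricGraph.line.level p μ δ' ρ) ∧
      (G.HasPendant →
        ∀ ε : ℝ, 0 < ε → ∃ μ₀ : ℝ, 0 < μ₀ ∧ ∀ μ : ℝ, 0 < μ → μ ≤ μ₀ →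
        ∀ δ : ℝ, 0 < δ → (G.setA μ δ).Nonempty →
        ∀ δ' : ℝ, MetricGraph.halfLine.IsMountainPass p μ δ' →
        ∀ ρ ∈ Icc (1 / 2 : ℝ) 1,
          G.level p μ δ ρ ≤ ((1 + ε : ℝ) : EReal) * MetricGraph.halfLine.level p μ δ' ρ) ∧
      (G.HasSignpost →
        ∃ μ₀ : ℝ, 0 < μ₀ ∧ ∀ μ : ℝ, 0 < μ → μ ≤ μ₀ →
        ∀ δ : ℝ, 0 < δ → (G.setA μ δ).Nonempty →
        ∀ δ' : ℝ, MetricGraph.line.IsMountainPass p μ δ' →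
        ∀ ρ ∈ Icc (1 / 2 : ℝ) 1,
          G.level p μ δ ρ < MetricGraph.line.level p μ δ' ρ) := by
  have hp2 : 2 < p := by linarith
  have hΛ : ∀ θ : ℝ, 0 < θ → ∀ μ : ℝ, 0 < μ → 0 < MetricGraph.gnConst p θ * μ ^ ((p + 2) / 4) :=
    fun θ hθ μ hμ => mul_pos (MetricGraph.gnConst_pos hp2 hθ) (Real.rpow_pos_of_pos hμ _)
  have hline : ∀ μ : ℝ, 0 < μ → ∀ x > 0, ∃ w ∈ MetricGraph.line.H1mass μ, ‖w.2‖ = x :=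
    fun μ hμ x hx => MetricGraph.exists_norm_snd_eq (fun _ => rfl) hμ hx
  have hhalf : ∀ μ : ℝ, 0 < μ → ∀ x > 0, ∃ w ∈ MetricGraph.halfLine.H1mass μ, ‖w.2‖ = x :=
    fun μ hμ x hx => MetricGraph.exists_norm_snd_eq (fun _ => rfl) hμ hx
  refine ⟨fun μ hμ => ⟨(MetricGraph.line_hasGNBound hp2 hμ).exists_isMountainPass hp (hΛ 2 two_pos μ hμ)
    (hline μ hμ), (MetricGraph.halfLine_hasGNBound hp2 hμ).exists_isMountainPass hp (hΛ 1 one_pos μ hμ)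
    (hhalf μ hμ)⟩, fun G hG => ?_⟩
  have : Countable G.E := hG.countable
  have hr₀ : ∀ ε : ℝ, 0 < ε → 0 < (1 + ε) ^ (-(((p - 2) / 2 - 2) / 2)) ∧
      (1 + ε) ^ (-(((p - 2) / 2 - 2) / 2)) < 1 := fun ε hε =>
    ⟨by positivity, Real.rpow_lt_one_of_one_lt_of_neg (by linarith) (by linarith)⟩
  refine ⟨fun ε hε => ?_, fun hP ε hε => ?_, fun hS => ?_⟩
  · rcases isEmpty_or_nonempty G.E with hE | ⟨⟨e⟩⟩
    · exact ⟨1, one_pos, fun μ hμ _ δ _ hA => absurd hA (MetricGraph.not_nonempty_setA hμ)⟩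
    · obtain ⟨μ₀, hμ₀, H⟩ := MetricGraph.exists_level_le_of_edge hp e (hr₀ ε hε).1 (hr₀ ε hε).2
      refine ⟨μ₀, hμ₀, fun μ hμ hμle δ _ hA δ' hδ' ρ hρ => ?_⟩
      obtain ⟨r, hr, Hr⟩ := H μ hμ hμle
      exact MetricGraph.level_le_mul_of_gnBound hp (MetricGraph.line_hasGNBound hp2 hμ) (hΛ 2 two_pos μ hμ) (hline μ hμ)
        hρ hδ' hε rfl hr (Hr δ hA ρ hρ)
  · obtain ⟨μ₀, hμ₀, H⟩ := MetricGraph.exists_level_le_of_pendant hp hP (hr₀ ε hε).1 (hr₀ ε hε).2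
    refine ⟨μ₀, hμ₀, fun μ hμ hμle δ _ hA δ' hδ' ρ hρ => ?_⟩
    obtain ⟨r, hr, Hr⟩ := H μ hμ hμle
    exact MetricGraph.level_le_mul_of_gnBound hp (MetricGraph.halfLine_hasGNBound hp2 hμ) (hΛ 1 one_pos μ hμ) (hhalf μ hμ)
      hρ hδ' hε rfl hr (Hr δ hA ρ hρ)
  · obtain ⟨μ₀, hμ₀, H⟩ := MetricGraph.exists_level_le_of_signpost hp hS
    refine ⟨μ₀, hμ₀, fun μ hμ hμle δ _ hA δ' hδ' ρ hρ => ?_⟩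
    obtain ⟨r, hr, Hr⟩ := H μ hμ hμle
    exact MetricGraph.level_lt_of_gnBound hp (MetricGraph.line_hasGNBound hp2 hμ) (hΛ 2 two_pos μ hμ) (hline μ hμ)
      hρ hδ' hr (Hr δ hA ρ hρ)
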